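/- **Theorem.** Let $c\ge \frac32$ be real and let $V=V_{\overline 0}\oplus V_{\overline 1}$ be a complex vector superspace with even operators $L_m$ ($m\in\mathbb Z$) and odd operators $G_n$ ($n\in\mathbb Z-\frac12$) that form a representation of the Neveu–Schwarz algebra with central charge $c$: $$[L_m,L_n]=(m-n)L_{m+n}+\tfrac{c(m^3-m)}{12}\delta_{m,-n},\quad [L_m,G_n]=\left(\tfrac m2-n\right)G_{m+n},\quad [G_m,G_n]=2L_{m+n}+\tfrac c3\left(m^2-\tfrac14\right)\delta_{m,-n},$$ where the last bracket is the anticommutator. Suppose that (i) there is a nonzero even vector $\Omega$ with $L_0\Omega=0$ and $L_m\Omega=G_n\Omega=0$ for all $m,n>0$, and $\Omega$ is cyclic (no proper subspace that is invariant under all $L_m$, $G_n$ contains $\Omega$); (ii) there is a (positive definite) scalar product $(\cdot|\cdot)$ on $V$, linear in the second variable, such that $T(z)=\sum_{m\in\mathbb Z}L_mz^{-m}$ and $G(z)=\sum_{n\in\mathbb Z-\frac12}G_nz^{-n}$ satisfy $$\bigl(p(z)T(z)\bigr)^\dagger=\overline p(z)T(z)\quad\text{and}\quad \bigl(p(z)z^{\frac12}G(z)\bigr)^\dagger=\overline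 p(z)z^{-\frac12}G(z)$$ as formal series, for all trigonometric polynomials $p(z)=\sum_{|n|<N}p_nz^{-n}$ with $p(-1)=0$. Here $\overline p(z)=\sum_{|n|<N}\overline{p_{-n}}z^{-n}$; for a formal series $A(z)=\sum_{n\in\frac12\mathbb Z}A_nz^{-n}$ one sets $A(z)^\dagger=\sum_n A_n^\dagger z^n$, and $A_n^\dagger=B$ means that $(A_nx|y)=(x|By)$ for all $x,y\in V$. Then $L_m^\dagger=L_{-m}$ for all $m\in\mathbb Z$ and $G_n^\dagger=G_{-n}$ for all $n\in\mathbb Z-\frac12$, that is, the representation is unitary. Furthermore, $V$ has a structure of vertex operator superalgebra (VOSA) with central charge $c$, with the given parity, with vacuum vector $\Omega$ and conformal vector $\nu=L_{-2}\Omega$, such that, with $\tau=G_{-\frac32}\Omega$, one has $Y(\nu,z)=\sum_mL_mz^{-m-2}$ and $Y(\tau,z)=\sum_nG_nz^{-n-\frac32}$. It is simple, and it is unitary with respect to the normalized scalar product $(\cdot|\cdot)/(\Omega|\Omega)$, i.e. there is an antilinear VOSA involution $\theta$ such that $(Y(\theta(a),z)b|d)=(b|Y(e^{zL_1}(-1)^{2L_0^2+L_0}z^{-2L_0}a,z^{-1})d)$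 for all $a,b,d\in V$, for the normalized scalar product. Finally, it is isomorphic, by an isomorphism of VOSAs that preserves the scalar products, to the $N=1$ super-Virasoro VOSA $V^c(NS)$ with a suitable unitary structure. Here $V^c(NS)$ is the VOSA on the irreducible lowest weight module of the Neveu–Schwarz algebra with central charge $c$ and lowest weight $0$, in which the vacuum is the lowest weight vector $\Omega_c$, the conformal vector is $\nu_c=L_{-2}\Omega_c$, and $Y(\nu_c,z)=\sum_mL_mz^{-m-2}$, $Y(G_{-\frac32}\Omega_c,z)=\sum_nG_nz^{-n-\frac32}$. -/

import Mathlib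

/-! ## Scalar products and adjoints -/

/-- `IsAdjointOf ip A B` says that the operator `A` on `V` has the adjoint `A† = B` with respect to
the scalar product `ip` (linear in the second variable): `(A x | y) = (x | B y)`. -/
def IsAdjointOf {V : Type*} [AddCommGroup V] [Module ℂ V] (ip : InnerProductSpace.Core ℂ V)
    (A B : Module.End ℂ V) : Prop :=
  ∀ x y : V, ip.inner (A x) y = ip.inner x (B y)

/-! ## Trigonometric polynomials and formal series -/

/-- Trigonometric polynomials `p(z) = ∑_n p_n z^n`, `n ∈ ℤ`, given by their coefficients. -/
abbrev TrigPoly : Type := ℤ →₀ ℂ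

namespace TrigPoly

/-- The complex conjugate `p̄(z) = ∑_n conj(p_n) z^{-n}`. -/
noncomputable def conj (p : TrigPoly) : TrigPoly :=
  p.sum fun n a => Finsupp.single (-n) (starRingEnd ℂ a)

/-- The value `p(w)` at a complex number `w` (used for `w ≠ 0`). -/
noncomputable def eval (w : ℂ) (p : TrigPoly) : ℂ :=
  p.sum fun n a => a * w ^ n

end TrigPoly

/-- A formal series `A(z) = ∑_{n ∈ ½ℤ} A_n z^{-n}` with coefficients in `End V`.
The index is doubled: the value at `k : ℤ` is the coefficient `A_{k/2}` of `z^{-k/2}`. -/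
abbrev FormalSeries (V : Type*) [AddCommGroup V] [Module ℂ V] : Type _ := ℤ → Module.End ℂ V

namespace FormalSeries

/-- The product `z^{j/2} A(z)`. -/
def halfShift {V : Type*} [AddCommGroup V] [Module ℂ V] (j : ℤ) (A : FormalSeries V) :
    FormalSeries V :=
  fun k => A (k + j)

/-- The product `p(z) A(z)` with a trigonometric polynomial `p(z) = ∑_n p_n z^n`: the coefficient
of `z^{-k/2}` is `∑_n p_n A_{k/2 + n}`. -/
noncomputable def polyMul {V : Type*} [AddCommGroup V] [Module ℂ V] (p : TrigPoly)
    (A : FormalSeries V) : FormalSeries V :=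
  fun k => p.sum fun n a => a • A (k + 2 * n)

/-- `A(z)† = B(z)`, where `A(z)† = ∑_n A_n† z^n`: every `A_n` has the adjoint `A_n† = B_{-n}`. -/
def DaggerEq {V : Type*} [AddCommGroup V] [Module ℂ V] (ip : InnerProductSpace.Core ℂ V)
    (A B : FormalSeries V) : Prop :=
  ∀ k : ℤ, IsAdjointOf ip (A k) (B (-k))

end FormalSeries

/-! ## Representations of the Neveu-Schwarz algebra -/

/-- A vector superspace `V` with operators `L_m`, `m ∈ ℤ`, and `G_n`, `n ∈ ℤ - 1/2`.
`parity 0` and `parity 1` are the even and the odd part; `G r` stands for `G_{r + 1/2}`. -/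
structure NSAction (V : Type*) [AddCommGroup V] [Module ℂ V] where
  parity : ZMod 2 → Submodule ℂ V
  L : ℤ → Module.End ℂ V
  G : ℤ → Module.End ℂ V

namespace NSAction

/-- `V` is a vector superspace on which the `L_m` (even) and the `G_n` (odd) form a representation
of the Neveu-Schwarz Lie superalgebra with central charge `c`. -/
structure IsRepresentation {V : Type*} [AddCommGroup V] [Module ℂ V] (ρ : NSAction V) (c : ℂ) :
    Prop where
  parity_internal : DirectSum.IsInternal ρ.parity
  L_parity : ∀ (m : ℤ) (p : ZMod 2), ∀ x ∈ ρ.parity p, ρ.L m x ∈ ρ.parity p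
  G_parity : ∀ (r : ℤ) (p : ZMod 2), ∀ x ∈ ρ.parity p, ρ.G r x ∈ ρ.parity (p + 1)
  /-- `[L_m, L_n] = (m - n) L_{m+n} + c (m³ - m) / 12 δ_{m,-n}` -/
  comm_LL : ∀ m n : ℤ, ρ.L m * ρ.L n - ρ.L n * ρ.L m =
    ((m : ℂ) - n) • ρ.L (m + n) +
      (if m = -n then c * ((m : ℂ) ^ 3 - m) / 12 else 0) • (1 : Module.End ℂ V)
  /-- `[L_m, G_n] = (m/2 - n) G_{m+n}`, where `n = r + 1/2` -/
  comm_LG : ∀ m r : ℤ, ρ.L m * ρ.G r - ρ.G r * ρ.L m =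
    ((m : ℂ) / 2 - ((r : ℂ) + 1 / 2)) • ρ.G (m + r)
  /-- `[G_m, G_n] = G_m G_n + G_n G_m = 2 L_{m+n} + c/3 (m² - 1/4) δ_{m,-n}`,
  where `m = r + 1/2` and `n = s + 1/2` -/
  comm_GG : ∀ r s : ℤ, ρ.G r * ρ.G s + ρ.G s * ρ.G r =
    (2 : ℂ) • ρ.L (r + s + 1) +
      (if r + s + 1 = 0 then c / 3 * (((r : ℂ) + 1 / 2) ^ 2 - 1 / 4) else 0) •
        (1 : Module.End ℂ V)

/-- `Ω` is a cyclic lowest weight vector with lowest weight `h`. -/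
structure IsCyclicLowestWeight {V : Type*} [AddCommGroup V] [Module ℂ V] (ρ : NSAction V)
    (Ω : V) (h : ℂ) : Prop where
  ne_zero : Ω ≠ 0
  L_zero : ρ.L 0 Ω = h • Ω
  L_pos : ∀ m : ℤ, 0 < m → ρ.L m Ω = 0
  G_pos : ∀ r : ℤ, 0 ≤ r → ρ.G r Ω = 0
  cyclic : ∀ W : Submodule ℂ V, Ω ∈ W → (∀ (m : ℤ), ∀ x ∈ W, ρ.L m x ∈ W) →
    (∀ (r : ℤ), ∀ x ∈ W, ρ.G r x ∈ W) → W = ⊤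

/-- The field `T(z) = ∑_{m ∈ ℤ} L_m z^{-m}`. -/
def seriesT {V : Type*} [AddCommGroup V] [Module ℂ V] (ρ : NSAction V) : FormalSeries V :=
  fun k => if Even k then ρ.L (k / 2) else 0

/-- The field `G(z) = ∑_{n ∈ ℤ - 1/2} G_n z^{-n}`. -/
def seriesG {V : Type*} [AddCommGroup V] [Module ℂ V] (ρ : NSAction V) : FormalSeries V :=
  fun k => if Odd k then ρ.G ((k - 1) / 2) else 0

/-- Weak symmetry: `(p(z) T(z))† = p̄(z) T(z)` and
`(p(z) z^{1/2} G(z))† = p̄(z) z^{-1/2} G(z)` for all trigonometric polynomials `p(z)` such that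
`p(-1) = 0`. -/
def IsWeaklySymmetric {V : Type*} [AddCommGroup V] [Module ℂ V] (ρ : NSAction V)
    (ip : InnerProductSpace.Core ℂ V) : Prop :=
  ∀ p : TrigPoly, p.eval (-1) = 0 →
    FormalSeries.DaggerEq ip (ρ.seriesT.polyMul p) (ρ.seriesT.polyMul p.conj) ∧
    FormalSeries.DaggerEq ip ((ρ.seriesG.halfShift 1).polyMul p)
      ((ρ.seriesG.halfShift (-1)).polyMul p.conj)

/-- The representation is unitary: `L_m† = L_{-m}` and `G_n† = G_{-n}`
(for `n = r + 1/2` one has `-n = (-r - 1) + 1/2`). -/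
def IsUnitary {V : Type*} [AddCommGroup V] [Module ℂ V] (ρ : NSAction V)
    (ip : InnerProductSpace.Core ℂ V) : Prop :=
  (∀ m : ℤ, IsAdjointOf ip (ρ.L m) (ρ.L (-m))) ∧
    (∀ r : ℤ, IsAdjointOf ip (ρ.G r) (ρ.G (-r - 1)))

end NSAction

/-! ## Vertex superalgebras and vertex operator superalgebras -/

/-- A vertex superalgebra structure on the complex vector space `V`. `Y a n` is the coefficient
`a_(n)` of the vertex operator `Y(a,z) = ∑_n a_(n) z^{-n-1}`, `vac` is the vacuum vector and `T` is
the infinitesimal translation operator. -/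
structure VertexSuperalgebra (V : Type*) [AddCommGroup V] [Module ℂ V] where
  parity : ZMod 2 → Submodule ℂ V
  parity_internal : DirectSum.IsInternal parity
  vac : V
  vac_even : vac ∈ parity 0
  T : Module.End ℂ V
  T_even : ∀ (p : ZMod 2), ∀ a ∈ parity p, T a ∈ parity p
  Y : V →ₗ[ℂ] (ℤ → Module.End ℂ V)
  Y_parity : ∀ (p q : ZMod 2) (n : ℤ), ∀ a ∈ parity p, ∀ b ∈ parity q, Y a n b ∈ parity (p + q)
  /-- the vertex operators are fields -/
  Y_field : ∀ a b : V, ∃ N : ℤ, ∀ n : ℤ, N ≤ n → Y a n b = 0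
  /-- `Y(Ω,z) = 1` -/
  Y_vac : ∀ n : ℤ, Y vac n = if n = -1 then 1 else 0
  /-- `Y(a,z)Ω` has no negative powers of `z` and its value at `z = 0` is `a` -/
  Y_apply_vac_nonneg : ∀ (a : V) (n : ℤ), 0 ≤ n → Y a n vac = 0
  Y_apply_vac : ∀ a : V, Y a (-1) vac = a
  T_vac : T vac = 0
  /-- translation covariance `[T, Y(a,z)] = ∂_z Y(a,z)` -/
  translation : ∀ (a : V) (n : ℤ), T * Y a n - Y a n * T = (-(n : ℂ)) • Y a (n - 1)
  /-- locality: `(z - w)^N [Y(a,z), Y(b,w)] = 0` for some `N`, with the supercommutator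
  `[A, B] = AB - (-1)^{pq} BA` -/
  locality : ∀ (p q : ZMod 2), ∀ a ∈ parity p, ∀ b ∈ parity q, ∃ N : ℕ, ∀ m n : ℤ,
    ∑ j ∈ Finset.range (N + 1), ((-1 : ℂ) ^ j * (N.choose j : ℂ)) •
      (Y a (m + N - j) * Y b (n + j) -
        ((-1 : ℂ) ^ (p.val * q.val)) • (Y b (n + j) * Y a (m + N - j))) = 0

namespace VertexSuperalgebra

/-- `ν` is a conformal vector with central charge `c`: it is even, the coefficients
`L_m = ν_(m+1)` satisfy the Virasoro relations with central charge `c`, `L_{-1} = T`, and `L_0` is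
diagonalizable. -/
structure IsConformalVector {V : Type*} [AddCommGroup V] [Module ℂ V] (S : VertexSuperalgebra V)
    (ν : V) (c : ℂ) : Prop where
  even : ν ∈ S.parity 0
  virasoro : ∀ m n : ℤ,
    S.Y ν (m + 1) * S.Y ν (n + 1) - S.Y ν (n + 1) * S.Y ν (m + 1) =
      ((m : ℂ) - n) • S.Y ν (m + n + 1) +
        (if m = -n then c * ((m : ℂ) ^ 3 - m) / 12 else 0) • (1 : Module.End ℂ V)
  L_neg_one : S.Y ν 0 = S.T
  diagonalizable : ⨆ μ : ℂ, Module.End.eigenspace (S.Y ν 1) μ = ⊤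

/-- An ideal: a `T`-invariant subspace `J` such that `a_(n) J ⊆ J` for all `a ∈ V`, `n ∈ ℤ`. -/
def IsIdeal {V : Type*} [AddCommGroup V] [Module ℂ V] (S : VertexSuperalgebra V)
    (J : Submodule ℂ V) : Prop :=
  (∀ x ∈ J, S.T x ∈ J) ∧ ∀ (a : V) (n : ℤ), ∀ x ∈ J, S.Y a n x ∈ J

/-- Simplicity: `V ≠ 0` and there are no ideals other than `0` and `V`. -/
def IsSimple {V : Type*} [AddCommGroup V] [Module ℂ V] (S : VertexSuperalgebra V) : Prop :=
  Nontrivial V ∧ ∀ J : Submodule ℂ V, S.IsIdeal J → J = ⊥ ∨ J = ⊤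

end VertexSuperalgebra

/-- A vertex operator superalgebra structure on `V`, with conformal vector `ν` and central charge
`c`. The space of conformal weight `n` is the `L_0`-eigenspace `V_n`, with `L_0 = ν_(1)`;
half-integers are written `k / 2` with `k : ℤ`. -/
structure VOSA (V : Type*) [AddCommGroup V] [Module ℂ V] extends VertexSuperalgebra V where
  ν : V
  c : ℂ
  conformal : toVertexSuperalgebra.IsConformalVector ν c
  finite_weight : ∀ k : ℤ, FiniteDimensional ℂ (Module.End.eigenspace (Y ν 1) ((k : ℂ) / 2))
  even_part : parity 0 = ⨆ n : ℤ, Module.End.eigenspace (Y ν 1) (n : ℂ)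
  odd_part : parity 1 = ⨆ n : ℤ, Module.End.eigenspace (Y ν 1) ((n : ℂ) - 1 / 2)
  bounded_below : ∃ N : ℤ, ∀ k : ℤ, k < 2 * N →
    Module.End.eigenspace (Y ν 1) ((k : ℂ) / 2) = ⊥

namespace VOSA

/-- `L_m = ν_(m+1)`. -/
def L {V : Type*} [AddCommGroup V] [Module ℂ V] (S : VOSA V) (m : ℤ) : Module.End ℂ V :=
  S.Y S.ν (m + 1)

/-- `θ` is an antilinear VOSA involution. -/
structure IsAntilinearInvolution {V : Type*} [AddCommGroup V] [Module ℂ V] (S : VOSA V)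
    (θ : V →ₗ⋆[ℂ] V) : Prop where
  involutive : ∀ a : V, θ (θ a) = a
  map_parity : ∀ (p : ZMod 2), ∀ a ∈ S.parity p, θ a ∈ S.parity p
  map_vac : θ S.vac = S.vac
  map_ν : θ S.ν = S.ν
  map_Y : ∀ (a b : V) (n : ℤ), θ (S.Y a n b) = S.Y (θ a) n (θ b)

/-- The scalar product `ip` makes the VOSA unitary: it is normalized, `(Ω|Ω) = 1`, and invariant,
i.e. there is an antilinear VOSA involution `θ` (the PCT operator) with
`(Y(θ(a),z) b | c) = (b | Y(e^{z L_1} (-1)^{2 L_0² + L_0} z^{-2 L_0} a, z^{-1}) c)`.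
The identity is written for `a` of conformal weight `d/2`, comparing the coefficients of
`z^{-n-1}`; note that `2 (d/2)² + d/2 = d (d+1) / 2` is an integer and that only finitely many
terms of the sum are nonzero. -/
structure IsUnitary {V : Type*} [AddCommGroup V] [Module ℂ V] (S : VOSA V)
    (ip : InnerProductSpace.Core ℂ V) : Prop where
  normalized : ip.inner S.vac S.vac = 1
  invariant : ∃ θ : V →ₗ⋆[ℂ] V, S.IsAntilinearInvolution θ ∧
    ∀ (d n : ℤ), ∀ a ∈ Module.End.eigenspace (S.L 0) ((d : ℂ) / 2), ∀ b c : V,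
      ip.inner (S.Y (θ a) n b) c =
        (-1 : ℂ) ^ (d * (d + 1) / 2) *
          ∑ᶠ j : ℕ, (1 / (j.factorial : ℂ)) *
            ip.inner b (S.Y ((S.L 1 ^ j) a) (d - n - 2 - j) c)

/-- `φ` is an isomorphism of VOSAs. -/
structure IsIso {V W : Type*} [AddCommGroup V] [Module ℂ V] [AddCommGroup W] [Module ℂ W]
    (S : VOSA V) (S' : VOSA W) (φ : V ≃ₗ[ℂ] W) : Prop where
  map_parity : ∀ (p : ZMod 2), ∀ a ∈ S.parity p, φ a ∈ S'.parity p
  map_vac : φ S.vac = S'.vac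
  map_ν : φ S.ν = S'.ν
  map_Y : ∀ (a b : V) (n : ℤ), φ (S.Y a n b) = S'.Y (φ a) n (φ b)

/-- The VOSA `S` is a VOSA structure on the representation `ρ` of the Neveu-Schwarz algebra: the
superspace is the one of `ρ`, the vacuum vector is `Ω`, the conformal vector is `ν = L_{-2} Ω`, the
central charge is `c`, and, with `τ = G_{-3/2} Ω`,
`Y(ν,z) = ∑ L_m z^{-m-2}` and `Y(τ,z) = ∑ G_n z^{-n-3/2}`, i.e.
`ν_(m+1) = L_m` and `τ_(r+1) = G_{r+1/2}`.
(Such a structure is unique if `Ω` is cyclic for `ρ`.) -/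
structure IsStructureOn {V : Type*} [AddCommGroup V] [Module ℂ V] (S : VOSA V) (ρ : NSAction V)
    (Ω : V) (c : ℂ) : Prop where
  parity_eq : S.parity = ρ.parity
  vac_eq : S.vac = Ω
  ν_eq : S.ν = ρ.L (-2) Ω
  c_eq : S.c = c
  Y_ν : ∀ m : ℤ, S.Y (ρ.L (-2) Ω) (m + 1) = ρ.L m
  Y_τ : ∀ r : ℤ, S.Y (ρ.G (-2) Ω) (r + 1) = ρ.G r

end VOSA

/-! ## The `N = 1` super-Virasoro VOSA `V^c(NS)`

It is built on the irreducible lowest weight module of the Neveu-Schwarz algebra with central charge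
`c` and lowest weight `0`, i.e. on the quotient of the vacuum module by its largest proper
submodule. -/

/-- Generators of the Neveu-Schwarz algebra: `L m` is `L_m` and `G r` is `G_{r+1/2}`. -/
inductive NSGen : Type
  | L (m : ℤ) : NSGen
  | G (r : ℤ) : NSGen

/-- The parity of a generator. -/
def NSGen.parity : NSGen → ZMod 2
  | NSGen.L _ => 0
  | NSGen.G _ => 1

/-- The relations of the Neveu-Schwarz algebra with central charge `c`. -/
inductive NSRel (c : ℂ) : FreeAlgebra ℂ NSGen → FreeAlgebra ℂ NSGen → Prop
  | LL (m n : ℤ) : NSRel c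
      (FreeAlgebra.ι ℂ (NSGen.L m) * FreeAlgebra.ι ℂ (NSGen.L n) -
        FreeAlgebra.ι ℂ (NSGen.L n) * FreeAlgebra.ι ℂ (NSGen.L m))
      (((m : ℂ) - n) • FreeAlgebra.ι ℂ (NSGen.L (m + n)) +
        (if m = -n then c * ((m : ℂ) ^ 3 - m) / 12 else 0) • (1 : FreeAlgebra ℂ NSGen))
  | LG (m r : ℤ) : NSRel c
      (FreeAlgebra.ι ℂ (NSGen.L m) * FreeAlgebra.ι ℂ (NSGen.G r) -
        FreeAlgebra.ι ℂ (NSGen.G r) * FreeAlgebra.ι ℂ (NSGen.L m))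
      (((m : ℂ) / 2 - ((r : ℂ) + 1 / 2)) • FreeAlgebra.ι ℂ (NSGen.G (m + r)))
  | GG (r s : ℤ) : NSRel c
      (FreeAlgebra.ι ℂ (NSGen.G r) * FreeAlgebra.ι ℂ (NSGen.G s) +
        FreeAlgebra.ι ℂ (NSGen.G s) * FreeAlgebra.ι ℂ (NSGen.G r))
      ((2 : ℂ) • FreeAlgebra.ι ℂ (NSGen.L (r + s + 1)) +
        (if r + s + 1 = 0 then c / 3 * (((r : ℂ) + 1 / 2) ^ 2 - 1 / 4) else 0) •
          (1 : FreeAlgebra ℂ NSGen))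

/-- The universal enveloping algebra of the Neveu-Schwarz algebra with the central element acting
as `c`. -/
abbrev NSEnveloping (c : ℂ) : Type := RingQuot (NSRel c)

/-- The image of a generator in the enveloping algebra. -/
noncomputable def NSEnveloping.gen (c : ℂ) (x : NSGen) : NSEnveloping c :=
  RingQuot.mkAlgHom ℂ (NSRel c) (FreeAlgebra.ι ℂ x)

/-- The largest proper left ideal of the enveloping algebra that contains `L_m` for `m ≥ -1` and
`G_n` for `n ≥ -1/2`, as the sum of all proper left ideals with this property. -/
noncomputable def NSEnveloping.vacuumIdeal (c : ℂ) : Submodule (NSEnveloping c) (NSEnveloping c) :=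
  sSup {I | I ≠ ⊤ ∧ (∀ m : ℤ, -1 ≤ m → NSEnveloping.gen c (NSGen.L m) ∈ I) ∧
    (∀ r : ℤ, -1 ≤ r → NSEnveloping.gen c (NSGen.G r) ∈ I)}

/-- The underlying space of `V^c(NS)`: the irreducible vacuum module of the Neveu-Schwarz algebra
with central charge `c`. -/
abbrev SuperVirasoro (c : ℂ) : Type := NSEnveloping c ⧸ NSEnveloping.vacuumIdeal c

namespace SuperVirasoro

/-- The vacuum vector of `V^c(NS)`. -/
noncomputable def vac (c : ℂ) : SuperVirasoro c :=
  Submodule.Quotient.mk (1 : NSEnveloping c)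

/-- The action of the Neveu-Schwarz algebra on `V^c(NS)` by left multiplication; the even (odd)
part is spanned by the `x₁ ⋯ x_k Ω` in which an even (odd) number of the generators `x_i` is
odd. -/
noncomputable def action (c : ℂ) : NSAction (SuperVirasoro c) where
  parity p := Submodule.span ℂ {v | ∃ w : List NSGen, (w.map NSGen.parity).sum = p ∧
    v = Submodule.Quotient.mk (w.map (NSEnveloping.gen c)).prod}
  L m := Algebra.lsmul ℂ ℂ (SuperVirasoro c) (NSEnveloping.gen c (NSGen.L m))
  G r := Algebra.lsmul ℂ ℂ (SuperVirasoro c) (NSEnveloping.gen c (NSGen.G r))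

/-- `S` is the VOSA `V^c(NS)`. -/
def IsVOSA (c : ℂ) (S : VOSA (SuperVirasoro c)) : Prop :=
  S.IsStructureOn (action c) (vac c) c

end SuperVirasoro

/-! Every induction runs over words in G_{-1/2} and G_{-3/2} applied to Ω. These two operators
generate all operators of negative energy (`NSRelations.mem_of_neg`), so by cyclicity the words span
V. They are also the modes τ_(0) and τ_(-1) of τ(z), so two kinds of field products suffice to reach
every vector.

Unitarity. The polynomial z^n - (-1)^n vanishes at -1, so weak symmetry makes the adjoint defect of
mode n equal to (-1)^n times the defect of mode 0, separately for L and for G (`adjoint_defect`).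
For a fixed left vector, one vanishing defect therefore kills them all. Positivity gives G_{-1/2}Ω =
0, and the identity G_n² = L_{2n} trades a G-defect for an L-defect that is already known. An
induction over y shows that Ω is orthogonal to L_0 y and G_{-1/2} y (`inner_vacuum_neg`), and an
induction over the left vector gives unitarity.

VOSA structure. `fields` asks for translation covariance and for locality with respect to τ(z) only.
Goddard's argument shows that such a field is determined by its state (`eq_zero_of_apply_vac`).
Dong's lemma (`isLocal_natProd`, `isLocal_normalOrd`) builds, for every vector, fields that are
local with respect to all of `fields` and have the given state (`exists_fields`). Hence any two
fields are mutually local, fields and states correspond bijectively, and Y is the inverse of the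
state map.

Unitary structure. As c is real, the real span of the words is invariant under all generators, and
the scalar product is real on it. It is thus a real form of V, and θ is its complex conjugation.
Invariance is proved by induction over words: the opposite vertex operators satisfy the adjoint of
the recursion for Y(G_{-1/2}a, z) and Y(G_{-3/2}a, z) (`inner_Y_gWord`).

Irreducibility. Let a proper left ideal I of the enveloping algebra contain L_m for m ≥ -1 and G_n
for n ≥ -1/2. Comparing weight-zero components in U/I and in V gives (Ω|uΩ) = 0 for u in I; as I is
a left ideal, (y|uΩ) = 0 for all y, so uΩ = 0 (`eval_eq_zero_of_mem`). This yields both simplicity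
and the identification of V with the irreducible vacuum module. -/

/-! ## Neveu-Schwarz relations and words in the generators `G_{-1/2}`, `G_{-3/2}` -/

/-- The relations of the Neveu-Schwarz algebra for operators `L m = L_m`, `G r = G_{r + 1/2}`,
without reference to a parity. -/
structure NSRelations {V : Type*} [AddCommGroup V] [Module ℂ V] (L G : ℤ → Module.End ℂ V)
    (c : ℂ) : Prop where
  LL : ∀ m n : ℤ, L m * L n - L n * L m = ((m : ℂ) - n) • L (m + n) +
      (if m = -n then c * ((m : ℂ) ^ 3 - m) / 12 else 0) • (1 : Module.End ℂ V)
  LG : ∀ m r : ℤ, L m * G r - G r * L m = ((m : ℂ) / 2 - ((r : ℂ) + 1 / 2)) • G (m + r)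
  GG : ∀ r s : ℤ, G r * G s + G s * G r = (2 : ℂ) • L (r + s + 1) +
      (if r + s + 1 = 0 then c / 3 * (((r : ℂ) + 1 / 2) ^ 2 - 1 / 4) else 0) •
        (1 : Module.End ℂ V)

/-- A vector of lowest weight `0`. -/
structure IsNSVacuum {V : Type*} [AddCommGroup V] [Module ℂ V] (L G : ℤ → Module.End ℂ V)
    (Ω : V) : Prop where
  L_nonneg : ∀ m : ℤ, 0 ≤ m → L m Ω = 0
  G_nonneg : ∀ r : ℤ, 0 ≤ r → G r Ω = 0

/-- The vector obtained from `Ω` by a word in `G_{-1/2}` (`false`) and `G_{-3/2}` (`true`). -/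
def gWord {V : Type*} [AddCommGroup V] [Module ℂ V] (G : ℤ → Module.End ℂ V) (Ω : V) :
    List Bool → V
  | [] => Ω
  | b :: w => G (if b then -2 else -1) (gWord G Ω w)

/-- Twice the conformal weight of a word. -/
def gWeight : List Bool → ℕ
  | [] => 0
  | b :: w => (if b then 3 else 1) + gWeight w

theorem length_le_gWeight (w : List Bool) : w.length ≤ gWeight w := by
  induction w with
  | nil => simp
  | cons b w ih => cases b <;> simp [gWeight] <;> omega

theorem finite_gWeight_eq (k : ℕ) : {w : List Bool | gWeight w = k}.Finite :=
  (List.finite_length_le Bool k).subset fun w hw => by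
    have := length_le_gWeight w
    simp only [Set.mem_ofPred_eq] at hw ⊢
    omega

/-! ### Arithmetic of a scalar product given as a bare core -/

section ScalarProduct

variable {V : Type*} [AddCommGroup V] [Module ℂ V] (ip : InnerProductSpace.Core ℂ V)

theorem coreInner_add_right (x y z : V) :
    ip.inner x (y + z) = ip.inner x y + ip.inner x z :=
  let _ := ip
  InnerProductSpace.Core.inner_add_right x y z

theorem coreInner_smul_right (x y : V) (a : ℂ) : ip.inner x (a • y) = a * ip.inner x y :=
  let _ := ip
  InnerProductSpace.Core.inner_smul_right x y

theorem coreInner_sub_left (x y z : V) : ip.inner (x - y) z = ip.inner x z - ip.inner y z :=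
  let _ := ip
  InnerProductSpace.Core.inner_sub_left x y z

theorem coreInner_sub_right (x y z : V) : ip.inner x (y - z) = ip.inner x y - ip.inner x z :=
  let _ := ip
  InnerProductSpace.Core.inner_sub_right x y z

theorem coreInner_neg_right (x y : V) : ip.inner x (-y) = -ip.inner x y :=
  let _ := ip
  InnerProductSpace.Core.inner_neg_right x y

theorem coreInner_zero_left (x : V) : ip.inner 0 x = 0 :=
  let _ := ip
  InnerProductSpace.Core.inner_zero_left x

theorem coreInner_zero_right (x : V) : ip.inner x 0 = 0 :=
  let _ := ip
  InnerProductSpace.Core.inner_zero_right x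

theorem coreInner_sum_left {ι : Type*} (s : Finset ι) (f : ι → V) (x : V) :
    ip.inner (∑ i ∈ s, f i) x = ∑ i ∈ s, ip.inner (f i) x := by
  classical
  induction s using Finset.induction_on with
  | empty => simp [coreInner_zero_left]
  | insert i s hi ih => rw [Finset.sum_insert hi, Finset.sum_insert hi, ip.add_left, ih]

theorem coreInner_sum_right {ι : Type*} (s : Finset ι) (f : ι → V) (x : V) :
    ip.inner x (∑ i ∈ s, f i) = ∑ i ∈ s, ip.inner x (f i) := by
  classical
  induction s using Finset.induction_on with
  | empty => simp [coreInner_zero_right]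
  | insert i s hi ih =>
    rw [Finset.sum_insert hi, Finset.sum_insert hi, coreInner_add_right, ih]

end ScalarProduct

/-! ### Invariance of the span of words under the whole algebra -/

namespace NSRelations

variable {V : Type*} [AddCommGroup V] [Module ℂ V] {L G : ℤ → Module.End ℂ V} {c : ℂ}

theorem LG_apply (h : NSRelations L G c) (m r : ℤ) (x : V) :
    L m (G r x) = G r (L m x) + ((m : ℂ) / 2 - ((r : ℂ) + 1 / 2)) • G (m + r) x := by
  have := LinearMap.congr_fun (h.LG m r) x
  simp only [LinearMap.sub_apply, Module.End.mul_apply, LinearMap.smul_apply] at this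
  rw [← this]; abel

theorem GG_apply (h : NSRelations L G c) (r s : ℤ) (x : V) :
    G r (G s x) = -G s (G r x) + (2 : ℂ) • L (r + s + 1) x +
      (if r + s + 1 = 0 then c / 3 * (((r : ℂ) + 1 / 2) ^ 2 - 1 / 4) else 0) • x := by
  have := LinearMap.congr_fun (h.GG r s) x
  simp only [LinearMap.add_apply, Module.End.mul_apply, LinearMap.smul_apply,
    Module.End.one_apply] at this
  rw [add_assoc, ← this]; abel

theorem L_zero_gWord (h : NSRelations L G c) {Ω : V} (hΩ : IsNSVacuum L G Ω) (w : List Bool) :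
    L 0 (gWord G Ω w) = ((gWeight w : ℂ) / 2) • gWord G Ω w := by
  induction w with
  | nil => simp [gWord, gWeight, hΩ.L_nonneg 0 le_rfl]
  | cons b w ih =>
    rw [gWord, h.LG_apply, ih, map_smul, zero_add, ← add_smul]
    congr 1
    cases b <;> simp [gWeight] <;> ring

/-- The scalar is a real number cast to `ℂ` so that the formula can be used inside real subspaces
through `real_smul_mem`. -/
theorem GG_apply_of_ne (h : NSRelations L G c) {r s : ℤ} (hrs : r + s + 1 ≠ 0) (x : V) :
    L (r + s + 1) x = ((2⁻¹ : ℝ) : ℂ) • (G r (G s x) + G s (G r x)) := by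
  rw [h.GG_apply r s x, if_neg hrs]
  push_cast
  rw [zero_smul, add_zero]
  module

theorem real_smul_mem {N : Submodule ℝ V} {x : V} (hx : x ∈ N) (a : ℝ) : ((a : ℂ)) • x ∈ N := by
  rw [Complex.coe_smul]; exact N.smul_mem a hx

/-- A real subspace invariant under `G_{-1/2}` and `G_{-3/2}` is invariant under all generators of
negative energy. -/
theorem mem_of_neg (h : NSRelations L G c) {N : Submodule ℝ V}
    (h1 : ∀ x ∈ N, G (-1) x ∈ N) (h2 : ∀ x ∈ N, G (-2) x ∈ N) :
    (∀ r : ℤ, r < 0 → ∀ x ∈ N, G r x ∈ N) ∧ ∀ m : ℤ, m < 0 → ∀ x ∈ N, L m x ∈ N := by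
  have hL1 : ∀ x ∈ N, L (-1) x ∈ N := fun x hx => by
    have := h.GG_apply_of_ne (r := -1) (s := -1) (by norm_num) x
    rw [show (-1 + -1 + 1 : ℤ) = -1 by norm_num] at this
    rw [this]
    exact real_smul_mem (N.add_mem (h1 _ (h1 x hx)) (h1 _ (h1 x hx))) _
  -- Bracketing with L_{-1} lowers the index step by step, with coefficient n + 1. From G_{-1/2} the
  -- coefficient would be 0, which is why G_{-3/2} is needed as a second letter.
  have hG : ∀ (n : ℕ), ∀ x ∈ N, G (-2 - (n : ℤ)) x ∈ N := by
    intro n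
    induction n with
    | zero => simpa using h2
    | succ n ih =>
      intro x hx
      have e := h.LG_apply (-1) (-2 - n) x
      have hn : ((n : ℂ) + 1) ≠ 0 := by exact_mod_cast n.succ_ne_zero
      have key : G (-2 - ((n + 1 : ℕ) : ℤ)) x = ((((n : ℝ) + 1)⁻¹ : ℝ) : ℂ) •
          (L (-1) (G (-2 - n) x) - G (-2 - n) (L (-1) x)) := by
        rw [e, add_sub_cancel_left, smul_smul]
        have e1 : (-2 - ((n + 1 : ℕ) : ℤ)) = -1 + (-2 - (n : ℤ)) := by push_cast; ring
        rw [e1]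
        conv_lhs => rw [← one_smul ℂ (G _ x)]
        congr 1
        push_cast
        field_simp
        ring
      rw [key]
      exact real_smul_mem (N.sub_mem (hL1 _ (ih x hx)) (ih _ (hL1 x hx))) _
  have hG' : ∀ r : ℤ, r < 0 → ∀ x ∈ N, G r x ∈ N := by
    intro r hr x hx
    rcases eq_or_lt_of_le (Int.le_sub_one_of_lt hr) with e | e
    · rw [e]; exact h1 x hx
    · obtain ⟨n, rfl⟩ : ∃ n : ℕ, r = -2 - n := ⟨(-2 - r).toNat, by omega⟩
      exact hG n x hx
  refine ⟨hG', fun m hm x hx => ?_⟩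
  have := h.GG_apply_of_ne (r := -1) (s := m) (by omega) x
  rw [show -1 + m + 1 = m by ring] at this
  rw [this]
  exact real_smul_mem (N.add_mem (h1 _ (hG' m hm x hx)) (hG' m hm _ (h1 x hx))) _

/-- The real span of the words in `G_{-1/2}`, `G_{-3/2}` is invariant under all generators. -/
theorem realSpan_invariant {c : ℝ} (h : NSRelations L G (c : ℂ)) {Ω : V}
    (hΩ : IsNSVacuum L G Ω) :
    (∀ r : ℤ, ∀ x ∈ Submodule.span ℝ (Set.range (gWord G Ω)),
      G r x ∈ Submodule.span ℝ (Set.range (gWord G Ω))) ∧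
    ∀ m : ℤ, ∀ x ∈ Submodule.span ℝ (Set.range (gWord G Ω)),
      L m x ∈ Submodule.span ℝ (Set.range (gWord G Ω)) := by
  set N := Submodule.span ℝ (Set.range (gWord G Ω)) with hN
  have hw : ∀ w, gWord G Ω w ∈ N := fun w => Submodule.subset_span ⟨w, rfl⟩
  have ext : ∀ A : Module.End ℂ V, (∀ w, A (gWord G Ω w) ∈ N) → ∀ x ∈ N, A x ∈ N := by
    intro A hA x hx
    induction hx using Submodule.span_induction with
    | mem x hx => obtain ⟨w, rfl⟩ := hx; exact hA w
    | zero => rw [map_zero]; exact N.zero_mem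
    | add x y _ _ hx hy => rw [map_add]; exact N.add_mem hx hy
    | smul a x _ hx =>
      rw [← Complex.coe_smul, map_smul, Complex.coe_smul]; exact N.smul_mem a hx
  have h1 : ∀ x ∈ N, G (-1) x ∈ N := ext _ fun w => hw (false :: w)
  have h2 : ∀ x ∈ N, G (-2) x ∈ N := ext _ fun w => hw (true :: w)
  obtain ⟨hG, hL⟩ := h.mem_of_neg h1 h2
  -- A generator is moved past the first letter; the bracket is again a generator, possibly plus a
  -- scalar, acting on the shorter word.
  have key : ∀ w, (∀ r, G r (gWord G Ω w) ∈ N) ∧ ∀ m, L m (gWord G Ω w) ∈ N := by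
    intro w
    induction w with
    | nil =>
      refine ⟨fun r => ?_, fun m => ?_⟩
      · rcases lt_or_ge r 0 with hr | hr
        · exact hG r hr _ (hw [])
        · rw [gWord, hΩ.G_nonneg r hr]; exact N.zero_mem
      · rcases lt_or_ge m 0 with hr | hr
        · exact hL m hr _ (hw [])
        · rw [gWord, hΩ.L_nonneg m hr]; exact N.zero_mem
    | cons b w ih =>
      have ha : ∀ x ∈ N, G (if b then -2 else -1) x ∈ N := by
        cases b
        · exact h1
        · exact h2
      rw [gWord]
      generalize (if b then -2 else -1 : ℤ) = s at ha
      refine ⟨fun r => ?_, fun m => ?_⟩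
      · rw [h.GG_apply]
        refine N.add_mem (N.add_mem (N.neg_mem (ha _ (ih.1 r))) ?_) ?_
        · exact_mod_cast real_smul_mem (ih.2 (r + s + 1)) 2
        -- The central term is a real scalar because c is real.
        · have : (if r + s + 1 = 0 then (c : ℂ) / 3 * (((r : ℂ) + 1 / 2) ^ 2 - 1 / 4) else 0) =
              ((if r + s + 1 = 0 then c / 3 * (((r : ℝ) + 1 / 2) ^ 2 - 1 / 4) else 0 : ℝ) : ℂ) := by
            split_ifs <;> push_cast <;> rfl
          rw [this]
          exact real_smul_mem (hw w) _
      · rw [h.LG_apply]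
        refine N.add_mem (ha _ (ih.2 m)) ?_
        have := real_smul_mem (ih.1 (m + s)) ((m : ℝ) / 2 - ((s : ℝ) + 1 / 2))
        push_cast at this
        exact this
  exact ⟨fun r => ext _ fun w => (key w).1 r, fun m => ext _ fun w => (key w).2 m⟩

theorem realSpan_le_span (Ω : V) {x : V} (hx : x ∈ Submodule.span ℝ (Set.range (gWord G Ω))) :
    x ∈ Submodule.span ℂ (Set.range (gWord G Ω)) := by
  have : Submodule.span ℝ (Set.range (gWord G Ω)) ≤
      (Submodule.span ℂ (Set.range (gWord G Ω))).restrictScalars ℝ :=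
    Submodule.span_le.2 Submodule.subset_span
  exact this hx

/-- The span of the words in `G_{-1/2}`, `G_{-3/2}` is invariant under all generators. -/
theorem span_invariant {c : ℝ} (h : NSRelations L G (c : ℂ)) {Ω : V} (hΩ : IsNSVacuum L G Ω) :
    (∀ r : ℤ, ∀ x ∈ Submodule.span ℂ (Set.range (gWord G Ω)),
      G r x ∈ Submodule.span ℂ (Set.range (gWord G Ω))) ∧
    ∀ m : ℤ, ∀ x ∈ Submodule.span ℂ (Set.range (gWord G Ω)),
      L m x ∈ Submodule.span ℂ (Set.range (gWord G Ω)) := by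
  obtain ⟨hG, hL⟩ := h.realSpan_invariant hΩ
  have ext : ∀ A : Module.End ℂ V,
      (∀ w, A (gWord G Ω w) ∈ Submodule.span ℝ (Set.range (gWord G Ω))) →
      ∀ x ∈ Submodule.span ℂ (Set.range (gWord G Ω)),
        A x ∈ Submodule.span ℂ (Set.range (gWord G Ω)) := by
    intro A hA
    refine fun x hx => (Submodule.span_le (p := (Submodule.span ℂ _).comap A)).2 ?_ hx
    rintro _ ⟨w, rfl⟩
    exact realSpan_le_span Ω (hA w)
  exact ⟨fun r => ext _ fun w => hG r _ (Submodule.subset_span ⟨w, rfl⟩),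
    fun m => ext _ fun w => hL m _ (Submodule.subset_span ⟨w, rfl⟩)⟩

end NSRelations

/-! ### Cyclicity and induction over words -/

namespace NSAction

variable {V : Type*} [AddCommGroup V] [Module ℂ V] {ρ : NSAction V}

theorem IsRepresentation.relations {c : ℂ} (h : ρ.IsRepresentation c) :
    NSRelations ρ.L ρ.G c :=
  ⟨h.comm_LL, h.comm_LG, h.comm_GG⟩

theorem IsCyclicLowestWeight.isNSVacuum {Ω : V} (h : ρ.IsCyclicLowestWeight Ω 0) :
    IsNSVacuum ρ.L ρ.G Ω where
  L_nonneg m hm := by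
    rcases eq_or_lt_of_le hm with rfl | hm
    · simpa using h.L_zero
    · exact h.L_pos m hm
  G_nonneg := h.G_pos

theorem span_gWord_eq_top {c : ℝ} {Ω : V} (h : ρ.IsRepresentation (c : ℂ))
    (hΩ : ρ.IsCyclicLowestWeight Ω 0) : Submodule.span ℂ (Set.range (gWord ρ.G Ω)) = ⊤ := by
  obtain ⟨hG, hL⟩ := h.relations.span_invariant hΩ.isNSVacuum
  exact hΩ.cyclic _ (Submodule.subset_span ⟨[], rfl⟩) hL hG

/-- A property of vectors that is stable under linear combinations, holds for `Ω`, and is inherited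
by `G_{-1/2} x` and `G_{-3/2} x` for words `x` holds everywhere. -/
theorem word_induction {c : ℝ} {Ω : V} (h : ρ.IsRepresentation (c : ℂ))
    (hΩ : ρ.IsCyclicLowestWeight Ω 0) {P : V → Prop} (zero : P 0)
    (add : ∀ x y, P x → P y → P (x + y)) (smul : ∀ (a : ℂ) x, P x → P (a • x)) (vac : P Ω)
    (step : ∀ (s : ℤ) (k : ℕ) (x : V), s = -1 ∨ s = -2 → ρ.L 0 x = ((k : ℂ) / 2) • x → P x →
      P (ρ.G s x)) (x : V) : P x := by
  have hx : x ∈ Submodule.span ℂ (Set.range (gWord ρ.G Ω)) := by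
    rw [span_gWord_eq_top h hΩ]; trivial
  induction hx using Submodule.span_induction with
  | mem x hx =>
    obtain ⟨w, rfl⟩ := hx
    induction w with
    | nil => exact vac
    | cons b w ih =>
      refine step _ _ _ ?_ (h.relations.L_zero_gWord hΩ.isNSVacuum w) ih
      cases b <;> simp
  | zero => exact zero
  | add x y _ _ hx hy => exact add x y hx hy
  | smul a x _ hx => exact smul a x hx

/-! ## Unitarity -/

/-- The test polynomial is z^n - (-1)^n, and the constant coefficients of both sides are compared.
In the G-series the factors z^{1/2} and z^{-1/2} turn these coefficients into G_{n+1/2} and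
G_{-n-1/2}. -/
theorem adjoint_defect {ip : InnerProductSpace.Core ℂ V} (hip : ρ.IsWeaklySymmetric ip) (n : ℤ)
    (x y : V) :
    ip.inner (ρ.L n x) y - ip.inner x (ρ.L (-n) y) =
      (-1) ^ n * (ip.inner (ρ.L 0 x) y - ip.inner x (ρ.L 0 y)) ∧
    ip.inner (ρ.G n x) y - ip.inner x (ρ.G (-n - 1) y) =
      (-1) ^ n * (ip.inner (ρ.G 0 x) y - ip.inner x (ρ.G (-1) y)) := by
  let _ := ip
  have hcs : starRingEnd ℂ ((-1 : ℂ) ^ n) = (-1) ^ n := by simp [map_zpow₀]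
  obtain ⟨e, he⟩ : ∃ e : ℂ, e = -(-1) ^ n := ⟨_, rfl⟩
  set p : TrigPoly := Finsupp.single n 1 + Finsupp.single 0 e with hp
  have hpe : p.eval (-1) = 0 := by
    rw [TrigPoly.eval, hp, Finsupp.sum_add_index' (by simp) (by intros; ring)]
    rw [Finsupp.sum_single_index (by simp), Finsupp.sum_single_index (by simp)]
    simp [he]
  have hpc : p.conj = Finsupp.single (-n) 1 + Finsupp.single 0 e := by
    rw [TrigPoly.conj, hp, Finsupp.sum_add_index' (by simp) (by intros; simp)]
    rw [Finsupp.sum_single_index (by simp), Finsupp.sum_single_index (by simp)]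
    simp [he]
  have hs : ∀ (m : ℤ) (A : FormalSeries V) (k : ℤ),
      A.polyMul (Finsupp.single m 1 + Finsupp.single 0 e) k =
        A (k + 2 * m) - ((-1 : ℂ) ^ n) • A k := by
    intro m A k
    rw [FormalSeries.polyMul, Finsupp.sum_add_index' (by simp) (by intros; rw [add_smul])]
    rw [Finsupp.sum_single_index (by simp), Finsupp.sum_single_index (by simp)]
    simp [he, sub_eq_add_neg]
  obtain ⟨h1, h2⟩ := hip p hpe
  have h1 := h1 0 x y
  have h2 := h2 0 x y
  rw [hpc, hs, hs] at h1 h2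
  have e1 : ∀ m : ℤ, ρ.seriesT (2 * m) = ρ.L m := fun m => by simp [seriesT]
  have e2 : ∀ m : ℤ, ρ.seriesG (2 * m + 1) = ρ.G m := fun m => by simp [seriesG]
  have e10 := e1 0
  have e20 := e2 0
  have e2n := e2 (-n - 1)
  have e2m := e2 (-1)
  rw [show 2 * (-n - 1) + 1 = 2 * -n + -1 by ring] at e2n
  norm_num at e10 e20 e2m
  simp only [FormalSeries.halfShift, zero_add, neg_zero, e1, e2, e10, e20, e2n, e2m,
    LinearMap.sub_apply, LinearMap.smul_apply] at h1 h2
  rw [coreInner_sub_left, coreInner_sub_right, ip.smul_left, hcs, coreInner_smul_right] at h1 h2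
  exact ⟨by linear_combination h1, by linear_combination h2⟩

/-- The vacuum functional `(Ω|·)` vanishes on everything of the form `L_{-m} y`, `m ≥ 0`, or
`G_{-n} y`, `n > 0`. -/
theorem inner_vacuum_neg {c : ℝ} (hρ : ρ.IsRepresentation (c : ℂ)) {Ω : V}
    (hΩ : ρ.IsCyclicLowestWeight Ω 0) {ip : InnerProductSpace.Core ℂ V}
    (hip : ρ.IsWeaklySymmetric ip) (y : V) :
    ip.inner Ω (ρ.L 0 y) = 0 ∧ ip.inner Ω (ρ.G (-1) y) = 0 := by
  have R := hρ.relations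
  have hv := hΩ.isNSVacuum
  -- For m ≥ 0 both L_m and L_0 annihilate Ω, so only the terms with Ω on the left of an operator
  -- survive in the defect relation.
  have hl : ∀ (m : ℕ) (y : V),
      ip.inner Ω (ρ.L (-(m : ℤ)) y) = (-1) ^ m * ip.inner Ω (ρ.L 0 y) := fun m y => by
    have := (adjoint_defect hip m Ω y).1
    rw [hv.L_nonneg _ (Int.natCast_nonneg m), hv.L_nonneg 0 le_rfl, coreInner_zero_left,
      zpow_natCast] at this
    linear_combination -this
  have hg : ∀ (r : ℕ) (y : V),
      ip.inner Ω (ρ.G (-(r : ℤ) - 1) y) = (-1) ^ r * ip.inner Ω (ρ.G (-1) y) := fun r y => by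
    have := (adjoint_defect hip r Ω y).2
    rw [hv.G_nonneg _ (Int.natCast_nonneg r), hv.G_nonneg 0 le_rfl, coreInner_zero_left,
      zpow_natCast] at this
    linear_combination -this
  have sq : ∀ (s : ℤ) (x : V), 2 * s + 1 ≠ 0 → ρ.G s (ρ.G s x) = ρ.L (2 * s + 1) x := by
    intro s x hs
    have := R.GG_apply_of_ne (r := s) (s := s) (by omega) x
    rw [show s + s + 1 = 2 * s + 1 by ring] at this
    rw [this]
    push_cast
    module
  -- By the relation for mode -1, the squared norm of G_{-1/2}Ω is (Ω|G_{1/2}G_{-1/2}Ω) +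
  -- (Ω|G_{-1/2}²Ω). The first term is 2(Ω|L_0Ω) = 0; the second is (Ω|L_{-1}Ω) = -(Ω|L_0Ω) = 0.
  have hG1 : ρ.G (-1) Ω = 0 := by
    apply ip.definite
    have h1 := (adjoint_defect hip (-1) Ω (ρ.G (-1) Ω)).2
    have h2 := sq (-1) Ω (by norm_num)
    have h3 := hl 1 Ω
    have h4 := R.GG_apply 0 (-1) Ω
    norm_num at h1 h2 h3 h4
    rw [h2, h3, h4, hv.G_nonneg 0 le_rfl, hv.L_nonneg 0 le_rfl] at h1
    simpa [coreInner_zero_left, coreInner_zero_right] using h1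
  induction y using word_induction hρ hΩ with
  | zero => simp [coreInner_zero_right]
  | add x y hx hy => simp [coreInner_add_right, hx, hy]
  | smul a x hx => simp [coreInner_smul_right, hx]
  | vac => rw [hG1, hv.L_nonneg 0 le_rfl, coreInner_zero_right]; simp
  | step s k x hs hk hx =>
    obtain ⟨r, rfl⟩ : ∃ r : ℕ, s = -(r : ℤ) - 1 := ⟨(-s - 1).toNat, by omega⟩
    have hgr := hg r
    refine ⟨?_, ?_⟩
    · rw [R.LG_apply, hk, zero_add, map_smul, coreInner_add_right, coreInner_smul_right,
        coreInner_smul_right, hgr, hx.2]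
      ring
    -- Up to sign, G_{-1/2} may be replaced by the mode equal to the new letter. The product is then
    -- a square, hence some L_{-m}, and the induction hypothesis for L_0 applies.
    · have h1 := hgr (ρ.G (-(r : ℤ) - 1) x)
      rw [sq _ _ (by omega), show (2 * (-(r : ℤ) - 1) + 1) = -((2 * r + 1 : ℕ) : ℤ) by
        push_cast; ring, hl, hx.1, mul_zero] at h1
      exact (mul_eq_zero.1 h1.symm).resolve_left (pow_ne_zero _ (by norm_num))

/-- By `adjoint_defect` it is enough to treat L_0 and G_{1/2}, and for a given left vector the
vanishing of the defect at one mode of each kind is as good as at all modes. -/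
theorem isUnitary_of_isWeaklySymmetric {c : ℝ} (hρ : ρ.IsRepresentation (c : ℂ)) {Ω : V}
    (hΩ : ρ.IsCyclicLowestWeight Ω 0) {ip : InnerProductSpace.Core ℂ V}
    (hip : ρ.IsWeaklySymmetric ip) : ρ.IsUnitary ip := by
  have R := hρ.relations
  have hv := hΩ.isNSVacuum
  have hvan := inner_vacuum_neg hρ hΩ hip
  have ne : ∀ n : ℤ, ((-1 : ℂ) ^ n) ≠ 0 := fun n => zpow_ne_zero _ (by norm_num)
  suffices H : ∀ x : V, (∀ y, ip.inner (ρ.L 0 x) y = ip.inner x (ρ.L 0 y)) ∧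
      ∀ y, ip.inner (ρ.G 0 x) y = ip.inner x (ρ.G (-1) y) by
    refine ⟨fun m x y => ?_, fun r x y => ?_⟩
    · have := (adjoint_defect hip m x y).1
      rw [(H x).1, sub_self, mul_zero] at this
      exact sub_eq_zero.1 this
    · have := (adjoint_defect hip r x y).2
      rw [(H x).2, sub_self, mul_zero] at this
      exact sub_eq_zero.1 this
  intro x
  induction x using word_induction hρ hΩ with
  | zero => simp [coreInner_zero_left]
  | add x y hx hy => simp [ip.add_left, hx, hy]
  | smul a x hx => simp [ip.smul_left, hx]
  | vac =>
    rw [hv.L_nonneg 0 le_rfl, hv.G_nonneg 0 le_rfl]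
    exact ⟨fun y => by rw [coreInner_zero_left, (hvan y).1],
      fun y => by rw [coreInner_zero_left, (hvan y).2]⟩
  | step s k x _ hk hx =>
    have hL : ∀ (m : ℤ) (y : V), ip.inner (ρ.L m x) y = ip.inner x (ρ.L (-m) y) := fun m y => by
      have := (adjoint_defect hip m x y).1
      rw [hx.1, sub_self, mul_zero] at this
      exact sub_eq_zero.1 this
    have hG : ∀ (m : ℤ) (y : V), ip.inner (ρ.G m x) y = ip.inner x (ρ.G (-m - 1) y) :=
      fun m y => by
        have := (adjoint_defect hip m x y).2
        rw [hx.2, sub_self, mul_zero] at this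
        exact sub_eq_zero.1 this
    refine ⟨fun y => ?_, fun y => ?_⟩
    · have h1 := hL 0 (ρ.G (-s - 1) y)
      rw [hk, ip.smul_left] at h1
      have hc2 : starRingEnd ℂ (2 : ℂ) = 2 := map_ofNat _ 2
      have hkk : starRingEnd ℂ ((k : ℂ) / 2) = (k : ℂ) / 2 := by simp [hc2]
      rw [hkk, neg_zero, R.LG_apply, coreInner_add_right, coreInner_smul_right, zero_add] at h1
      rw [R.LG_apply, hk, map_smul, ip.add_left, ip.smul_left, ip.smul_left, hkk, zero_add,
        hG s y, hG s (ρ.L 0 y), h1]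
      simp [hc2]
      ring
    · have h1 := (adjoint_defect hip s (ρ.G s x) y).2
      -- The defect of G_s x is tested at the mode s itself: G_s² is a Virasoro mode, whose adjoint
      -- on x is known, and that adjoint is again the square of a G-mode.
      have key : ip.inner (ρ.G s (ρ.G s x)) y = ip.inner (ρ.G s x) (ρ.G (-s - 1) y) := by
        have h2 := R.GG_apply s s x
        have h3 := R.GG_apply (-s - 1) (-s - 1) y
        rw [hG]
        have h2' : ρ.G s (ρ.G s x) = ρ.L (s + s + 1) x +
            ((if s + s + 1 = 0 then (c : ℂ) / 3 * (((s : ℂ) + 1 / 2) ^ 2 - 1 / 4) else 0) / 2) •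
              x := by
          linear_combination (norm := module) (2⁻¹ : ℂ) • h2
        have h3' : ρ.G (-s - 1) (ρ.G (-s - 1) y) = ρ.L (-(s + s + 1)) y := by
          rw [if_neg (by omega), show (-s - 1 + (-s - 1) + 1) = -(s + s + 1) by ring] at h3
          linear_combination (norm := module) (2⁻¹ : ℂ) • h3
        rw [h2', h3', ip.add_left, hL, if_neg (by omega)]
        simp [coreInner_zero_left]
      rw [key, sub_self] at h1
      exact sub_eq_zero.1 ((mul_eq_zero.1 h1.symm).resolve_left (ne s))

end NSAction

/-! ## Difference operators and Dong's lemma -/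

theorem finsum_nat_eq_sum {W : Type*} [AddCommMonoid W] {f : ℕ → W} {K : ℕ} (h : ∀ j, K ≤ j → f j = 0) :
    ∑ᶠ j, f j = ∑ j ∈ Finset.range K, f j :=
  finsum_eq_sum_of_support_subset _ fun j hj => by
    simp only [Finset.coe_range, Set.mem_Iio]
    by_contra hc
    exact hj (h j (not_lt.1 hc))

section Difference

variable {W : Type*} [AddCommGroup W] [Module ℂ W]

/-- Multiplication by `z - w` on the coefficients of a formal series in `z`, `w`. -/
def diff2 (W : Type*) [AddCommGroup W] [Module ℂ W] : Module.End ℂ (ℤ → ℤ → W) where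
  toFun F m n := F (m + 1) n - F m (n + 1)
  map_add' F F' := by ext; simp; abel
  map_smul' a F := by ext; simp [smul_sub]

@[simp] theorem diff2_apply (F : ℤ → ℤ → W) (m n : ℤ) :
    diff2 W F m n = F (m + 1) n - F m (n + 1) := rfl

/-- The binomial theorem for two commuting shifts. It links the operator `diff2`, convenient in
proofs, with the explicit sum in `VertexSuperalgebra.locality`. -/
theorem diff2_pow_apply (F : ℤ → ℤ → W) (N : ℕ) (m n : ℤ) :
    (diff2 W ^ N) F m n = ∑ j ∈ Finset.range (N + 1),
      ((-1 : ℂ) ^ j * (N.choose j : ℂ)) • F (m + N - j) (n + j) := by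
  let S1 : Module.End ℂ (ℤ → ℤ → W) :=
    { toFun := fun F m n => F (m + 1) n
      map_add' := fun _ _ => rfl
      map_smul' := fun _ _ => rfl }
  let S2 : Module.End ℂ (ℤ → ℤ → W) :=
    { toFun := fun F m n => -F m (n + 1)
      map_add' := fun F F' => by ext; simp; abel
      map_smul' := fun a F => by ext; simp }
  have hd : diff2 W = S2 + S1 := by
    ext F m n
    simp [S1, S2]
    abel
  have hc : Commute S2 S1 := by
    ext F m n
    simp [S1, S2]
  have h1 : ∀ (k : ℕ) (F : ℤ → ℤ → W) (m n : ℤ), (S1 ^ k) F m n = F (m + k) n := by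
    intro k
    induction k with
    | zero => simp
    | succ k ih =>
      intro F m n
      rw [pow_succ, Module.End.mul_apply, ih]
      simp only [S1, LinearMap.coe_mk, AddHom.coe_mk]
      congr 1; push_cast; ring
  have h2 : ∀ (k : ℕ) (F : ℤ → ℤ → W) (m n : ℤ),
      (S2 ^ k) F m n = ((-1 : ℂ) ^ k) • F m (n + k) := by
    intro k
    induction k with
    | zero => simp
    | succ k ih =>
      intro F m n
      rw [pow_succ, Module.End.mul_apply, ih]
      simp only [S2, LinearMap.coe_mk, AddHom.coe_mk]
      rw [pow_succ, mul_neg_one, neg_smul, smul_neg]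
      congr 3; push_cast; ring
  rw [hd, hc.add_pow]
  simp only [LinearMap.sum_apply, Finset.sum_apply]
  refine Finset.sum_congr rfl fun j hj => ?_
  have hj' : j ≤ N := Nat.lt_succ_iff.1 (Finset.mem_range.1 hj)
  rw [(Nat.cast_commute _ _).eq.symm, Module.End.mul_apply, Module.End.mul_apply,
    ← nsmul_one, LinearMap.smul_apply, Module.End.one_apply, Pi.smul_apply, Pi.smul_apply, h2, h1,
    ← Nat.cast_smul_eq_nsmul ℂ, smul_smul, mul_comm]
  congr 2
  push_cast [hj']
  ring

/-- Only additivity is required, so that the lemma covers conjugation of operators by an antilinear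
map. -/
theorem diff2_pow_addMap {W' : Type*} [AddCommGroup W'] [Module ℂ W'] (f : W →+ W') (N : ℕ)
    (F : ℤ → ℤ → W) :
    (diff2 W' ^ N) (fun m n => f (F m n)) = fun m n => f ((diff2 W ^ N) F m n) := by
  induction N with
  | zero => rfl
  | succ N ih =>
    rw [pow_succ', Module.End.mul_apply, ih, pow_succ', Module.End.mul_apply]
    ext m n
    simp

theorem diff2_pow_map {W' : Type*} [AddCommGroup W'] [Module ℂ W'] (f : W →ₗ[ℂ] W') (N : ℕ)
    (F : ℤ → ℤ → W) : (diff2 W' ^ N) (fun m n => f (F m n)) = fun m n => f ((diff2 W ^ N) F m n) :=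
  diff2_pow_addMap f.toAddMonoidHom N F

theorem diff2_pow_eq_zero_of_le {F : ℤ → ℤ → W} {N N' : ℕ} (h : N ≤ N')
    (hF : (diff2 W ^ N) F = 0) : (diff2 W ^ N') F = 0 := by
  obtain ⟨k, rfl⟩ := Nat.exists_eq_add_of_le' h
  rw [pow_add, Module.End.mul_apply, hF, map_zero]

/-- A series killed by a power of `z - w` and bounded in `w` vanishes. -/
theorem eq_zero_of_diff2_pow {F : ℤ → ℤ → W} {N : ℕ} {M : ℤ} (hF : (diff2 W ^ N) F = 0)
    (hM : ∀ n, M ≤ n → ∀ m, F m n = 0) : F = 0 := by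
  induction N with
  | zero => simpa using hF
  | succ N ih =>
    refine ih ?_
    rw [pow_succ', Module.End.mul_apply] at hF
    set F' := (diff2 W ^ N) F with hF'
    have hM' : ∀ n, M ≤ n → ∀ m, F' m n = 0 := fun n hn m => by
      rw [hF', diff2_pow_apply]
      exact Finset.sum_eq_zero fun j _ => by rw [hM _ (by omega), smul_zero]
    -- A series killed by z - w is constant along m + n = const, so every coefficient can be slid
    -- into the region where it vanishes.
    have hstep : ∀ (k : ℕ) (m n : ℤ), F' m n = F' (m - k) (n + k) := by
      intro k
      induction k with
      | zero => simp
      | succ k ih =>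
        intro m n
        rw [ih]
        have := congr_fun (congr_fun hF (m - (k + 1 : ℕ))) (n + k)
        simp only [diff2_apply, Pi.zero_apply] at this
        rw [sub_eq_zero] at this
        convert this using 2
        · push_cast; ring
        · push_cast; ring
    ext m n
    rw [hstep (M - n).toNat m n, hM' _ (by omega)]; rfl

/-! ### Series in three variables and the algebra behind Dong's lemma -/

/-- Multiplication by `z - w` on formal series in `z`, `w`, `x`. -/
def diffZW (W : Type*) [AddCommGroup W] [Module ℂ W] : Module.End ℂ (ℤ → ℤ → ℤ → W) where
  toFun F l m k := F (l + 1) m k - F l (m + 1) k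
  map_add' F F' := by ext; simp; abel
  map_smul' a F := by ext; simp [smul_sub]

/-- Multiplication by `z - x` on formal series in `z`, `w`, `x`. -/
def diffZX (W : Type*) [AddCommGroup W] [Module ℂ W] : Module.End ℂ (ℤ → ℤ → ℤ → W) where
  toFun F l m k := F (l + 1) m k - F l m (k + 1)
  map_add' F F' := by ext; simp; abel
  map_smul' a F := by ext; simp [smul_sub]

/-- Multiplication by `w - x` on formal series in `z`, `w`, `x`. -/
def diffWX (W : Type*) [AddCommGroup W] [Module ℂ W] : Module.End ℂ (ℤ → ℤ → ℤ → W) where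
  toFun F l m k := F l (m + 1) k - F l m (k + 1)
  map_add' F F' := by ext; simp; abel
  map_smul' a F := by ext; simp [smul_sub]

@[simp] theorem diffZW_apply (F : ℤ → ℤ → ℤ → W) (l m k : ℤ) :
    diffZW W F l m k = F (l + 1) m k - F l (m + 1) k := rfl

@[simp] theorem diffZX_apply (F : ℤ → ℤ → ℤ → W) (l m k : ℤ) :
    diffZX W F l m k = F (l + 1) m k - F l m (k + 1) := rfl

@[simp] theorem diffWX_apply (F : ℤ → ℤ → ℤ → W) (l m k : ℤ) :
    diffWX W F l m k = F l (m + 1) k - F l m (k + 1) := rfl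

theorem commute_diffZW_diffZX : Commute (diffZW W) (diffZX W) := by
  ext F l m k; simp; abel

theorem commute_diffZW_diffWX : Commute (diffZW W) (diffWX W) := by
  ext F l m k; simp; abel

theorem commute_diffZX_diffWX : Commute (diffZX W) (diffWX W) := by
  ext F l m k; simp; abel

theorem diffWX_eq : diffWX W = diffZX W + -diffZW W := by
  ext F l m k; simp

theorem diffZW_pow_apply (F : ℤ → ℤ → ℤ → W) (N : ℕ) (l m k : ℤ) :
    (diffZW W ^ N) F l m k = (diff2 W ^ N) (fun l m => F l m k) l m := by
  induction N generalizing F l m k with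
  | zero => simp
  | succ N ih => rw [pow_succ, Module.End.mul_apply, ih, pow_succ, Module.End.mul_apply]; rfl

theorem diffZX_pow_apply (F : ℤ → ℤ → ℤ → W) (N : ℕ) (l m k : ℤ) :
    (diffZX W ^ N) F l m k = (diff2 W ^ N) (fun l k => F l m k) l k := by
  induction N generalizing F l m k with
  | zero => simp
  | succ N ih => rw [pow_succ, Module.End.mul_apply, ih, pow_succ, Module.End.mul_apply]; rfl

theorem diffWX_pow_apply (F : ℤ → ℤ → ℤ → W) (N : ℕ) (l m k : ℤ) :
    (diffWX W ^ N) F l m k = (diff2 W ^ N) (fun m k => F l m k) m k := by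
  induction N generalizing F l m k with
  | zero => simp
  | succ N ih => rw [pow_succ, Module.End.mul_apply, ih, pow_succ, Module.End.mul_apply]; rfl

/-- The polynomial in `z`, `w`, `x` by which `(w - x)^{3N}` is replaced in Dong's lemma, divided by
`(z - w)^{N + 1}`. -/
noncomputable def dongCofactor (W : Type*) [AddCommGroup W] [Module ℂ W] (N : ℕ) :
    Module.End ℂ (ℤ → ℤ → ℤ → W) :=
  ∑ i ∈ Finset.range N, (((2 * N).choose i : ℂ) * (-1) ^ (2 * N - i)) •
    (diffZX W ^ i * diffZW W ^ (N - 1 - i) * diffWX W ^ N)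

/-- The series `F` is divisible by `z - w` after multiplication by `(w - x)^{3N}`. -/
theorem diffWX_pow_eq (N : ℕ) {F : ℤ → ℤ → ℤ → W}
    (hF : (diffWX W ^ N) ((diffZX W ^ N) F) = 0) :
    (diffWX W ^ (N + 2 * N)) F = diffZW W (dongCofactor W N ((diffZW W ^ N) F)) := by
  have hc : Commute (diffZX W) (-diffZW W) :=
    (commute_diffZW_diffZX (W := W)).symm.neg_right
  rw [dongCofactor]
  rw [pow_add, (Commute.pow_pow_self (diffWX W) _ _).eq]
  -- Of the 3N factors w - x, 2N are expanded by w - x = (z - x) - (z - w) and N are kept. Terms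
  -- with at least N factors z - x die by `hF`; in the others z - w occurs at least N + 1 times.
  have e2 : diffWX W ^ (2 * N) = ∑ i ∈ Finset.range (2 * N + 1),
      (((2 * N).choose i : ℂ) * (-1) ^ (2 * N - i)) •
        (diffZX W ^ i * diffZW W ^ (2 * N - i)) := by
    conv_lhs => rw [diffWX_eq, hc.add_pow]
    refine Finset.sum_congr rfl fun i _ => ?_
    rw [← nsmul_one, mul_smul_comm, mul_one, ← Nat.cast_smul_eq_nsmul ℂ, mul_smul]
    congr 1
    rw [← neg_one_smul ℂ (diffZW W), smul_pow, mul_smul_comm]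
  rw [e2, show 2 * N + 1 = N + (N + 1) by ring, Finset.sum_range_add, add_mul]
  have hz : ((∑ i ∈ Finset.range (N + 1),
      (((2 * N).choose (N + i) : ℂ) * (-1) ^ (2 * N - (N + i))) •
        (diffZX W ^ (N + i) * diffZW W ^ (2 * N - (N + i)))) * diffWX W ^ N) F = 0 := by
    rw [Finset.sum_mul, LinearMap.sum_apply]
    refine Finset.sum_eq_zero fun i _ => ?_
    have : (diffZX W ^ (N + i) * diffZW W ^ (2 * N - (N + i))) * diffWX W ^ N =
        (diffZX W ^ i * diffZW W ^ (2 * N - (N + i))) * (diffWX W ^ N * diffZX W ^ N) := by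
      rw [pow_add, (Commute.pow_pow_self (diffZX W) N i).eq, mul_assoc, mul_assoc, mul_assoc]
      congr 1
      rw [(commute_diffZX_diffWX.symm.pow_pow N N).eq, ← mul_assoc, ← mul_assoc,
        (commute_diffZW_diffZX.symm.pow_pow N _).eq]
    rw [smul_mul_assoc, this, LinearMap.smul_apply, Module.End.mul_apply, Module.End.mul_apply,
      Module.End.mul_apply, hF, map_zero, map_zero, smul_zero]
  rw [LinearMap.add_apply, hz, add_zero, Finset.sum_mul, LinearMap.sum_apply, LinearMap.sum_apply,
    map_sum]
  refine Finset.sum_congr rfl fun i hi => ?_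
  have hi' : i < N := Finset.mem_range.1 hi
  rw [smul_mul_assoc, LinearMap.smul_apply, LinearMap.smul_apply, map_smul]
  congr 1
  simp only [← Module.End.mul_apply]
  congr 1
  have : diffZW W ^ (2 * N - i) = diffZW W * (diffZW W ^ (N - 1 - i) * diffZW W ^ N) := by
    rw [← pow_add, ← pow_succ']
    congr 1; omega
  rw [this]
  simp only [mul_assoc]
  rw [(commute_diffZW_diffWX.pow_pow N N).eq]
  simp only [← mul_assoc]
  rw [(commute_diffZW_diffZX.pow_right i).eq]

/-- Series in `z, w, x` with values in `W` that are bounded in `w`, uniformly in `z`. -/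
def boundedW (W : Type*) [AddCommGroup W] [Module ℂ W] : Submodule ℂ (ℤ → ℤ → ℤ → W) where
  carrier := {F | ∀ k, ∃ M : ℤ, ∀ m, M ≤ m → ∀ l, F l m k = 0}
  zero_mem' k := ⟨0, fun _ _ _ => rfl⟩
  add_mem' {F F'} h h' k := by
    obtain ⟨M, hM⟩ := h k
    obtain ⟨M', hM'⟩ := h' k
    refine ⟨max M M', fun m hm l => ?_⟩
    simp [hM m (le_trans (le_max_left _ _) hm), hM' m (le_trans (le_max_right _ _) hm)]
  smul_mem' a F h k := by
    obtain ⟨M, hM⟩ := h k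
    exact ⟨M, fun m hm l => by simp [hM m hm]⟩

/-- Series in `z, w, x` with values in `W` that are bounded in `z`, uniformly in `w`. -/
def boundedZ (W : Type*) [AddCommGroup W] [Module ℂ W] : Submodule ℂ (ℤ → ℤ → ℤ → W) where
  carrier := {F | ∀ k, ∃ M : ℤ, ∀ l, M ≤ l → ∀ m, F l m k = 0}
  zero_mem' k := ⟨0, fun _ _ _ => rfl⟩
  add_mem' {F F'} h h' k := by
    obtain ⟨M, hM⟩ := h k
    obtain ⟨M', hM'⟩ := h' k
    refine ⟨max M M', fun m hm l => ?_⟩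
    simp [hM m (le_trans (le_max_left _ _) hm), hM' m (le_trans (le_max_right _ _) hm)]
  smul_mem' a F h k := by
    obtain ⟨M, hM⟩ := h k
    exact ⟨M, fun m hm l => by simp [hM m hm]⟩

theorem boundedW_diff {F : ℤ → ℤ → ℤ → W} (h : F ∈ boundedW W) :
    diffZW W F ∈ boundedW W ∧ diffZX W F ∈ boundedW W ∧ diffWX W F ∈ boundedW W := by
  refine ⟨fun k => ?_, fun k => ?_, fun k => ?_⟩ <;>
  · obtain ⟨M, hM⟩ := h k
    obtain ⟨M', hM'⟩ := h (k + 1)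
    refine ⟨max M M', fun m hm l => ?_⟩
    have h1 : M ≤ m := le_trans (le_max_left _ _) hm
    have h2 : M' ≤ m := le_trans (le_max_right _ _) hm
    simp [hM m h1, hM (m + 1) (by omega), hM' m h2]

theorem boundedZ_diff {F : ℤ → ℤ → ℤ → W} (h : F ∈ boundedZ W) :
    diffZW W F ∈ boundedZ W ∧ diffZX W F ∈ boundedZ W ∧ diffWX W F ∈ boundedZ W := by
  refine ⟨fun k => ?_, fun k => ?_, fun k => ?_⟩ <;>
  · obtain ⟨M, hM⟩ := h k
    obtain ⟨M', hM'⟩ := h (k + 1)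
    refine ⟨max M M', fun m hm l => ?_⟩
    have h1 : M ≤ m := le_trans (le_max_left _ _) hm
    have h2 : M' ≤ m := le_trans (le_max_right _ _) hm
    simp [hM m h1, hM (m + 1) (by omega), hM' m h2]

theorem pow_mem_of_stable {X : Type*} [AddCommGroup X] [Module ℂ X] {S : Submodule ℂ X}
    {D : Module.End ℂ X} (h : ∀ F ∈ S, D F ∈ S) (n : ℕ) : ∀ F ∈ S, (D ^ n) F ∈ S := by
  induction n with
  | zero => simp
  | succ n ih => intro F hF; rw [pow_succ, Module.End.mul_apply]; exact ih _ (h F hF)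

theorem dongCofactor_mem {S : Submodule ℂ (ℤ → ℤ → ℤ → W)}
    (h : ∀ F ∈ S, diffZW W F ∈ S ∧ diffZX W F ∈ S ∧ diffWX W F ∈ S) (N : ℕ)
    {F : ℤ → ℤ → ℤ → W} (hF : F ∈ S) : dongCofactor W N F ∈ S := by
  rw [dongCofactor, LinearMap.sum_apply]
  refine Submodule.sum_mem _ fun i _ => Submodule.smul_mem _ _ ?_
  rw [Module.End.mul_apply, Module.End.mul_apply]
  have h1 := pow_mem_of_stable (D := diffZW W) fun F hF => (h F hF).1
  have h2 := pow_mem_of_stable (D := diffZX W) fun F hF => (h F hF).2.1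
  have h3 := pow_mem_of_stable (D := diffWX W) fun F hF => (h F hF).2.2
  exact h2 _ _ (h1 _ _ (h3 _ _ hF))

/-- The algebraic core of Dong's lemma. -/
theorem exists_diffZW_eq {N : ℕ} {U U' : ℤ → ℤ → ℤ → W} (hU : U ∈ boundedW W)
    (hU' : U' ∈ boundedZ W) (h : (diffZW W ^ N) (U - U') = 0)
    (h1 : (diffWX W ^ N) ((diffZX W ^ N) U) = 0)
    (h2 : (diffWX W ^ N) ((diffZX W ^ N) U') = 0) :
    ∃ E ∈ boundedW W, E ∈ boundedZ W ∧ (diffWX W ^ (N + 2 * N)) U = diffZW W E ∧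
      (diffWX W ^ (N + 2 * N)) U' = diffZW W E := by
  have e : (diffZW W ^ N) U = (diffZW W ^ N) U' := by rwa [map_sub, sub_eq_zero] at h
  -- After multiplication by (z - w)^N the two series coincide, so one E serves both: it inherits
  -- boundedness in w from U and boundedness in z from U'.
  refine ⟨dongCofactor W N ((diffZW W ^ N) U), ?_, ?_, diffWX_pow_eq N h1,
    by rw [diffWX_pow_eq N h2, e]⟩
  · exact dongCofactor_mem (fun F hF => boundedW_diff hF) _
      (pow_mem_of_stable (D := diffZW W) (fun F hF => (boundedW_diff hF).1) _ _ hU)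
  · rw [e]
    exact dongCofactor_mem (fun F hF => boundedZ_diff hF) _
      (pow_mem_of_stable (D := diffZW W) (fun F hF => (boundedZ_diff hF).1) _ _ hU')

/-- Dong's lemma for the commutator terms. -/
theorem diffWX_pow_sub_eq_zero {N : ℕ} {U U' : ℤ → ℤ → ℤ → W}
    (h : (diffZW W ^ N) (U - U') = 0) (h1 : (diffWX W ^ N) ((diffZX W ^ N) U) = 0)
    (h2 : (diffWX W ^ N) ((diffZX W ^ N) U') = 0) :
    (diffWX W ^ (N + 2 * N)) (U - U') = 0 := by
  rw [diffWX_pow_eq N (by rw [map_sub, map_sub, h1, h2, sub_zero]), h, map_zero, map_zero]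

/-! ### Residues against the two expansions of 1/(z - w) -/

/-- The coefficient of `z^{-1}` of `F(z,w,x)/(z - w)`, expanded in `|z| > |w|`. -/
noncomputable def resW (F : ℤ → ℤ → ℤ → W) : ℤ → ℤ → W :=
  fun m k => ∑ᶠ j : ℕ, F (-1 - j) (m + j) k

/-- Minus the coefficient of `z^{-1}` of `F(z,w,x)/(z - w)`, expanded in `|w| > |z|`. -/
noncomputable def resZ (F : ℤ → ℤ → ℤ → W) : ℤ → ℤ → W :=
  fun m k => ∑ᶠ j : ℕ, F j (m - 1 - j) k

theorem resW_finite {F : ℤ → ℤ → ℤ → W} (h : F ∈ boundedW W) (m k : ℤ) :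
    ∃ K : ℕ, ∀ j, K ≤ j → ∀ l, F l (m + (j : ℕ)) k = 0 := by
  obtain ⟨M, hM⟩ := h k
  exact ⟨(M - m).toNat, fun j hj l => hM _ (by omega) l⟩

theorem resZ_finite {F : ℤ → ℤ → ℤ → W} (h : F ∈ boundedZ W) (k : ℤ) :
    ∃ K : ℕ, ∀ j, K ≤ j → ∀ m, F (j : ℕ) m k = 0 := by
  obtain ⟨M, hM⟩ := h k
  exact ⟨M.toNat, fun j hj m => hM _ (by omega) m⟩

/-- The residue is taken in z, so the factor w - x passes through it; boundedness makes the sums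
finite and allows splitting them. -/
theorem resW_diffWX {F : ℤ → ℤ → ℤ → W} (h : F ∈ boundedW W) :
    resW (diffWX W F) = diff2 W (resW F) := by
  ext m k
  obtain ⟨K1, h1⟩ := resW_finite h (m + 1) k
  obtain ⟨K2, h2⟩ := resW_finite h m (k + 1)
  have e1 : ∀ j : ℕ, m + j + 1 = m + 1 + j := fun j => by ring
  simp only [resW, diff2_apply, diffWX_apply, e1]
  rw [finsum_nat_eq_sum (K := max K1 K2), finsum_nat_eq_sum (K := max K1 K2),
    finsum_nat_eq_sum (K := max K1 K2), Finset.sum_sub_distrib]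
  · exact fun j hj => h2 j (le_trans (le_max_right _ _) hj) _
  · exact fun j hj => h1 j (le_trans (le_max_left _ _) hj) _
  · intro j hj
    rw [h1 j (le_trans (le_max_left _ _) hj), h2 j (le_trans (le_max_right _ _) hj), sub_zero]

theorem resZ_diffWX {F : ℤ → ℤ → ℤ → W} (h : F ∈ boundedZ W) :
    resZ (diffWX W F) = diff2 W (resZ F) := by
  ext m k
  obtain ⟨K1, h1⟩ := resZ_finite h k
  obtain ⟨K2, h2⟩ := resZ_finite h (k + 1)
  have e1 : ∀ j : ℕ, m - 1 - j + 1 = m + 1 - 1 - j := fun j => by ring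
  simp only [resZ, diff2_apply, diffWX_apply, e1]
  rw [finsum_nat_eq_sum (K := max K1 K2), finsum_nat_eq_sum (K := max K1 K2),
    finsum_nat_eq_sum (K := max K1 K2), Finset.sum_sub_distrib]
  · exact fun j hj => h2 j (le_trans (le_max_right _ _) hj) _
  · exact fun j hj => h1 j (le_trans (le_max_left _ _) hj) _
  · intro j hj
    rw [h1 j (le_trans (le_max_left _ _) hj), h2 j (le_trans (le_max_right _ _) hj), sub_zero]

theorem resW_diffWX_pow {F : ℤ → ℤ → ℤ → W} (h : F ∈ boundedW W) (N : ℕ) :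
    resW ((diffWX W ^ N) F) = (diff2 W ^ N) (resW F) := by
  induction N with
  | zero => simp
  | succ N ih =>
    rw [pow_succ', Module.End.mul_apply, resW_diffWX
      (pow_mem_of_stable (D := diffWX W) (fun F hF => (boundedW_diff hF).2.2) _ _ h), ih, pow_succ',
      Module.End.mul_apply]

theorem resZ_diffWX_pow {F : ℤ → ℤ → ℤ → W} (h : F ∈ boundedZ W) (N : ℕ) :
    resZ ((diffWX W ^ N) F) = (diff2 W ^ N) (resZ F) := by
  induction N with
  | zero => simp
  | succ N ih =>
    rw [pow_succ', Module.End.mul_apply, resZ_diffWX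
      (pow_mem_of_stable (D := diffWX W) (fun F hF => (boundedZ_diff hF).2.2) _ _ h), ih, pow_succ',
      Module.End.mul_apply]

/-- The factor z - w cancels the denominator and leaves the residue of E in z, which is the
coefficient of index 0. Concretely, the sum telescopes and boundedness kills the far end. In
`resZ_diffZW` the opposite sign appears, so the two contributions cancel in `diff2_pow_res_eq_zero`.
-/
theorem resW_diffZW {E : ℤ → ℤ → ℤ → W} (h : E ∈ boundedW W) : resW (diffZW W E) = E 0 := by
  ext m k
  obtain ⟨K, hK⟩ := resW_finite h m k
  have e : ∀ j : ℕ, E (-1 - j + 1) (m + j) k - E (-1 - j) (m + j + 1) k =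
      (fun i : ℕ => E (-i) (m + i) k) j - (fun i : ℕ => E (-i) (m + i) k) (j + 1) := fun j => by
    have e1 : -((j + 1 : ℕ) : ℤ) + 1 = -j := by push_cast; ring
    have e2 : (-1 - j : ℤ) = -((j + 1 : ℕ) : ℤ) := by push_cast; ring
    have e3 : m + j + 1 = m + ((j + 1 : ℕ) : ℤ) := by push_cast; ring
    simp only [e2, e1, e3]
  simp only [resW, diffZW_apply, e]
  rw [finsum_nat_eq_sum (K := K), Finset.sum_range_sub' (fun i : ℕ => E (-i) (m + i) k), hK K le_rfl]
  · simp
  · intro j hj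
    rw [hK j hj, hK (j + 1) (by omega), sub_zero]

theorem resZ_diffZW {E : ℤ → ℤ → ℤ → W} (h : E ∈ boundedZ W) : resZ (diffZW W E) = -E 0 := by
  ext m k
  obtain ⟨K, hK⟩ := resZ_finite h k
  have e : ∀ j : ℕ, E (j + 1) (m - 1 - j) k - E j (m - 1 - j + 1) k =
      (fun i : ℕ => E i (m - i) k) (j + 1) - (fun i : ℕ => E i (m - i) k) j := fun j => by
    have e1 : (j : ℤ) + 1 = ((j + 1 : ℕ) : ℤ) := by push_cast; ring
    have e2 : m - 1 - j = m - ((j + 1 : ℕ) : ℤ) := by push_cast; ring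
    have e3 : m - ((j + 1 : ℕ) : ℤ) + 1 = m - j := by push_cast; ring
    simp only [e1, e2, e3]
  simp only [resZ, diffZW_apply, e]
  rw [finsum_nat_eq_sum (K := K), Finset.sum_range_sub (fun i : ℕ => E i (m - i) k), hK K le_rfl]
  · simp
  · intro j hj
    rw [hK j hj, hK (j + 1) (by omega), sub_zero]

/-- Dong's lemma for normally ordered products. -/
theorem diff2_pow_res_eq_zero {N : ℕ} {U U' : ℤ → ℤ → ℤ → W} (hU : U ∈ boundedW W)
    (hU' : U' ∈ boundedZ W) (h : (diffZW W ^ N) (U - U') = 0)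
    (h1 : (diffWX W ^ N) ((diffZX W ^ N) U) = 0)
    (h2 : (diffWX W ^ N) ((diffZX W ^ N) U') = 0) :
    (diff2 W ^ (N + 2 * N)) (resW U + resZ U') = 0 := by
  obtain ⟨E, hE, hE', e1, e2⟩ := exists_diffZW_eq hU hU' h h1 h2
  rw [map_add, ← resW_diffWX_pow hU, ← resZ_diffWX_pow hU', e1, e2, resW_diffZW hE,
    resZ_diffZW hE', add_neg_cancel]

end Difference

/-! ## Local fields and their products -/

section Fields

variable {V : Type*} [AddCommGroup V] [Module ℂ V]

/-- The modes `A n` form a field: `A n b = 0` for `n` large. -/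
def IsFieldSeries (A : ℤ → Module.End ℂ V) : Prop :=
  ∀ b : V, ∃ M : ℤ, ∀ n, M ≤ n → A n b = 0

/-- The commutator of two series, with sign `ε`. -/
def superComm (ε : ℂ) (A B : ℤ → Module.End ℂ V) : ℤ → ℤ → Module.End ℂ V :=
  fun m n => A m * B n - ε • (B n * A m)

/-- Locality of two series, with respect to the commutator with sign `ε`. -/
def IsLocal (ε : ℂ) (A B : ℤ → Module.End ℂ V) : Prop :=
  ∃ N : ℕ, (diff2 (Module.End ℂ V) ^ N) (superComm ε A B) = 0

theorem diff2_pow_swap {W : Type*} [AddCommGroup W] [Module ℂ W] (F : ℤ → ℤ → W) (N : ℕ) (m n : ℤ) :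
    (diff2 W ^ N) (fun m n => F n m) m n = ((-1 : ℂ) ^ N) • (diff2 W ^ N) F n m := by
  induction N generalizing F m n with
  | zero => simp
  | succ N ih =>
    rw [pow_succ', Module.End.mul_apply, diff2_apply, ih F (m + 1) n, ih F m (n + 1),
      Module.End.mul_apply, diff2_apply, pow_succ (-1 : ℂ) N]
    module

theorem IsLocal.symm {ε : ℂ} (hε : ε * ε = 1) {A B : ℤ → Module.End ℂ V} (h : IsLocal ε A B) :
    IsLocal ε B A := by
  obtain ⟨N, hN⟩ := h
  refine ⟨N, ?_⟩
  have : superComm ε B A = (-ε) • fun m n => superComm ε A B n m := by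
    ext m n x
    simp only [superComm, Pi.smul_apply, LinearMap.sub_apply, LinearMap.smul_apply, smul_sub,
      smul_smul, neg_mul, hε]
    module
  rw [this, map_smul]
  ext m n x
  rw [Pi.smul_apply, Pi.smul_apply, diff2_pow_swap, hN]
  simp

theorem IsLocal.add {ε : ℂ} {A B B' : ℤ → Module.End ℂ V} (h : IsLocal ε A B)
    (h' : IsLocal ε A B') : IsLocal ε A (B + B') := by
  obtain ⟨N, hN⟩ := h
  obtain ⟨N', hN'⟩ := h'
  refine ⟨max N N', ?_⟩
  have : superComm ε A (B + B') = superComm ε A B + superComm ε A B' := by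
    ext m n x
    simp [superComm]
    abel
  rw [this, map_add, diff2_pow_eq_zero_of_le (le_max_left _ _) hN,
    diff2_pow_eq_zero_of_le (le_max_right _ _) hN', add_zero]

theorem IsLocal.smul {ε : ℂ} {A B : ℤ → Module.End ℂ V} (h : IsLocal ε A B) (a : ℂ) :
    IsLocal ε A (a • B) := by
  obtain ⟨N, hN⟩ := h
  refine ⟨N, ?_⟩
  have : superComm ε A (a • B) = a • superComm ε A B := by
    ext m n x
    simp [superComm, smul_sub, smul_comm a ε]
  rw [this, map_smul, hN, smul_zero]

theorem isLocal_zero (ε : ℂ) (A : ℤ → Module.End ℂ V) : IsLocal ε A 0 :=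
  ⟨0, by ext; simp [superComm]⟩

/-! ### Products of fields and their translation covariance -/

/-- The `n`-th product `A_(n) B` of two fields, `n ≥ 0`. -/
def natProd (ε : ℂ) (A B : ℤ → Module.End ℂ V) (n : ℕ) : ℤ → Module.End ℂ V :=
  (diff2 (Module.End ℂ V) ^ n) (superComm ε A B) 0

theorem natProd_zero (ε : ℂ) (A B : ℤ → Module.End ℂ V) (m : ℤ) :
    natProd ε A B 0 m = A 0 * B m - ε • (B m * A 0) := by
  simp [natProd, superComm]

theorem natProd_one (ε : ℂ) (A B : ℤ → Module.End ℂ V) (m : ℤ) :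
    natProd ε A B 1 m = (A 1 * B m - ε • (B m * A 1)) -
      (A 0 * B (m + 1) - ε • (B (m + 1) * A 0)) := by
  simp [natProd, superComm]

/-- The normally ordered product `A_(-1) B = :AB:` of two fields. -/
noncomputable def normalOrd (ε : ℂ) (A B : ℤ → Module.End ℂ V) (hA : IsFieldSeries A)
    (hB : IsFieldSeries B) : ℤ → Module.End ℂ V := fun m =>
  have key : ∀ v : V, ∃ K : ℕ, ∀ j : ℕ, K ≤ j → B (m + j) v = 0 ∧ A j v = 0 := fun v => by
    obtain ⟨M, hM⟩ := hB v
    obtain ⟨M', hM'⟩ := hA v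
    exact ⟨max (M - m).toNat M'.toNat, fun j hj => ⟨hM _ (by omega), hM' _ (by omega)⟩⟩
  -- The two sums have the shape of `resW` for A_l B_m v and of `resZ` for ε B_m A_l v; this is what
  -- makes Dong's lemma applicable.
  { toFun := fun v => ∑ᶠ j : ℕ, A (-1 - j) (B (m + j) v) + ε • ∑ᶠ j : ℕ, B (m - 1 - j) (A j v)
    map_add' := fun x y => by
      obtain ⟨K, hK⟩ := key x
      obtain ⟨K', hK'⟩ := key y
      have h1 : ∀ j, max K K' ≤ j → _ := fun j hj => hK j (le_trans (le_max_left _ _) hj)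
      have h2 : ∀ j, max K K' ≤ j → _ := fun j hj => hK' j (le_trans (le_max_right _ _) hj)
      rw [finsum_nat_eq_sum (K := max K K'), finsum_nat_eq_sum (K := max K K'),
        finsum_nat_eq_sum (K := max K K'), finsum_nat_eq_sum (K := max K K'),
        finsum_nat_eq_sum (K := max K K'), finsum_nat_eq_sum (K := max K K')]
      · simp only [map_add, Finset.sum_add_distrib, smul_add]
        abel
      all_goals
        intro j hj
        simp [h1 j hj, h2 j hj]
    map_smul' := fun a x => by
      obtain ⟨K, hK⟩ := key x
      rw [finsum_nat_eq_sum (K := K), finsum_nat_eq_sum (K := K), finsum_nat_eq_sum (K := K),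
        finsum_nat_eq_sum (K := K)]
      · simp only [map_smul, smul_add, Finset.smul_sum, RingHom.id_apply, smul_comm a ε]
      all_goals
        intro j hj
        simp [hK j hj] }

theorem normalOrd_apply (ε : ℂ) {A B : ℤ → Module.End ℂ V} (hA : IsFieldSeries A) (hB : IsFieldSeries B)
    (m : ℤ) (v : V) : normalOrd ε A B hA hB m v =
      ∑ᶠ j : ℕ, A (-1 - j) (B (m + j) v) + ε • ∑ᶠ j : ℕ, B (m - 1 - j) (A j v) := rfl

/-- Every sufficiently large cut-off works, so several normally ordered products can be expanded
over one common finite range. -/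
theorem normalOrd_eventually (ε : ℂ) {A B : ℤ → Module.End ℂ V} (hA : IsFieldSeries A) (hB : IsFieldSeries B)
    (m : ℤ) (v : V) : ∃ K₀ : ℕ, ∀ K, K₀ ≤ K → normalOrd ε A B hA hB m v =
      ∑ j ∈ Finset.range K, A (-1 - j) (B (m + j) v) +
        ε • ∑ j ∈ Finset.range K, B (m - 1 - j) (A j v) := by
  obtain ⟨M, hM⟩ := hB v
  obtain ⟨M', hM'⟩ := hA v
  refine ⟨max (M - m).toNat M'.toNat, fun K hK => ?_⟩
  rw [normalOrd_apply, finsum_nat_eq_sum (K := K), finsum_nat_eq_sum (K := K)]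
  · intro j hj; rw [hM' _ (by omega), map_zero]
  · intro j hj; rw [hM _ (by omega), map_zero]

theorem IsFieldSeries.exists_forall_lt {B : ℤ → Module.End ℂ V} (hB : IsFieldSeries B) (f : ℕ → V) (J : ℕ) :
    ∃ M : ℤ, ∀ j < J, ∀ n, M ≤ n → B n (f j) = 0 := by
  induction J with
  | zero => exact ⟨0, by simp⟩
  | succ J ih =>
    obtain ⟨M, hM⟩ := ih
    obtain ⟨M', hM'⟩ := hB (f J)
    refine ⟨max M M', fun j hj n hn => ?_⟩
    rcases Nat.lt_succ_iff_lt_or_eq.1 hj with h | rfl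
    · exact hM j h n (le_trans (le_max_left _ _) hn)
    · exact hM' n (le_trans (le_max_right _ _) hn)

theorem isFieldSeries_normalOrd (ε : ℂ) {A B : ℤ → Module.End ℂ V} (hA : IsFieldSeries A) (hB : IsFieldSeries B) :
    IsFieldSeries (normalOrd ε A B hA hB) := by
  intro v
  obtain ⟨M, hM⟩ := hB v
  obtain ⟨M', hM'⟩ := hA v
  obtain ⟨M'', hM''⟩ := hB.exists_forall_lt (fun j => A j v) M'.toNat
  refine ⟨max M (M'' + M'.toNat + 1), fun m hm => ?_⟩
  have h1 : ∀ j : ℕ, A (-1 - j) (B (m + j) v) = 0 := fun j => by rw [hM _ (by omega), map_zero]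
  have h2 : ∀ j : ℕ, B (m - 1 - j) (A j v) = 0 := fun j => by
    rcases lt_or_ge j M'.toNat with h | h
    · exact hM'' j h _ (by omega)
    · rw [hM' _ (by omega), map_zero]
  simp [normalOrd_apply, h1, h2]

theorem isFieldSeries_natProd (ε : ℂ) {A B : ℤ → Module.End ℂ V} (hB : IsFieldSeries B) (n : ℕ) :
    IsFieldSeries (natProd ε A B n) := by
  intro v
  obtain ⟨M, hM⟩ := hB v
  obtain ⟨M', hM'⟩ := hB.exists_forall_lt (fun j => A j v) (n + 1)
  refine ⟨max M M', fun m hm => ?_⟩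
  rw [natProd, diff2_pow_apply, LinearMap.sum_apply]
  refine Finset.sum_eq_zero fun j hj => ?_
  have hj' : j < n + 1 := Finset.mem_range.1 hj
  have e : (0 : ℤ) + n - j = ((n - j : ℕ) : ℤ) := by push_cast [Nat.lt_succ_iff.1 hj']; ring
  rw [superComm, LinearMap.smul_apply, LinearMap.sub_apply, LinearMap.smul_apply,
    Module.End.mul_apply, Module.End.mul_apply, hM _ (by omega), e,
    hM' (n - j) (by omega) _ (by omega)]
  simp

/-- `[T, A(z)] = ∂ A(z)`. -/
def IsTranslationCovariant (T : Module.End ℂ V) (A : ℤ → Module.End ℂ V) : Prop :=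
  ∀ n : ℤ, T * A n - A n * T = (-(n : ℂ)) • A (n - 1)

theorem IsTranslationCovariant.apply {T : Module.End ℂ V} {A : ℤ → Module.End ℂ V}
    (h : IsTranslationCovariant T A) (n : ℤ) (v : V) :
    T (A n v) = A n (T v) - (n : ℂ) • A (n - 1) v := by
  have := LinearMap.congr_fun (h n) v
  simp only [neg_smul, LinearMap.sub_apply, Module.End.mul_apply, LinearMap.neg_apply,
    LinearMap.smul_apply] at this
  rw [sub_eq_iff_eq_add'] at this
  rw [this]; module

/-- Since ∂_z + ∂_w annihilates z - w, two-variable covariance survives every power of `diff2`.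
Setting the first index to 0 removes the ∂_z term, whose coefficient is that index. -/
theorem isTranslationCovariant_natProd (ε : ℂ) {T : Module.End ℂ V} {A B : ℤ → Module.End ℂ V}
    (hA : IsTranslationCovariant T A) (hB : IsTranslationCovariant T B) (n : ℕ) :
    IsTranslationCovariant T (natProd ε A B n) := by
  have key : ∀ (F : ℤ → ℤ → Module.End ℂ V), (∀ m k v, T (F m k v) = F m k (T v) -
      (m : ℂ) • F (m - 1) k v - (k : ℂ) • F m (k - 1) v) → ∀ (n : ℕ) m k v,
        T ((diff2 _ ^ n) F m k v) = (diff2 _ ^ n) F m k (T v) -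
          (m : ℂ) • (diff2 _ ^ n) F (m - 1) k v - (k : ℂ) • (diff2 _ ^ n) F m (k - 1) v := by
    intro F hF n
    induction n with
    | zero => simpa using hF
    | succ n ih =>
      intro m k v
      simp only [pow_succ', Module.End.mul_apply, diff2_apply, LinearMap.sub_apply, map_sub, ih]
      rw [show m + 1 - 1 = m by ring, show k + 1 - 1 = k by ring, show m - 1 + 1 = m by ring,
        show k - 1 + 1 = k by ring]
      push_cast
      module
  intro m
  ext v
  have := key (superComm ε A B) (fun m k v => by
    simp only [superComm, LinearMap.sub_apply, LinearMap.smul_apply, Module.End.mul_apply, map_sub,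
      map_smul, hA.apply, hB.apply]
    module) n 0 m v
  simp only [LinearMap.sub_apply, Module.End.mul_apply, LinearMap.smul_apply, natProd]
  rw [this]
  simp

/-- In each of the two sums the commutator with T produces the wanted term -m times the mode m - 1
together with a telescoping difference whose boundary terms vanish for a large cut-off. -/
theorem isTranslationCovariant_normalOrd (ε : ℂ) {T : Module.End ℂ V} {A B : ℤ → Module.End ℂ V}
    (hA : IsFieldSeries A) (hB : IsFieldSeries B) (hTA : IsTranslationCovariant T A)
    (hTB : IsTranslationCovariant T B) : IsTranslationCovariant T (normalOrd ε A B hA hB) := by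
  intro m
  ext v
  obtain ⟨K1, h1⟩ := normalOrd_eventually ε hA hB m v
  obtain ⟨K2, h2⟩ := normalOrd_eventually ε hA hB m (T v)
  obtain ⟨K3, h3⟩ := normalOrd_eventually ε hA hB (m - 1) v
  obtain ⟨M, hM⟩ := hB v
  obtain ⟨M', hM'⟩ := hA v
  obtain ⟨K, hK⟩ : ∃ K : ℕ, K1 ≤ K ∧ K2 ≤ K ∧ K3 ≤ K ∧ M - m + 1 ≤ K ∧ M' + 1 ≤ K ∧ 1 ≤ K :=
    ⟨K1 + K2 + K3 + (M - m + 1).toNat + (M' + 1).toNat + 1, by omega⟩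
  simp only [LinearMap.sub_apply, Module.End.mul_apply, LinearMap.smul_apply]
  rw [h1 K hK.1, h2 K hK.2.1, h3 K hK.2.2.1, map_add, map_smul, map_sum, map_sum]
  set f : ℕ → V := fun j => A (-1 - j) (B (m - 1 + j) v) with hf
  set g : ℕ → V := fun j => B (m - 1 - 1 - j) (A j v) with hg
  have e1 : ∀ j : ℕ, T (A (-1 - j) (B (m + j) v)) = A (-1 - j) (B (m + j) (T v)) +
      ((((j + 1 : ℕ) : ℂ) • f (j + 1) - (j : ℂ) • f j) - (m : ℂ) • f j) := fun j => by
    rw [hTA.apply, hTB.apply, map_sub, map_smul, hf]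
    simp only
    rw [show (-1 - (j : ℤ) - 1) = -1 - ((j + 1 : ℕ) : ℤ) by push_cast; ring,
      show m + (j : ℤ) - 1 = m - 1 + j by ring,
      show m - 1 + ((j + 1 : ℕ) : ℤ) = m + j by push_cast; ring]
    push_cast
    module
  have e2 : ∀ j : ℕ, T (B (m - 1 - j) (A j v)) = B (m - 1 - j) (A j (T v)) +
      ((((j + 1 : ℕ) : ℂ) • g j - (j : ℂ) • B (m - 1 - j) (A (j - 1) v)) - (m : ℂ) • g j) :=
    fun j => by
      rw [hTB.apply, hTA.apply, map_sub, map_smul, hg]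
      simp only
      rw [show m - 1 - (j : ℤ) - 1 = m - 1 - 1 - j by ring]
      push_cast
      module
  have t1 : ∑ j ∈ Finset.range K, (((j + 1 : ℕ) : ℂ) • f (j + 1) - (j : ℂ) • f j) = 0 := by
    rw [Finset.sum_range_sub (fun j : ℕ => (j : ℂ) • f j)]
    simp only [hf]
    rw [hM _ (by omega)]
    simp
  have t2 : ∑ j ∈ Finset.range K,
      (((j + 1 : ℕ) : ℂ) • g j - (j : ℂ) • B (m - 1 - j) (A (j - 1) v)) = 0 := by
    have := Finset.sum_range_sub (fun j : ℕ => (j : ℂ) • B (m - 1 - j) (A (j - 1) v)) K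
    rw [hM' _ (by omega)] at this
    simp only [map_zero, smul_zero, Nat.cast_zero, zero_smul, sub_zero] at this
    rw [← this]
    refine Finset.sum_congr rfl fun j _ => ?_
    congr 2
    simp only [hg]
    rw [show m - 1 - ((j + 1 : ℕ) : ℤ) = m - 1 - 1 - j by push_cast; ring,
      show ((j + 1 : ℕ) : ℤ) - 1 = j by push_cast; ring]
  simp only [e1, e2]
  rw [Finset.sum_add_distrib, Finset.sum_sub_distrib, t1, Finset.sum_add_distrib,
    Finset.sum_sub_distrib, t2, ← Finset.smul_sum, ← Finset.smul_sum]
  module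

/-! ### Dong's lemma -/

theorem diff2_pow_superComm {ε : ℂ} {A B : ℤ → Module.End ℂ V} {N : ℕ}
    (h : (diff2 (Module.End ℂ V) ^ N) (superComm ε A B) = 0) {W : Type*} [AddCommGroup W]
    [Module ℂ W] (f : Module.End ℂ V →ₗ[ℂ] W) :
    (diff2 W ^ N) (fun m n => f (superComm ε A B m n)) = 0 := by
  rw [diff2_pow_map, h]
  ext; simp

section Dong

variable {ε ε₁ ε₂ : ℂ} {A B C : ℤ → Module.End ℂ V} {N : ℕ}

/-- The map `X ↦ P (X v)` on operators. -/
def sandwich (P : Module.End ℂ V) (v : V) : Module.End ℂ V →ₗ[ℂ] V where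
  toFun X := P (X v)
  map_add' := by simp
  map_smul' := by simp

/-- The two series are the brackets of A_l B_m and of ε B_m A_l with C_k, applied to v. Their
difference is the bracket of [A_l, B_m] with C_k, so it is linear in [A_l, B_m]. -/
theorem dong_left (hAB : (diff2 (Module.End ℂ V) ^ N) (superComm ε A B) = 0) (v : V) :
    (diffZW V ^ N) ((fun l m k => A l (B m (C k v)) - (ε₁ * ε₂) • C k (A l (B m v))) -
      fun l m k => ε • (B m (A l (C k v)) - (ε₁ * ε₂) • C k (B m (A l v)))) = 0 := by
  have : ((fun l m k => A l (B m (C k v)) - (ε₁ * ε₂) • C k (A l (B m v))) -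
      fun l m k => ε • (B m (A l (C k v)) - (ε₁ * ε₂) • C k (B m (A l v)))) =
      fun l m k => (sandwich 1 (C k v) - (ε₁ * ε₂) • sandwich (C k) v) (superComm ε A B l m) := by
    ext l m k
    simp only [sandwich, superComm, Pi.sub_apply, LinearMap.sub_apply, LinearMap.smul_apply,
      LinearMap.coe_mk, AddHom.coe_mk, Module.End.mul_apply, Module.End.one_apply, map_sub,
      map_smul]
  rw [this]
  ext l m k
  rw [diffZW_pow_apply, diff2_pow_superComm hAB]
  rfl

/-- Super Leibniz rule: the bracket of A_l B_m with C_k is A_l [B_m, C_k] + ε₂ [A_l, C_k] B_m.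
Powers of w - x kill the first term and powers of z - x the second. -/
theorem dong_right (hAC : (diff2 (Module.End ℂ V) ^ N) (superComm ε₁ A C) = 0)
    (hBC : (diff2 (Module.End ℂ V) ^ N) (superComm ε₂ B C) = 0) (v : V) :
    (diffWX V ^ N) ((diffZX V ^ N)
      (fun l m k => A l (B m (C k v)) - (ε₁ * ε₂) • C k (A l (B m v)))) = 0 ∧
    (diffWX V ^ N) ((diffZX V ^ N)
      (fun l m k => ε • (B m (A l (C k v)) - (ε₁ * ε₂) • C k (B m (A l v))))) = 0 := by
  have van : ∀ F F' : ℤ → ℤ → ℤ → V, (diffWX V ^ N) F = 0 → (diffZX V ^ N) F' = 0 →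
      (diffWX V ^ N) ((diffZX V ^ N) (F + F')) = 0 := fun F F' h h' => by
    rw [map_add, h', add_zero, ← Module.End.mul_apply,
      ((commute_diffZX_diffWX (W := V)).symm.pow_pow N N).eq, Module.End.mul_apply, h, map_zero]
  have hz : ∀ f : ℤ → Module.End ℂ V →ₗ[ℂ] V,
      (diffZX V ^ N) (fun l m k => f m (superComm ε₁ A C l k)) = 0 := fun f => by
    ext l m k
    rw [diffZX_pow_apply, diff2_pow_superComm hAC]; rfl
  have hw : ∀ f : ℤ → Module.End ℂ V →ₗ[ℂ] V,
      (diffWX V ^ N) (fun l m k => f l (superComm ε₂ B C m k)) = 0 := fun f => by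
    ext l m k
    rw [diffWX_pow_apply, diff2_pow_superComm hBC]; rfl
  constructor
  · convert van _ _ (hw fun l => sandwich (A l) v) (hz fun m => ε₂ • sandwich 1 (B m v)) using 3
    ext l m k
    simp only [sandwich, superComm, Pi.add_apply, LinearMap.smul_apply,
      LinearMap.coe_mk, AddHom.coe_mk, Module.End.mul_apply, Module.End.one_apply, map_sub,
      map_smul]
    module
  · convert van _ _ (hw fun l => (ε * ε₁) • sandwich 1 (A l v))
      (hz fun m => ε • sandwich (B m) v) using 3
    ext l m k
    simp only [sandwich, superComm, Pi.add_apply, LinearMap.smul_apply,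
      LinearMap.coe_mk, AddHom.coe_mk, Module.End.mul_apply, Module.End.one_apply, map_sub,
      map_smul]
    module

theorem isLocal_of_forall {M : ℕ} (h : ∀ v : V, (diff2 V ^ M)
    (fun m n => (superComm ε A B m n) v) = 0) : IsLocal ε A B := by
  refine ⟨M, ?_⟩
  ext m n v
  have := congr_fun (congr_fun (h v) m) n
  have e := congr_fun (congr_fun (diff2_pow_map (sandwich 1 v) M (superComm ε A B)) m) n
  exact e.symm.trans this

theorem IsLocal.exists_common {A' B' A'' B'' : ℤ → Module.End ℂ V} (h : IsLocal ε A B)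
    (h' : IsLocal ε₁ A' B') (h_right : IsLocal ε₂ A'' B'') : ∃ N : ℕ,
      (diff2 (Module.End ℂ V) ^ N) (superComm ε A B) = 0 ∧
      (diff2 (Module.End ℂ V) ^ N) (superComm ε₁ A' B') = 0 ∧
      (diff2 (Module.End ℂ V) ^ N) (superComm ε₂ A'' B'') = 0 := by
  obtain ⟨N, h⟩ := h
  obtain ⟨N', h'⟩ := h'
  obtain ⟨N'', h_right⟩ := h_right
  exact ⟨N + N' + N'', diff2_pow_eq_zero_of_le (by omega) h, diff2_pow_eq_zero_of_le (by omega) h',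
    diff2_pow_eq_zero_of_le (by omega) h_right⟩

/-- Dong's lemma for the products `A_(n) B`, `n ≥ 0`. -/
theorem isLocal_natProd (hAB : IsLocal ε A B) (hAC : IsLocal ε₁ A C) (hBC : IsLocal ε₂ B C)
    (n : ℕ) : IsLocal (ε₁ * ε₂) (natProd ε A B n) C := by
  obtain ⟨N, hAB, hAC, hBC⟩ := hAB.exists_common hAC hBC
  refine isLocal_of_forall (M := N + 2 * N) fun v => ?_
  have h1 := diffWX_pow_sub_eq_zero (dong_left (ε₁ := ε₁) (ε₂ := ε₂) (C := C) hAB v)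
    (dong_right (ε := ε) hAC hBC v).1 (dong_right hAC hBC v).2
  set U : ℤ → ℤ → ℤ → V := (fun l m k => A l (B m (C k v)) - (ε₁ * ε₂) • C k (A l (B m v))) -
      fun l m k => ε • (B m (A l (C k v)) - (ε₁ * ε₂) • C k (B m (A l v))) with hU
  -- Multiplications commute, so the factor (z - w)^n of the n-th product does no harm; the product
  -- itself is read off at z-index 0.
  have h2 : (diffWX V ^ (N + 2 * N)) ((diffZW V ^ n) U) = 0 := by
    rw [← Module.End.mul_apply, ((commute_diffZW_diffWX (W := V)).symm.pow_pow _ _).eq,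
      Module.End.mul_apply, h1, map_zero]
  have h3 : (fun m k => (superComm (ε₁ * ε₂) (natProd ε A B n) C m k) v) =
      ((diffZW V ^ n) U) 0 := by
    ext m k
    rw [diffZW_pow_apply]
    have : (fun l m => U l m k) = fun l m =>
        (sandwich 1 (C k v) - (ε₁ * ε₂) • sandwich (C k) v) (superComm ε A B l m) := by
      ext l m
      simp only [hU, sandwich, superComm, Pi.sub_apply, LinearMap.sub_apply, LinearMap.smul_apply,
        LinearMap.coe_mk, AddHom.coe_mk, Module.End.mul_apply, Module.End.one_apply, map_sub,
        map_smul]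
    rw [this, diff2_pow_map]
    simp [natProd, sandwich, superComm]
  rw [h3]
  ext m k
  have := congr_fun (congr_fun (congr_fun h2 0) m) k
  rwa [diffWX_pow_apply] at this

/-- Dong's lemma for the normally ordered product. -/
theorem isLocal_normalOrd (hA : IsFieldSeries A) (hB : IsFieldSeries B) (hAB : IsLocal ε A B)
    (hAC : IsLocal ε₁ A C) (hBC : IsLocal ε₂ B C) :
    IsLocal (ε₁ * ε₂) (normalOrd ε A B hA hB) C := by
  obtain ⟨N, hAB, hAC, hBC⟩ := hAB.exists_common hAC hBC
  refine isLocal_of_forall (M := N + 2 * N) fun v => ?_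
  have hU : (fun l m k => A l (B m (C k v)) - (ε₁ * ε₂) • C k (A l (B m v))) ∈ boundedW V := by
    intro k
    obtain ⟨M, hM⟩ := hB (C k v)
    obtain ⟨M', hM'⟩ := hB v
    refine ⟨max M M', fun m hm l => ?_⟩
    simp [hM m (le_trans (le_max_left _ _) hm), hM' m (le_trans (le_max_right _ _) hm)]
  have hU' : (fun l m k => ε • (B m (A l (C k v)) - (ε₁ * ε₂) • C k (B m (A l v)))) ∈
      boundedZ V := by
    intro k
    obtain ⟨M, hM⟩ := hA (C k v)
    obtain ⟨M', hM'⟩ := hA v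
    refine ⟨max M M', fun l hl m => ?_⟩
    simp [hM l (le_trans (le_max_left _ _) hl), hM' l (le_trans (le_max_right _ _) hl)]
  have := diff2_pow_res_eq_zero hU hU' (dong_left hAB v) (dong_right (ε := ε) hAC hBC v).1
    (dong_right hAC hBC v).2
  convert this using 2
  ext m k
  obtain ⟨K1, h1⟩ := normalOrd_eventually ε hA hB m v
  obtain ⟨K2, h2⟩ := normalOrd_eventually ε hA hB m (C k v)
  obtain ⟨K3, h3⟩ := resW_finite hU m k
  obtain ⟨K4, h4⟩ := resZ_finite hU' k
  simp only [superComm, LinearMap.sub_apply, LinearMap.smul_apply, Module.End.mul_apply,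
    Pi.add_apply, resW, resZ]
  rw [h1 (K1 + K2 + K3 + K4) (by omega), h2 (K1 + K2 + K3 + K4) (by omega),
    finsum_nat_eq_sum (K := K1 + K2 + K3 + K4) (fun j hj => h3 j (by omega) _),
    finsum_nat_eq_sum (K := K1 + K2 + K3 + K4) (fun j hj => h4 j (by omega) _)]
  simp only [Finset.sum_sub_distrib, ← Finset.smul_sum, map_add, map_smul, map_sum]
  module

end Dong

end Fields

/-! ## The state-field correspondence -/

/-- The sign `(-1)^{pq}`. -/
def paritySign (p q : ZMod 2) : ℂ := (-1) ^ (p.val * q.val)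

theorem zmod_two_cases (p : ZMod 2) : p = 0 ∨ p = 1 := by
  revert p; decide

theorem paritySign_zero_left (q : ZMod 2) : paritySign 0 q = 1 := by
  simp [paritySign]

theorem paritySign_comm (p q : ZMod 2) : paritySign p q = paritySign q p := by
  rw [paritySign, paritySign, mul_comm]

theorem paritySign_mul_self (p q : ZMod 2) : paritySign p q * paritySign p q = 1 := by
  rw [paritySign, ← mul_pow]; simp

theorem paritySign_one_one : paritySign 1 1 = -1 := by
  simp [paritySign, ZMod.val_one]

theorem paritySign_add_left (p q r : ZMod 2) :
    paritySign (p + q) r = paritySign p r * paritySign q r := by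
  have e : (1 + 1 : ZMod 2) = 0 := by decide
  rcases zmod_two_cases p with rfl | rfl <;> rcases zmod_two_cases q with rfl | rfl <;>
    rcases zmod_two_cases r with rfl | rfl <;>
    simp [paritySign, ZMod.val_one, e]

namespace NSAction

variable {V : Type*} [AddCommGroup V] [Module ℂ V] {ρ : NSAction V}

/-- A cyclic representation generated by a translation invariant even lowest weight vector. -/
structure IsVacuumModule (ρ : NSAction V) (c : ℝ) (Ω : V) : Prop where
  rep : ρ.IsRepresentation (c : ℂ)
  cyc : ρ.IsCyclicLowestWeight Ω 0
  even : Ω ∈ ρ.parity 0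
  G_neg_one : ρ.G (-1) Ω = 0

/-- The modes `τ_(n) = G_{n - 1/2}`. -/
def tauField (ρ : NSAction V) : ℤ → Module.End ℂ V := fun n => ρ.G (n - 1)

/-- The modes `ν_(n) = L_{n - 1}`. -/
def nuField (ρ : NSAction V) : ℤ → Module.End ℂ V := fun n => ρ.L (n - 1)

/-- The modes of the identity field. -/
def oneField (V : Type*) [AddCommGroup V] [Module ℂ V] : ℤ → Module.End ℂ V :=
  fun n => if n = -1 then 1 else 0

theorem isLocal_oneField (A : ℤ → Module.End ℂ V) : IsLocal 1 A (oneField V) := by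
  refine ⟨0, ?_⟩
  ext m n x
  simp only [superComm, pow_zero, Module.End.one_apply, oneField]
  split_ifs <;> simp

/-- The translation covariant fields of parity `p` that are local with respect to `τ(z)`. -/
def fields (ρ : NSAction V) (p : ZMod 2) : Submodule ℂ (ℤ → Module.End ℂ V) where
  carrier := {A | IsFieldSeries A ∧ (∀ q n, ∀ x ∈ ρ.parity q, A n x ∈ ρ.parity (p + q)) ∧
    IsTranslationCovariant (ρ.L (-1)) A ∧ IsLocal (paritySign 1 p) ρ.tauField A}
  zero_mem' := ⟨fun _ => ⟨0, fun _ _ => rfl⟩, fun q n x _ => (ρ.parity _).zero_mem,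
    fun n => by simp, isLocal_zero _ _⟩
  add_mem' := by
    rintro A B ⟨h1, h2, h3, h4⟩ ⟨h1', h2', h3', h4'⟩
    refine ⟨fun b => ?_, fun q n x hx => (ρ.parity _).add_mem (h2 q n x hx) (h2' q n x hx),
      fun n => ?_, h4.add h4'⟩
    · obtain ⟨M, hM⟩ := h1 b
      obtain ⟨M', hM'⟩ := h1' b
      refine ⟨max M M', fun n hn => ?_⟩
      simp [hM n (le_trans (le_max_left _ _) hn), hM' n (le_trans (le_max_right _ _) hn)]
    · rw [Pi.add_apply, Pi.add_apply, smul_add, ← h3, ← h3', mul_add, add_mul]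
      abel
  smul_mem' := by
    rintro a A ⟨h1, h2, h3, h4⟩
    refine ⟨fun b => ?_, fun q n x hx => (ρ.parity _).smul_mem _ (h2 q n x hx), fun n => ?_,
      h4.smul a⟩
    · obtain ⟨M, hM⟩ := h1 b
      exact ⟨M, fun n hn => by simp [hM n hn]⟩
    · rw [Pi.smul_apply, Pi.smul_apply, smul_comm, ← h3, mul_smul_comm, smul_mul_assoc, smul_sub]

namespace IsVacuumModule

variable {c : ℝ} {Ω : V}

theorem L_neg_one (h : ρ.IsVacuumModule c Ω) : ρ.L (-1) Ω = 0 := by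
  have := h.rep.relations.GG_apply_of_ne (r := -1) (s := -1) (by norm_num) Ω
  norm_num at this
  rw [this, h.G_neg_one]
  simp

theorem eventually_zero (h : ρ.IsVacuumModule c Ω) (x : V) :
    ∃ M : ℤ, ∀ n, M ≤ n → ρ.G n x = 0 ∧ ρ.L n x = 0 := by
  induction x using word_induction h.rep h.cyc with
  | zero => exact ⟨0, by simp⟩
  | add x y hx hy =>
    obtain ⟨M, hM⟩ := hx
    obtain ⟨M', hM'⟩ := hy
    refine ⟨max M M', fun n hn => ?_⟩
    have h1 := hM n (le_trans (le_max_left _ _) hn)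
    have h2 := hM' n (le_trans (le_max_right _ _) hn)
    simp [h1, h2]
  | smul a x hx =>
    obtain ⟨M, hM⟩ := hx
    exact ⟨M, fun n hn => by simp [hM n hn]⟩
  | vac => exact ⟨0, fun n hn => ⟨h.cyc.isNSVacuum.G_nonneg n hn, h.cyc.isNSVacuum.L_nonneg n hn⟩⟩
  | step s k x hs _ hx =>
    obtain ⟨M, hM⟩ := hx
    refine ⟨max (M + 2) 2, fun n hn => ?_⟩
    have hn1 : M + 2 ≤ n := le_trans (le_max_left _ _) hn
    have hn2 : 2 ≤ n := le_trans (le_max_right _ _) hn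
    rw [h.rep.relations.GG_apply, h.rep.relations.LG_apply, (hM n (by omega)).1,
      (hM n (by omega)).2, (hM (n + s) (by omega)).1, (hM (n + s + 1) (by omega)).2,
      if_neg (by omega)]
    simp

theorem isFieldSeries_tau (h : ρ.IsVacuumModule c Ω) : IsFieldSeries ρ.tauField := fun x => by
  obtain ⟨M, hM⟩ := h.eventually_zero x
  exact ⟨M + 1, fun n hn => (hM (n - 1) (by omega)).1⟩

theorem isFieldSeries_nu (h : ρ.IsVacuumModule c Ω) : IsFieldSeries ρ.nuField := fun x => by
  obtain ⟨M, hM⟩ := h.eventually_zero x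
  exact ⟨M + 1, fun n hn => (hM (n - 1) (by omega)).2⟩

theorem tau_mem_fields (h : ρ.IsVacuumModule c Ω) : ρ.tauField ∈ ρ.fields 1 := by
  -- Order 3: for fixed m + n the bracket of τ with itself depends on m through a polynomial of
  -- degree 2, coming from the central term.
  refine ⟨h.isFieldSeries_tau, fun q n x hx => ?_, fun n => ?_, 3, ?_⟩
  · rw [add_comm]; exact h.rep.G_parity _ _ x hx
  · rw [tauField, tauField, h.rep.comm_LG, show -1 + (n - 1) = n - 1 - 1 by ring]
    congr 1
    push_cast
    ring
  · ext m n x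
    simp only [diff2_pow_apply, paritySign_one_one, superComm, tauField, neg_smul, one_smul,
      sub_neg_eq_add, h.rep.comm_GG, Finset.sum_range_succ, Finset.sum_range_zero]
    have e : ∀ j : ℤ, m + (3 : ℕ) - j - 1 + (n + j - 1) + 1 = m + n + 2 := fun j => by
      push_cast; ring
    simp only [e, Pi.zero_apply, Nat.choose]
    split_ifs <;> simp <;> module

theorem nu_mem_fields (h : ρ.IsVacuumModule c Ω) : ρ.nuField ∈ ρ.fields 0 := by
  -- Order 2: for fixed m + n the bracket of τ with ν has a coefficient of degree 1 in m.
  refine ⟨h.isFieldSeries_nu, fun q n x hx => ?_, fun n => ?_, 2, ?_⟩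
  · rw [zero_add]; exact h.rep.L_parity _ _ x hx
  · rw [nuField, nuField, h.rep.comm_LL, show -1 + (n - 1) = n - 1 - 1 by ring]
    have : (if (-1 : ℤ) = -(n - 1) then (c : ℂ) * (((-1 : ℤ) : ℂ) ^ 3 - ((-1 : ℤ) : ℂ)) / 12
        else 0) = 0 := by split_ifs <;> norm_num
    rw [this, zero_smul, add_zero]
    congr 1
    push_cast
    ring
  · have e1 : superComm (paritySign 1 0) ρ.tauField ρ.nuField = fun m n : ℤ =>
        (((m : ℂ) - 1 / 2) - ((n : ℂ) - 1) / 2) • ρ.G ((m + n - 2 : ℤ)) := by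
      ext m n x
      have := LinearMap.congr_fun (h.rep.comm_LG (n - 1) (m - 1)) x
      rw [show n - 1 + (m - 1) = m + n - 2 by ring] at this
      simp only [superComm, paritySign_comm 1 0, paritySign_zero_left, one_smul, tauField, nuField]
      rw [← neg_sub, LinearMap.neg_apply, this]
      simp only [LinearMap.smul_apply]
      push_cast
      module
    rw [e1]
    ext m n x
    simp only [diff2_pow_apply, Finset.sum_range_succ, Finset.sum_range_zero]
    have e : ∀ j : ℤ, m + (2 : ℕ) - j + (n + j) - 2 = m + n := fun j => by
      push_cast; ring
    simp only [e, Pi.zero_apply, Nat.choose]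
    simp
    module

theorem one_mem_fields : oneField V ∈ ρ.fields 0 := by
  refine ⟨fun b => ⟨0, fun n hn => ?_⟩, fun q n x hx => ?_, fun n => ?_, ?_⟩
  · rw [oneField, if_neg (by omega)]; rfl
  · rw [zero_add, oneField]
    split_ifs
    · exact hx
    · exact (ρ.parity q).zero_mem
  · by_cases h1 : n = -1
    · subst h1; simp [oneField]
    · by_cases h2 : n = 0
      · subst h2; simp [oneField]
      · rw [oneField, oneField, if_neg h1, if_neg (by omega)]; simp
  · rw [paritySign_comm, paritySign_zero_left]
    exact isLocal_oneField _

/-! ### Fields are determined by their states, and every state has a field -/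

/-- `A(z) Ω` has no negative powers of `z`. -/
theorem apply_vac_nonneg (h : ρ.IsVacuumModule c Ω) {p : ZMod 2} {A : ℤ → Module.End ℂ V}
    (hA : A ∈ ρ.fields p) {n : ℤ} (hn : 0 ≤ n) : A n Ω = 0 := by
  obtain ⟨M, hM⟩ := hA.1 Ω
  have key : ∀ k : ℕ, ∀ n : ℤ, 0 ≤ n → M ≤ n + k → A n Ω = 0 := by
    intro k
    induction k with
    | zero => intro n _ hn; exact hM n (by simpa using hn)
    | succ k ih =>
      intro n hn hk
      have h1 := hA.2.2.1.apply (n + 1) Ω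
      rw [ih (n + 1) (by omega) (by push_cast at hk; omega), h.L_neg_one, map_zero, map_zero,
        zero_sub, eq_comm, neg_eq_zero, smul_eq_zero, add_sub_cancel_right] at h1
      refine h1.resolve_left ?_
      exact_mod_cast (by omega : n + 1 ≠ 0)
  exact key (M - n).toNat n hn (by omega)

/-- Goddard's uniqueness theorem: a local field is determined by its state. -/
theorem eq_zero_of_apply_vac (h : ρ.IsVacuumModule c Ω) {p : ZMod 2} {A : ℤ → Module.End ℂ V}
    (hA : A ∈ ρ.fields p) (h0 : A (-1) Ω = 0) : A = 0 := by
  have key : ∀ x : V, ∀ n, A n x = 0 := by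
    intro x
    induction x using word_induction h.rep h.cyc with
    | zero => simp
    | add x y hx hy => intro n; rw [map_add, hx, hy, add_zero]
    | smul a x hx => intro n; rw [map_smul, hx, smul_zero]
    | vac =>
      have neg : ∀ k : ℕ, A (-1 - k) Ω = 0 := by
        intro k
        induction k with
        | zero => simpa using h0
        | succ k ih =>
          have h1 := hA.2.2.1.apply (-1 - k) Ω
          rw [ih, h.L_neg_one, map_zero, map_zero, zero_sub, eq_comm, neg_eq_zero,
            smul_eq_zero] at h1
          rw [show -1 - ((k + 1 : ℕ) : ℤ) = -1 - k - 1 by push_cast; ring]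
          refine h1.resolve_left ?_
          exact_mod_cast (by omega : (-1 - (k : ℤ)) ≠ 0)
      intro n
      rcases lt_or_ge n 0 with hn | hn
      · have := neg (-1 - n).toNat
        rwa [show -1 - ((-1 - n).toNat : ℤ) = n by omega] at this
      · exact h.apply_vac_nonneg hA hn
    | step s k x _ _ hx =>
      -- As A(z)x = 0, the commutator of A and τ on x reduces to A(z)τ(w)x. This is bounded in w and
      -- killed by a power of z - w, so it vanishes.
      obtain ⟨N, hN⟩ := hA.2.2.2.symm (paritySign_mul_self _ _)
      obtain ⟨M, hM⟩ := h.isFieldSeries_tau x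
      have h1 := diff2_pow_superComm hN (sandwich 1 x)
      have h2 := eq_zero_of_diff2_pow (M := M) h1 fun n hn m => by
        simp [sandwich, superComm, hM n hn, hx]
      intro n
      have := congr_fun (congr_fun h2 n) (s + 1)
      simpa [sandwich, superComm, hx, tauField] using this
  ext n x
  exact key x n

theorem parity_mem_zero (h : ρ.IsVacuumModule c Ω) {p q : ZMod 2} (hpq : p ≠ q) {x : V}
    (hp : x ∈ ρ.parity p) (hq : x ∈ ρ.parity q) : x = 0 :=
  Submodule.disjoint_def.1 (h.rep.parity_internal.submodule_iSupIndep.pairwiseDisjoint hpq) x hp hq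

theorem state_mem (h : ρ.IsVacuumModule c Ω) {p : ZMod 2} {A : ℤ → Module.End ℂ V}
    (hA : A ∈ ρ.fields p) : A (-1) Ω ∈ ρ.parity p := by
  simpa using hA.2.1 0 (-1) Ω h.even

theorem natProd_mem {p q : ZMod 2} {A B : ℤ → Module.End ℂ V}
    (hA : A ∈ ρ.fields p) (hB : B ∈ ρ.fields q) (hAB : IsLocal (paritySign p q) A B) (n : ℕ) :
    natProd (paritySign p q) A B n ∈ ρ.fields (p + q) := by
  refine ⟨isFieldSeries_natProd _ hB.1 n, fun r m x hx => ?_,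
    isTranslationCovariant_natProd _ hA.2.2.1 hB.2.2.1 n, ?_⟩
  · rw [natProd, diff2_pow_apply, LinearMap.sum_apply]
    refine Submodule.sum_mem _ fun j _ => Submodule.smul_mem _ _ (Submodule.sub_mem _ ?_
      (Submodule.smul_mem _ _ ?_))
    · rw [add_assoc]; exact hA.2.1 _ _ _ (hB.2.1 _ _ _ hx)
    · rw [add_comm p q, add_assoc]; exact hB.2.1 _ _ _ (hA.2.1 _ _ _ hx)
  · refine IsLocal.symm (paritySign_mul_self _ _) ?_
    rw [paritySign_comm, paritySign_add_left]
    refine isLocal_natProd hAB ?_ ?_ n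
    · rw [paritySign_comm]; exact hA.2.2.2.symm (paritySign_mul_self _ _)
    · rw [paritySign_comm]; exact hB.2.2.2.symm (paritySign_mul_self _ _)

theorem normalOrd_mem {p q : ZMod 2} {A B : ℤ → Module.End ℂ V}
    (hA : A ∈ ρ.fields p) (hB : B ∈ ρ.fields q) (hAB : IsLocal (paritySign p q) A B) :
    normalOrd (paritySign p q) A B hA.1 hB.1 ∈ ρ.fields (p + q) := by
  refine ⟨isFieldSeries_normalOrd _ hA.1 hB.1, fun r m x hx => ?_,
    isTranslationCovariant_normalOrd _ hA.1 hB.1 hA.2.2.1 hB.2.2.1, ?_⟩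
  · obtain ⟨K, hK⟩ := normalOrd_eventually (paritySign p q) hA.1 hB.1 m x
    rw [hK K le_rfl]
    refine Submodule.add_mem _ (Submodule.sum_mem _ fun j _ => ?_)
      (Submodule.smul_mem _ _ (Submodule.sum_mem _ fun j _ => ?_))
    · rw [add_assoc]; exact hA.2.1 _ _ _ (hB.2.1 _ _ _ hx)
    · rw [add_comm p q, add_assoc]; exact hB.2.1 _ _ _ (hA.2.1 _ _ _ hx)
  · refine IsLocal.symm (paritySign_mul_self _ _) ?_
    rw [paritySign_comm, paritySign_add_left]
    refine isLocal_normalOrd _ _ hAB ?_ ?_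
    · rw [paritySign_comm]; exact hA.2.2.2.symm (paritySign_mul_self _ _)
    · rw [paritySign_comm]; exact hB.2.2.2.symm (paritySign_mul_self _ _)

/-- Nonnegative modes annihilate Ω, so on the vacuum only the leading binomial term, with A_n on the
left, survives. -/
theorem natProd_state (h : ρ.IsVacuumModule c Ω) {p q : ZMod 2} {A B : ℤ → Module.End ℂ V}
    (hA : A ∈ ρ.fields p) (hB : B ∈ ρ.fields q) (ε : ℂ) (n : ℕ) :
    natProd ε A B n (-1) Ω = A n (B (-1) Ω) := by
  rw [natProd, diff2_pow_apply, LinearMap.sum_apply, Finset.sum_range_succ']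
  rw [Finset.sum_eq_zero fun j hj => ?_]
  · simp [superComm, h.apply_vac_nonneg hA (Int.natCast_nonneg n)]
  · have hj' : j < n := Finset.mem_range.1 hj
    rw [superComm, LinearMap.smul_apply, LinearMap.sub_apply, LinearMap.smul_apply,
      Module.End.mul_apply, Module.End.mul_apply, h.apply_vac_nonneg hA (by push_cast; omega),
      h.apply_vac_nonneg hB (by push_cast; omega)]
    simp

theorem normalOrd_state (h : ρ.IsVacuumModule c Ω) {p q : ZMod 2} {A B : ℤ → Module.End ℂ V}
    (hA : A ∈ ρ.fields p) (hB : B ∈ ρ.fields q) (ε : ℂ) :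
    normalOrd ε A B hA.1 hB.1 (-1) Ω = A (-1) (B (-1) Ω) := by
  obtain ⟨K, hK⟩ := normalOrd_eventually ε hA.1 hB.1 (-1) Ω
  rw [hK (K + 1) (by omega), Finset.sum_range_succ', Finset.sum_eq_zero fun j _ => ?_,
    Finset.sum_eq_zero fun j _ => ?_]
  · simp
  · rw [h.apply_vac_nonneg hA (Int.natCast_nonneg j), map_zero]
  · rw [h.apply_vac_nonneg hB (by push_cast; omega), map_zero]

/-- Every vector is the state of a field that is local with respect to all fields. -/
theorem exists_fields (h : ρ.IsVacuumModule c Ω) (x : V) :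
    ∃ A : ZMod 2 → ℤ → Module.End ℂ V, (∀ q, A q ∈ ρ.fields q ∧
      ∀ p, ∀ B ∈ ρ.fields p, IsLocal (paritySign p q) B (A q)) ∧
      A 0 (-1) Ω + A 1 (-1) Ω = x := by
  have hτ := h.tau_mem_fields
  induction x using word_induction h.rep h.cyc with
  | zero =>
    exact ⟨0, fun q => ⟨Submodule.zero_mem _, fun p B _ => isLocal_zero _ _⟩, by simp⟩
  | add x y hx hy =>
    obtain ⟨A, hA, rfl⟩ := hx
    obtain ⟨A', hA', rfl⟩ := hy
    refine ⟨A + A', fun q => ⟨Submodule.add_mem _ (hA q).1 (hA' q).1, fun p B hB =>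
      ((hA q).2 p B hB).add ((hA' q).2 p B hB)⟩, ?_⟩
    simp only [Pi.add_apply, LinearMap.add_apply]
    abel
  | smul a x hx =>
    obtain ⟨A, hA, rfl⟩ := hx
    refine ⟨a • A, fun q => ⟨Submodule.smul_mem _ _ (hA q).1, fun p B hB =>
      ((hA q).2 p B hB).smul a⟩, ?_⟩
    simp
  | vac =>
    refine ⟨fun q => if q = 0 then oneField V else 0, fun q => ?_, by simp [oneField]⟩
    rcases zmod_two_cases q with rfl | rfl
    · simp only [if_true]
      refine ⟨one_mem_fields, fun p B _ => ?_⟩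
      rw [paritySign_comm, paritySign_zero_left]
      exact isLocal_oneField _
    · simp only [one_ne_zero, if_false]
      exact ⟨Submodule.zero_mem _, fun p B _ => isLocal_zero _ _⟩
  | step s k x hs _ hx =>
    obtain ⟨A, hA, rfl⟩ := hx
    have hq : ∀ q : ZMod 2, 1 + (1 + q) = q := by decide
    suffices H : ∀ q, ∃ P ∈ ρ.fields (1 + q),
        (∀ p, ∀ B ∈ ρ.fields p, IsLocal (paritySign p (1 + q)) B P) ∧
        P (-1) Ω = ρ.G s (A q (-1) Ω) by
      choose P h1 h2 h3 using H
      refine ⟨fun q => P (1 + q), fun q => ⟨?_, fun p B hB => ?_⟩, ?_⟩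
      · have := h1 (1 + q); rwa [hq] at this
      · have := h2 (1 + q) p B hB; rwa [hq] at this
      · rw [h3, h3, map_add, add_comm]
        rfl
    intro q
    have hτq : IsLocal (paritySign 1 q) ρ.tauField (A q) := (hA q).2 1 _ hτ
    have loc : ∀ p, ∀ B ∈ ρ.fields p, IsLocal (paritySign 1 p) ρ.tauField B ∧
        IsLocal (paritySign q p) (A q) B := fun p B hB =>
      ⟨hB.2.2.2, ((hA q).2 p B hB).symm (paritySign_mul_self _ _) |> fun h => by
        rwa [paritySign_comm] at h⟩
    -- G_{-1/2} = τ_(0) corresponds to the product of index 0, G_{-3/2} = τ_(-1) to the normally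
    -- ordered product.
    rcases hs with rfl | rfl
    · refine ⟨_, natProd_mem hτ (hA q).1 hτq 0, fun p B hB => ?_, ?_⟩
      · refine IsLocal.symm (paritySign_mul_self _ _) ?_
        rw [paritySign_comm, paritySign_add_left]
        exact isLocal_natProd hτq (loc p B hB).1 (loc p B hB).2 0
      · rw [h.natProd_state hτ (hA q).1]; rfl
    · refine ⟨_, normalOrd_mem hτ (hA q).1 hτq, fun p B hB => ?_, ?_⟩
      · refine IsLocal.symm (paritySign_mul_self _ _) ?_
        rw [paritySign_comm, paritySign_add_left]
        exact isLocal_normalOrd _ _ hτq (loc p B hB).1 (loc p B hB).2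
      · rw [h.normalOrd_state hτ (hA q).1]; rfl

theorem states_unique (h : ρ.IsVacuumModule c Ω) {A A' B B' : ℤ → Module.End ℂ V}
    (hA : A ∈ ρ.fields 0) (hA' : A' ∈ ρ.fields 0) (hB : B ∈ ρ.fields 1) (hB' : B' ∈ ρ.fields 1)
    (e : A (-1) Ω + B (-1) Ω = A' (-1) Ω + B' (-1) Ω) : A = A' ∧ B = B' := by
  have e1 : (A - A') (-1) Ω = -(B - B') (-1) Ω := by
    simp only [Pi.sub_apply, LinearMap.sub_apply]
    rw [← sub_eq_zero] at e ⊢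
    rw [← e]; abel
  have hAs := Submodule.sub_mem _ hA hA'
  have hBs := Submodule.sub_mem _ hB hB'
  have e2 : (A - A') (-1) Ω = 0 := h.parity_mem_zero (p := 0) (q := 1) (by decide)
    (h.state_mem hAs) (by rw [e1]; exact Submodule.neg_mem _ (h.state_mem hBs))
  rw [e2, eq_comm, neg_eq_zero] at e1
  exact ⟨sub_eq_zero.1 (h.eq_zero_of_apply_vac hAs e2),
    sub_eq_zero.1 (h.eq_zero_of_apply_vac hBs e1)⟩

/-- Any two fields are mutually local. -/
theorem isLocal_fields (h : ρ.IsVacuumModule c Ω) {p q : ZMod 2} {A B : ℤ → Module.End ℂ V}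
    (hA : A ∈ ρ.fields p) (hB : B ∈ ρ.fields q) : IsLocal (paritySign p q) A B := by
  -- By uniqueness B is the field constructed from its own state, and the constructed fields are
  -- local with respect to all others.
  obtain ⟨C, hC, e⟩ := h.exists_fields (B (-1) Ω)
  suffices C q = B by rw [← this]; exact (hC q).2 p A hA
  rcases zmod_two_cases q with rfl | rfl
  · exact (h.states_unique (hC 0).1 hB (hC 1).1 (Submodule.zero_mem _) (by simpa using e)).1
  · exact (h.states_unique (hC 0).1 (Submodule.zero_mem _) (hC 1).1 hB (by simpa using e)).2

/-- The map from fields to states. -/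
def stateMap (ρ : NSAction V) (Ω : V) : (ρ.fields 0 × ρ.fields 1) →ₗ[ℂ] V where
  toFun A := A.1.1 (-1) Ω + A.2.1 (-1) Ω
  map_add' A B := by simp; abel
  map_smul' a A := by simp

theorem stateMap_bijective (h : ρ.IsVacuumModule c Ω) :
    Function.Bijective (stateMap ρ Ω) := by
  constructor
  · intro A B e
    have := h.states_unique A.1.2 B.1.2 A.2.2 B.2.2 e
    exact Prod.ext (Subtype.ext this.1) (Subtype.ext this.2)
  · intro x
    obtain ⟨A, hA, e⟩ := h.exists_fields x
    exact ⟨(⟨A 0, (hA 0).1⟩, ⟨A 1, (hA 1).1⟩), e⟩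

/-- The state-field correspondence. -/
noncomputable def Y (h : ρ.IsVacuumModule c Ω) : V →ₗ[ℂ] (ℤ → Module.End ℂ V) :=
  ((ρ.fields 0).subtype.coprod (ρ.fields 1).subtype) ∘ₗ
    (LinearEquiv.ofBijective (stateMap ρ Ω) h.stateMap_bijective).symm.toLinearMap

/-- A field is the vertex operator of its state. -/
theorem Y_state (h : ρ.IsVacuumModule c Ω) {p : ZMod 2} {A : ℤ → Module.End ℂ V}
    (hA : A ∈ ρ.fields p) : h.Y (A (-1) Ω) = A := by
  rcases zmod_two_cases p with rfl | rfl
  · have : (LinearEquiv.ofBijective (stateMap ρ Ω) h.stateMap_bijective).symm (A (-1) Ω) =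
        (⟨A, hA⟩, 0) := by
      rw [LinearEquiv.symm_apply_eq]
      simp [stateMap]
    simp [Y, this]
  · have : (LinearEquiv.ofBijective (stateMap ρ Ω) h.stateMap_bijective).symm (A (-1) Ω) =
        (0, ⟨A, hA⟩) := by
      rw [LinearEquiv.symm_apply_eq]
      simp [stateMap]
    simp [Y, this]

theorem Y_apply_vac (h : ρ.IsVacuumModule c Ω) (a : V) : h.Y a (-1) Ω = a := by
  obtain ⟨A, hA, rfl⟩ := h.exists_fields a
  rw [map_add, h.Y_state (hA 0).1, h.Y_state (hA 1).1]
  rfl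

theorem Y_mem (h : ρ.IsVacuumModule c Ω) {p : ZMod 2} {a : V} (ha : a ∈ ρ.parity p) :
    h.Y a ∈ ρ.fields p := by
  obtain ⟨A, hA, rfl⟩ := h.exists_fields a
  rcases zmod_two_cases p with rfl | rfl
  · have : A 1 (-1) Ω = 0 := h.parity_mem_zero (p := 0) (q := 1) (by decide)
      (by simpa using Submodule.sub_mem _ ha (h.state_mem (hA 0).1)) (h.state_mem (hA 1).1)
    rw [this, add_zero, h.Y_state (hA 0).1]
    exact (hA 0).1
  · have : A 0 (-1) Ω = 0 := h.parity_mem_zero (p := 1) (q := 0) (by decide)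
      (by simpa using Submodule.sub_mem _ ha (h.state_mem (hA 1).1)) (h.state_mem (hA 0).1)
    rw [this, zero_add, h.Y_state (hA 1).1]
    exact (hA 1).1

/-- A property of vectors holds everywhere if it is additive and holds for even and odd vectors. -/
theorem parity_induction (h : ρ.IsVacuumModule c Ω) {P : V → Prop}
    (add : ∀ x y, P x → P y → P (x + y)) (hom : ∀ p, ∀ x ∈ ρ.parity p, P x) (x : V) : P x := by
  obtain ⟨A, hA, rfl⟩ := h.exists_fields x
  exact add _ _ (hom 0 _ (h.state_mem (hA 0).1)) (hom 1 _ (h.state_mem (hA 1).1))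

theorem Y_nu (h : ρ.IsVacuumModule c Ω) : h.Y (ρ.L (-2) Ω) = ρ.nuField := by
  have := h.Y_state h.nu_mem_fields
  rwa [show ρ.nuField (-1) = ρ.L (-2) from rfl] at this

theorem Y_tau (h : ρ.IsVacuumModule c Ω) : h.Y (ρ.G (-2) Ω) = ρ.tauField := by
  have := h.Y_state h.tau_mem_fields
  rwa [show ρ.tauField (-1) = ρ.G (-2) from rfl] at this

/-- `Y(a_(n) b, z)` is the `n`-th product of `Y(a,z)` and `Y(b,z)`, for `n ≥ 0`. -/
theorem Y_natProd (h : ρ.IsVacuumModule c Ω) {p q : ZMod 2} {A : ℤ → Module.End ℂ V} {b : V}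
    (hA : A ∈ ρ.fields p) (hb : b ∈ ρ.parity q) (n : ℕ) :
    h.Y (A n b) = natProd (paritySign p q) A (h.Y b) n := by
  have hB := h.Y_mem hb
  have := h.Y_state (natProd_mem hA hB (h.isLocal_fields hA hB) n)
  rwa [h.natProd_state hA hB, h.Y_apply_vac] at this

theorem Y_normalOrd (h : ρ.IsVacuumModule c Ω) {p q : ZMod 2} {A : ℤ → Module.End ℂ V} {b : V}
    (hA : A ∈ ρ.fields p) (hb : b ∈ ρ.parity q) :
    h.Y (A (-1) b) = normalOrd (paritySign p q) A (h.Y b) hA.1 (h.Y_mem hb).1 := by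
  have hB := h.Y_mem hb
  have := h.Y_state (normalOrd_mem hA hB (h.isLocal_fields hA hB))
  rwa [h.normalOrd_state hA hB, h.Y_apply_vac] at this

/-- The vertex superalgebra on a vacuum module of the Neveu-Schwarz algebra. -/
noncomputable def vertexSuperalgebra (h : ρ.IsVacuumModule c Ω) : VertexSuperalgebra V where
  parity := ρ.parity
  parity_internal := h.rep.parity_internal
  vac := Ω
  vac_even := h.even
  T := ρ.L (-1)
  T_even p a ha := h.rep.L_parity _ p a ha
  Y := h.Y
  Y_parity p q n a ha b hb := (h.Y_mem ha).2.1 q n b hb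
  Y_field a b := by
    induction a using h.parity_induction with
    | add x y hx hy =>
      obtain ⟨M, hM⟩ := hx
      obtain ⟨M', hM'⟩ := hy
      refine ⟨max M M', fun n hn => ?_⟩
      simp [hM n (le_trans (le_max_left _ _) hn), hM' n (le_trans (le_max_right _ _) hn)]
    | hom p x hx => exact (h.Y_mem hx).1 b
  Y_vac n := by
    have := h.Y_state one_mem_fields
    rw [show oneField V (-1) Ω = Ω by simp [oneField]] at this
    rw [this]
    rfl
  Y_apply_vac_nonneg a n hn := by
    induction a using h.parity_induction with
    | add x y hx hy => simp [hx, hy]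
    | hom p x hx => exact h.apply_vac_nonneg (h.Y_mem hx) hn
  Y_apply_vac := h.Y_apply_vac
  T_vac := h.L_neg_one
  translation a n := by
    induction a using h.parity_induction with
    | add x y hx hy =>
      rw [map_add, Pi.add_apply, Pi.add_apply, smul_add, ← hx, ← hy, mul_add, add_mul]
      abel
    | hom p x hx => exact (h.Y_mem hx).2.2.1 n
  locality p q a ha b hb := by
    obtain ⟨N, hN⟩ := h.isLocal_fields (h.Y_mem ha) (h.Y_mem hb)
    refine ⟨N, fun m n => ?_⟩
    have := congr_fun (congr_fun hN m) n
    rwa [diff2_pow_apply] at this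

end IsVacuumModule

end NSAction

/-! ## The vertex operator superalgebra on a vacuum module -/

/-- Submodules of an independent family that together span everything are the members of the
family. -/
theorem eq_of_le_of_iSup_eq_top {R M ι : Type*} [Ring R] [AddCommGroup M] [Module R M]
    {f g : ι → Submodule R M} (hf : iSupIndep f) (hle : ∀ i, g i ≤ f i) (hg : ⨆ i, g i = ⊤)
    (i : ι) : g i = f i := by
  refine le_antisymm (hle i) fun x hx => ?_
  have hx' : x ∈ ⨆ i, g i := by rw [hg]; trivial
  rw [iSup_split_single g i] at hx'
  obtain ⟨y, hy, z, hz, rfl⟩ := Submodule.mem_sup.1 hx'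
  have h1 : z ∈ f i := by simpa using Submodule.sub_mem _ hx (hle i hy)
  have h2 : z ∈ ⨆ j, ⨆ (_ : j ≠ i), f j := iSup₂_mono (fun j _ => hle j) hz
  rw [Submodule.disjoint_def.1 (hf i) z h1 h2, add_zero]
  exact hy

namespace NSAction

namespace IsVacuumModule

variable {V : Type*} [AddCommGroup V] [Module ℂ V] {ρ : NSAction V} {c : ℝ} {Ω : V}

theorem gWord_mem_parity (h : ρ.IsVacuumModule c Ω) (w : List Bool) :
    gWord ρ.G Ω w ∈ ρ.parity (gWeight w) := by
  induction w with
  | nil => simpa [gWeight, gWord] using h.even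
  | cons b w ih =>
    have e : ((gWeight (b :: w) : ℕ) : ZMod 2) = (gWeight w : ZMod 2) + 1 := by
      have : (3 : ZMod 2) = 1 := by decide
      cases b <;> simp [gWeight, add_comm, this]
    rw [e]
    exact h.rep.G_parity _ _ _ ih

theorem gWord_mem_eigenspace (h : ρ.IsVacuumModule c Ω) (w : List Bool) :
    gWord ρ.G Ω w ∈ Module.End.eigenspace (ρ.L 0) ((gWeight w : ℂ) / 2) :=
  Module.End.mem_eigenspace_iff.2 (h.rep.relations.L_zero_gWord h.cyc.isNSVacuum w)

/-- The words of weight μ lie in the eigenspace for μ, and all words together span V; independence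
of eigenspaces leaves no room for more. `parity_eq_span` is the same argument for parities. -/
theorem eigenspace_eq_span (h : ρ.IsVacuumModule c Ω) (μ : ℂ) :
    Module.End.eigenspace (ρ.L 0) μ =
      Submodule.span ℂ (gWord ρ.G Ω '' {w | (gWeight w : ℂ) / 2 = μ}) := by
  refine (eq_of_le_of_iSup_eq_top
    (g := fun μ => Submodule.span ℂ (gWord ρ.G Ω '' {w | (gWeight w : ℂ) / 2 = μ}))
    (Module.End.eigenspaces_iSupIndep (ρ.L 0)) (fun μ => ?_) ?_ μ).symm
  · refine Submodule.span_le.2 ?_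
    rintro _ ⟨w, rfl, rfl⟩
    exact h.gWord_mem_eigenspace w
  · rw [eq_top_iff, ← span_gWord_eq_top h.rep h.cyc]
    refine Submodule.span_le.2 ?_
    rintro _ ⟨w, rfl⟩
    exact Submodule.mem_iSup_of_mem _ (Submodule.subset_span ⟨w, rfl, rfl⟩)

theorem parity_eq_span (h : ρ.IsVacuumModule c Ω) (p : ZMod 2) :
    ρ.parity p = Submodule.span ℂ (gWord ρ.G Ω '' {w | (gWeight w : ZMod 2) = p}) := by
  refine (eq_of_le_of_iSup_eq_top
    (g := fun p => Submodule.span ℂ (gWord ρ.G Ω '' {w | (gWeight w : ZMod 2) = p}))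
    h.rep.parity_internal.submodule_iSupIndep (fun μ => ?_) ?_ p).symm
  · refine Submodule.span_le.2 ?_
    rintro _ ⟨w, rfl, rfl⟩
    exact h.gWord_mem_parity w
  · rw [eq_top_iff, ← span_gWord_eq_top h.rep h.cyc]
    refine Submodule.span_le.2 ?_
    rintro _ ⟨w, rfl⟩
    exact Submodule.mem_iSup_of_mem _ (Submodule.subset_span ⟨w, rfl, rfl⟩)

theorem iSup_eigenspace (h : ρ.IsVacuumModule c Ω) :
    ⨆ μ : ℂ, Module.End.eigenspace (ρ.L 0) μ = ⊤ := by
  rw [eq_top_iff, ← span_gWord_eq_top h.rep h.cyc]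
  refine Submodule.span_le.2 ?_
  rintro _ ⟨w, rfl⟩
  exact Submodule.mem_iSup_of_mem _ (h.gWord_mem_eigenspace w)

theorem half_eq_iff (m : ℕ) (k : ℤ) : (m : ℂ) / 2 = (k : ℂ) / 2 ↔ (m : ℤ) = k := by
  rw [div_left_inj' two_ne_zero]
  exact_mod_cast Iff.rfl

theorem finiteDimensional_eigenspace (h : ρ.IsVacuumModule c Ω) (k : ℤ) :
    FiniteDimensional ℂ (Module.End.eigenspace (ρ.L 0) ((k : ℂ) / 2)) := by
  rw [h.eigenspace_eq_span]
  refine FiniteDimensional.span_of_finite ℂ (Set.Finite.image _ ?_)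
  refine (finite_gWeight_eq k.toNat).subset fun w hw => ?_
  have : (gWeight w : ℤ) = k := (half_eq_iff _ _).1 hw
  simp only [Set.mem_ofPred_eq]
  omega

theorem eigenspace_neg (h : ρ.IsVacuumModule c Ω) {k : ℤ} (hk : k < 0) :
    Module.End.eigenspace (ρ.L 0) ((k : ℂ) / 2) = ⊥ := by
  rw [h.eigenspace_eq_span, Submodule.span_eq_bot]
  rintro _ ⟨w, hw, rfl⟩
  have : (gWeight w : ℤ) = k := (half_eq_iff _ _).1 hw
  omega

/-- Reduces the conditions `even_part` and `odd_part` of a VOSA to arithmetic of the numbers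
`gWeight w`. -/
theorem parity_eq_iSup (h : ρ.IsVacuumModule c Ω) (p : ZMod 2) (μ : ℤ → ℂ)
    (hμ : ∀ m : ℕ, (m : ZMod 2) = p ↔ ∃ n, (m : ℂ) / 2 = μ n) :
    ρ.parity p = ⨆ n : ℤ, Module.End.eigenspace (ρ.L 0) (μ n) := by
  rw [h.parity_eq_span]
  refine le_antisymm (Submodule.span_le.2 ?_) (iSup_le fun n => ?_)
  · rintro _ ⟨w, hw, rfl⟩
    obtain ⟨n, hn⟩ := (hμ _).1 hw
    refine Submodule.mem_iSup_of_mem n ?_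
    rw [← hn]
    exact h.gWord_mem_eigenspace w
  · rw [h.eigenspace_eq_span]
    refine Submodule.span_mono (Set.image_mono fun w hw => ?_)
    exact (hμ _).2 ⟨n, hw⟩

theorem nuField_add_one (ρ : NSAction V) (m : ℤ) : ρ.nuField (m + 1) = ρ.L m := by
  simp [nuField]

/-- The VOSA on a vacuum module of the Neveu-Schwarz algebra. -/
noncomputable def vosa (h : ρ.IsVacuumModule c Ω) : VOSA V :=
  have e1 : h.Y (ρ.L (-2) Ω) 1 = ρ.L 0 := by rw [h.Y_nu]; rfl
  { h.vertexSuperalgebra with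
    ν := ρ.L (-2) Ω
    c := c
    conformal :=
      { even := h.rep.L_parity _ _ _ h.even
        virasoro := fun m n => by
          change h.Y _ _ * h.Y _ _ - h.Y _ _ * h.Y _ _ = _ • h.Y _ _ + _
          rw [h.Y_nu, nuField_add_one, nuField_add_one, nuField_add_one]
          exact h.rep.comm_LL m n
        L_neg_one := by
          change h.Y _ _ = ρ.L (-1)
          rw [h.Y_nu]; rfl
        diagonalizable := by
          change ⨆ μ : ℂ, Module.End.eigenspace (h.Y _ 1) μ = ⊤
          rw [e1]; exact h.iSup_eigenspace }
    finite_weight := fun k => by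
      change FiniteDimensional ℂ (Module.End.eigenspace (h.Y _ 1) _)
      rw [e1]; exact h.finiteDimensional_eigenspace k
    even_part := by
      change ρ.parity 0 = ⨆ n : ℤ, Module.End.eigenspace (h.Y _ 1) _
      rw [e1]
      refine h.parity_eq_iSup _ _ fun m => ?_
      rw [ZMod.natCast_eq_zero_iff]
      constructor
      · rintro ⟨n, rfl⟩
        exact ⟨n, by push_cast; ring⟩
      · rintro ⟨n, hn⟩
        have : (m : ℤ) = 2 * n := by
          have : (m : ℂ) = 2 * n := by linear_combination 2 * hn
          exact_mod_cast this
        omega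
    odd_part := by
      change ρ.parity 1 = ⨆ n : ℤ, Module.End.eigenspace (h.Y _ 1) _
      rw [e1]
      refine h.parity_eq_iSup _ _ fun m => ?_
      rw [← Nat.cast_one, ZMod.natCast_eq_natCast_iff]
      constructor
      · intro hm
        -- Odd weights are written as n - 1/2, so m = 2k + 1 corresponds to n = k + 1.
        refine ⟨m / 2 + 1, ?_⟩
        have h1 : (m : ℤ) = 2 * ((m : ℤ) / 2) + 1 := by
          have : m % 2 = 1 % 2 := hm
          omega
        generalize (m : ℤ) / 2 = n at h1
        have h2 : (m : ℂ) = 2 * n + 1 := by exact_mod_cast h1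
        rw [h2]
        push_cast
        ring
      · rintro ⟨n, hn⟩
        have h1 : (m : ℤ) = 2 * n - 1 := by
          have : (m : ℂ) = 2 * n - 1 := by linear_combination 2 * hn
          exact_mod_cast this
        change m % 2 = 1 % 2
        omega
    bounded_below := ⟨0, fun k hk => by
      change Module.End.eigenspace (h.Y _ 1) _ = ⊥
      rw [e1]; exact h.eigenspace_neg (by omega)⟩ }

theorem vosa_Y (h : ρ.IsVacuumModule c Ω) : h.vosa.Y = h.Y := rfl

theorem vosa_L (h : ρ.IsVacuumModule c Ω) (m : ℤ) : h.vosa.L m = ρ.L m := by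
  change h.Y (ρ.L (-2) Ω) (m + 1) = _
  rw [h.Y_nu, nuField_add_one]

theorem vosa_isStructureOn (h : ρ.IsVacuumModule c Ω) : h.vosa.IsStructureOn ρ Ω (c : ℂ) where
  parity_eq := rfl
  vac_eq := rfl
  ν_eq := rfl
  c_eq := rfl
  Y_ν m := h.vosa_L m
  Y_τ r := by
    rw [vosa_Y, h.Y_tau]
    simp [tauField]

/-! ## The antilinear involution -/

section Unitary

variable {ip : InnerProductSpace.Core ℂ V}

/-- Letters of x are moved to the other side as adjoints, which preserve the real span. This reduces
to pairing Ω with words: nonempty words are orthogonal to Ω, and (Ω|Ω) is real. -/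
theorem inner_real_of_mem (h : ρ.IsVacuumModule c Ω) (hu : ρ.IsUnitary ip) {x y : V}
    (hx : x ∈ Submodule.span ℝ (Set.range (gWord ρ.G Ω)))
    (hy : y ∈ Submodule.span ℝ (Set.range (gWord ρ.G Ω))) : (ip.inner x y).im = 0 := by
  obtain ⟨hG, -⟩ := h.rep.relations.realSpan_invariant h.cyc.isNSVacuum
  have vac : ∀ y ∈ Submodule.span ℝ (Set.range (gWord ρ.G Ω)), (ip.inner Ω y).im = 0 := by
    intro y hy
    induction hy using Submodule.span_induction with
    | mem y hy =>
      obtain ⟨w, rfl⟩ := hy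
      cases w with
      | nil =>
        have := ip.conj_inner_symm Ω Ω
        exact Complex.conj_eq_iff_im.1 this
      | cons b w =>
        rw [gWord]
        have hs : ∀ s : ℤ, s < 0 → (ip.inner Ω (ρ.G s (gWord ρ.G Ω w))).im = 0 := fun s hs => by
          have := hu.2 (-s - 1) Ω (gWord ρ.G Ω w)
          rw [h.cyc.G_pos _ (by omega), coreInner_zero_left,
            show -(-s - 1) - 1 = s by ring] at this
          rw [← this]; rfl
        exact hs _ (by cases b <;> simp)
    | zero => rw [coreInner_zero_right]; rfl
    | add x y _ _ hx hy => rw [coreInner_add_right, Complex.add_im, hx, hy, add_zero]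
    | smul a x _ hx =>
      rw [← Complex.coe_smul, coreInner_smul_right, Complex.im_ofReal_mul, hx, mul_zero]
  induction hx using Submodule.span_induction with
  | mem x hx =>
    obtain ⟨w, rfl⟩ := hx
    induction w generalizing y with
    | nil => exact vac y hy
    | cons b w ih => rw [gWord, hu.2]; exact ih (hG _ _ hy)
  | zero => rw [coreInner_zero_left]; rfl
  | add x y _ _ hx hy => rw [ip.add_left, Complex.add_im, hx, hy, add_zero]
  | smul a x _ hx =>
    rw [← Complex.coe_smul, ip.smul_left, Complex.conj_ofReal, Complex.im_ofReal_mul, hx, mul_zero]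

theorem exists_real_imaginary (h : ρ.IsVacuumModule c Ω) (x : V) :
    ∃ u ∈ Submodule.span ℝ (Set.range (gWord ρ.G Ω)),
      ∃ v ∈ Submodule.span ℝ (Set.range (gWord ρ.G Ω)), u + Complex.I • v = x := by
  obtain ⟨hG, -⟩ := h.rep.relations.realSpan_invariant h.cyc.isNSVacuum
  set N := Submodule.span ℝ (Set.range (gWord ρ.G Ω))
  induction x using word_induction h.rep h.cyc with
  | zero => exact ⟨0, N.zero_mem, 0, N.zero_mem, by simp⟩
  | add x y hx hy =>
    obtain ⟨u, hu, v, hv, rfl⟩ := hx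
    obtain ⟨u', hu', v', hv', rfl⟩ := hy
    exact ⟨u + u', N.add_mem hu hu', v + v', N.add_mem hv hv', by rw [smul_add]; abel⟩
  | smul a x hx =>
    obtain ⟨u, hu, v, hv, rfl⟩ := hx
    refine ⟨a.re • u - a.im • v, N.sub_mem (N.smul_mem _ hu) (N.smul_mem _ hv),
      a.re • v + a.im • u, N.add_mem (N.smul_mem _ hv) (N.smul_mem _ hu), ?_⟩
    conv_rhs => rw [← Complex.re_add_im a]
    simp only [← Complex.coe_smul]
    have : Complex.I * Complex.I = -1 := Complex.I_mul_I
    linear_combination (norm := module) (-(a.im : ℂ) * this) • v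
  | vac => exact ⟨Ω, Submodule.subset_span ⟨[], rfl⟩, 0, N.zero_mem, by simp⟩
  | step s k x _ _ hx =>
    obtain ⟨u, hu, v, hv, rfl⟩ := hx
    exact ⟨_, hG s u hu, _, hG s v hv, by simp⟩

/-- The antilinear map that fixes all words in the `G_n`. -/
theorem exists_antilinear (h : ρ.IsVacuumModule c Ω) (hu : ρ.IsUnitary ip) :
    ∃ θ : V →ₗ⋆[ℂ] V, ∀ x ∈ Submodule.span ℝ (Set.range (gWord ρ.G Ω)), θ x = x := by
  set N := Submodule.span ℝ (Set.range (gWord ρ.G Ω)) with hN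
  -- If u = -iv with u, v in N, then (v|u) = -i(v|v) is real, so (v|v) = 0: positivity makes N and
  -- iN meet only in 0.
  have inj : ∀ u ∈ N, ∀ v ∈ N, u + Complex.I • v = 0 → u = 0 ∧ v = 0 := by
    intro u hu' v hv e
    have e1 : u = -(Complex.I • v) := eq_neg_of_add_eq_zero_left e
    have h1 := h.inner_real_of_mem hu hv hu'
    have h2 := h.inner_real_of_mem hu hv hv
    rw [e1, coreInner_neg_right, coreInner_smul_right] at h1
    have hv0 : v = 0 := ip.definite v (Complex.ext (by simpa using h1) h2)
    rw [hv0] at e1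
    exact ⟨by simpa using e1, hv0⟩
  have uniq : ∀ u ∈ N, ∀ v ∈ N, ∀ u' ∈ N, ∀ v' ∈ N,
      u + Complex.I • v = u' + Complex.I • v' → u = u' ∧ v = v' := by
    intro u hu v hv u' hu' v' hv' e
    have := inj (u - u') (N.sub_mem hu hu') (v - v') (N.sub_mem hv hv') (by
      rw [smul_sub, ← sub_eq_zero.2 e]; abel)
    exact ⟨sub_eq_zero.1 this.1, sub_eq_zero.1 this.2⟩
  choose u hu v hv e using h.exists_real_imaginary
  have key : ∀ x, ∀ u' ∈ N, ∀ v' ∈ N, u' + Complex.I • v' = x → u x - Complex.I • v x =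
      u' - Complex.I • v' := fun x u' hu' v' hv' e' => by
    obtain ⟨e1, e2⟩ := uniq _ (hu x) _ (hv x) _ hu' _ hv' ((e x).trans e'.symm)
    rw [e1, e2]
  refine ⟨{ toFun := fun x => u x - Complex.I • v x, map_add' := fun x y => ?_,
            map_smul' := fun a x => ?_ }, fun x hx => ?_⟩
  · rw [key (x + y) _ (N.add_mem (hu x) (hu y)) _ (N.add_mem (hv x) (hv y))]
    · rw [smul_add]; abel
    · conv_rhs => rw [← e x, ← e y]
      rw [smul_add]; abel
  · have I2 : Complex.I * Complex.I = -1 := Complex.I_mul_I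
    rw [key (a • x) (a.re • u x - a.im • v x)
      (N.sub_mem (N.smul_mem _ (hu x)) (N.smul_mem _ (hv x))) (a.re • v x + a.im • u x)
      (N.add_mem (N.smul_mem _ (hv x)) (N.smul_mem _ (hu x)))]
    · conv_rhs => rw [← Complex.re_add_im a]
      simp only [← Complex.coe_smul, map_add, map_mul, Complex.conj_ofReal, Complex.conj_I]
      linear_combination (norm := module) (-(a.im : ℂ) * I2) • v x
    · conv_rhs => rw [← e x, ← Complex.re_add_im a]
      simp only [← Complex.coe_smul]
      linear_combination (norm := module) (-(a.im : ℂ) * I2) • v x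
  · have := key x x hx 0 N.zero_mem (by simp)
    simpa using this

variable {θ : V →ₗ⋆[ℂ] V}

theorem theta_commutes (h : ρ.IsVacuumModule c Ω)
    (hθ : ∀ x ∈ Submodule.span ℝ (Set.range (gWord ρ.G Ω)), θ x = x) :
    (∀ r x, θ (ρ.G r x) = ρ.G r (θ x)) ∧ (∀ m x, θ (ρ.L m x) = ρ.L m (θ x)) ∧
      ∀ x, θ (θ x) = x := by
  obtain ⟨hG, hL⟩ := h.rep.relations.realSpan_invariant h.cyc.isNSVacuum
  refine ⟨fun r x => ?_, fun m x => ?_, fun x => ?_⟩ <;>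
    obtain ⟨u, hu, v, hv, rfl⟩ := h.exists_real_imaginary x
  · simp [hθ _ hu, hθ _ hv, hθ _ (hG r _ hu), hθ _ (hG r _ hv)]
  · simp [hθ _ hu, hθ _ hv, hθ _ (hL m _ hu), hθ _ (hL m _ hv)]
  · simp [hθ _ hu, hθ _ hv]

theorem theta_parity (h : ρ.IsVacuumModule c Ω)
    (hθ : ∀ x ∈ Submodule.span ℝ (Set.range (gWord ρ.G Ω)), θ x = x) (p : ZMod 2) {a : V}
    (ha : a ∈ ρ.parity p) : θ a ∈ ρ.parity p := by
  rw [h.parity_eq_span] at ha ⊢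
  induction ha using Submodule.span_induction with
  | mem x hx =>
    obtain ⟨w, hw, rfl⟩ := hx
    rw [hθ _ (Submodule.subset_span ⟨w, rfl⟩)]
    exact Submodule.subset_span ⟨w, hw, rfl⟩
  | zero => rw [map_zero]; exact Submodule.zero_mem _
  | add x y _ _ hx hy => rw [map_add]; exact Submodule.add_mem _ hx hy
  | smul a x _ hx => rw [map_smulₛₗ]; exact Submodule.smul_mem _ _ hx

theorem conj_paritySign (p q : ZMod 2) : starRingEnd ℂ (paritySign p q) = paritySign p q := by
  simp [paritySign]

/-- The series θ Y(a,z)_n θ again belongs to `fields`, because θ commutes with the generators, and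
its state is θ a. By uniqueness it is Y(θ a, z). -/
theorem theta_Y (h : ρ.IsVacuumModule c Ω)
    (hθ : ∀ x ∈ Submodule.span ℝ (Set.range (gWord ρ.G Ω)), θ x = x) (a b : V) (n : ℤ) :
    θ (h.Y a n b) = h.Y (θ a) n (θ b) := by
  obtain ⟨hG, hL, hi⟩ := h.theta_commutes hθ
  induction a using h.parity_induction with
  | add x y hx hy => simp [hx, hy]
  | hom p a ha =>
    have hY := h.Y_mem ha
    let conj : Module.End ℂ V →+ Module.End ℂ V :=
      { toFun := fun X => θ.comp (X.comp θ)
        map_zero' := by ext; simp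
        map_add' := fun X X' => by ext; simp }
    have hc : ∀ X x, conj X x = θ (X (θ x)) := fun X x => rfl
    have hmem : (fun n => conj (h.Y a n)) ∈ ρ.fields p := by
      refine ⟨fun b => ?_, fun q n x hx => ?_, fun n => ?_, ?_⟩
      · obtain ⟨M, hM⟩ := hY.1 (θ b)
        exact ⟨M, fun n hn => by rw [hc, hM n hn, map_zero]⟩
      · exact h.theta_parity hθ _ (hY.2.1 q n _ (h.theta_parity hθ q hx))
      · ext x
        have := hY.2.2.1.apply n (θ x)
        simp only [LinearMap.sub_apply, Module.End.mul_apply, LinearMap.smul_apply, hc, ← hL, this]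
        simp only [hL, map_sub, map_smulₛₗ]
        simp
      · obtain ⟨N, hN⟩ := hY.2.2.2
        refine ⟨N, ?_⟩
        have e : superComm (paritySign 1 p) ρ.tauField (fun n => conj (h.Y a n)) =
            fun m n => conj (superComm (paritySign 1 p) ρ.tauField (h.Y a) m n) := by
          ext m n x
          simp only [superComm, LinearMap.sub_apply, Module.End.mul_apply, LinearMap.smul_apply,
            hc, map_sub, map_smulₛₗ, conj_paritySign, tauField, hG]
        rw [e, diff2_pow_addMap, hN]
        ext m n x
        simp
    have e := h.Y_state hmem
    have hΩ : θ Ω = Ω := hθ _ (Submodule.subset_span ⟨[], rfl⟩)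
    simp only [hc, hΩ, h.Y_apply_vac] at e
    rw [e, hc, hi]

theorem vosa_isAntilinearInvolution (h : ρ.IsVacuumModule c Ω)
    (hθ : ∀ x ∈ Submodule.span ℝ (Set.range (gWord ρ.G Ω)), θ x = x) :
    h.vosa.IsAntilinearInvolution θ := by
  have hΩ : θ Ω = Ω := hθ _ (Submodule.subset_span ⟨[], rfl⟩)
  obtain ⟨hG, hL, hi⟩ := h.theta_commutes hθ
  refine ⟨hi, fun p a ha => h.theta_parity hθ p ha, hΩ, ?_, h.theta_Y hθ⟩
  change θ (ρ.L (-2) Ω) = ρ.L (-2) Ω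
  rw [hL, hΩ]

end Unitary

end IsVacuumModule

end NSAction

/-! ## Invariance of the scalar product -/

namespace NSAction

namespace IsVacuumModule

variable {V : Type*} [AddCommGroup V] [Module ℂ V] {ρ : NSAction V} {c : ℝ} {Ω : V}

/-- [L_1, G_{-1/2}] = G_{1/2} and [L_1, G_{1/2}] = 0, so the Leibniz expansion stops after one
correction; it stops after two in `L_one_pow_G_neg_two`, where [L_1, G_{-3/2}] = 2G_{-1/2}. -/
theorem L_one_pow_G_neg_one (h : ρ.IsVacuumModule c Ω) (j : ℕ) (a : V) :
    (ρ.L 1 ^ (j + 1)) (ρ.G (-1) a) =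
      ρ.G (-1) ((ρ.L 1 ^ (j + 1)) a) + ((j + 1 : ℕ) : ℂ) • ρ.G 0 ((ρ.L 1 ^ j) a) := by
  have R := h.rep.relations
  have e1 : ∀ x, ρ.L 1 (ρ.G (-1) x) = ρ.G (-1) (ρ.L 1 x) + ρ.G 0 x := fun x => by
    rw [R.LG_apply]; norm_num
  have e2 : ∀ x, ρ.L 1 (ρ.G 0 x) = ρ.G 0 (ρ.L 1 x) := fun x => by
    rw [R.LG_apply]; norm_num
  induction j with
  | zero => simp [e1]
  | succ j ih =>
    rw [pow_succ' (ρ.L 1) (j + 1), Module.End.mul_apply, ih, map_add, map_smul, e1, e2]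
    simp only [pow_succ', Module.End.mul_apply]
    push_cast
    module

theorem L_one_pow_G_neg_two (h : ρ.IsVacuumModule c Ω) (j : ℕ) (a : V) :
    (ρ.L 1 ^ (j + 2)) (ρ.G (-2) a) = ρ.G (-2) ((ρ.L 1 ^ (j + 2)) a) +
      (2 * ((j + 2 : ℕ) : ℂ)) • ρ.G (-1) ((ρ.L 1 ^ (j + 1)) a) +
      (((j + 2 : ℕ) : ℂ) * ((j + 1 : ℕ) : ℂ)) • ρ.G 0 ((ρ.L 1 ^ j) a) := by
  have R := h.rep.relations
  have e0 : ∀ x, ρ.L 1 (ρ.G (-2) x) = ρ.G (-2) (ρ.L 1 x) + (2 : ℂ) • ρ.G (-1) x := fun x => by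
    rw [R.LG_apply]; norm_num
  have e1 : ∀ x, ρ.L 1 (ρ.G (-1) x) = ρ.G (-1) (ρ.L 1 x) + ρ.G 0 x := fun x => by
    rw [R.LG_apply]; norm_num
  have e2 : ∀ x, ρ.L 1 (ρ.G 0 x) = ρ.G 0 (ρ.L 1 x) := fun x => by
    rw [R.LG_apply]; norm_num
  induction j with
  | zero =>
    simp only [zero_add, pow_succ', pow_zero, mul_one, Module.End.mul_apply, Module.End.one_apply,
      e0, e1, map_add, map_smul]
    push_cast
    module
  | succ j ih =>
    rw [pow_succ' (ρ.L 1) (j + 2), Module.End.mul_apply, ih, map_add, map_add, map_smul, map_smul,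
      e0, e1, e2]
    simp only [pow_succ', Module.End.mul_apply]
    push_cast
    module

/-- The coefficients of `Y(e^{z L_1} (-1)^{2 L_0² + L_0} z^{-2 L_0} a, z^{-1})`, for `a` of conformal
weight `d / 2` with `L_1^K a = 0`. -/
noncomputable def oppMode (h : ρ.IsVacuumModule c Ω) (K : ℕ) (d : ℤ) (a : V) (n : ℤ) :
    Module.End ℂ V :=
  (-1 : ℂ) ^ (d * (d + 1) / 2) • ∑ j ∈ Finset.range K,
    (1 / (j.factorial : ℂ)) • h.Y ((ρ.L 1 ^ j) a) (d - n - 2 - j)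

theorem L_one_pow_eq_zero {a : V} {K K' : ℕ} (hK : (ρ.L 1 ^ K) a = 0) (hKK' : K ≤ K') :
    (ρ.L 1 ^ K') a = 0 := by
  obtain ⟨k, rfl⟩ := Nat.exists_eq_add_of_le' hKK'
  rw [pow_add, Module.End.mul_apply, hK, map_zero]

theorem oppMode_of_le (h : ρ.IsVacuumModule c Ω) {K K' : ℕ} {a : V} (hK : (ρ.L 1 ^ K) a = 0)
    (hKK' : K ≤ K') (d n : ℤ) : h.oppMode K' d a n = h.oppMode K d a n := by
  rw [oppMode, oppMode]
  congr 1
  symm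
  refine Finset.sum_subset (Finset.range_mono hKK') fun j _ hj => ?_
  rw [L_one_pow_eq_zero hK (by simpa using hj)]
  simp

theorem L_parity_pow (h : ρ.IsVacuumModule c Ω) {p : ZMod 2} {a : V} (ha : a ∈ ρ.parity p)
    (j : ℕ) : (ρ.L 1 ^ j) a ∈ ρ.parity p := by
  induction j with
  | zero => simpa using ha
  | succ j ih => rw [pow_succ', Module.End.mul_apply]; exact h.rep.L_parity _ _ _ ih

theorem neg_one_zpow_one (d : ℤ) : (-1 : ℂ) ^ ((d + 1) * (d + 1 + 1) / 2) =
    -((-1) ^ d * (-1) ^ (d * (d + 1) / 2)) := by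
  have : (d + 1) * (d + 1 + 1) / 2 = d * (d + 1) / 2 + (d + 1) := by
    rw [show (d + 1) * (d + 1 + 1) = d * (d + 1) + (d + 1) * 2 by ring,
      Int.add_mul_ediv_right _ _ (by norm_num)]
  rw [this, zpow_add₀ (by norm_num), zpow_add₀ (by norm_num)]
  simp
  ring

theorem neg_one_zpow_three (d : ℤ) : (-1 : ℂ) ^ ((d + 3) * (d + 3 + 1) / 2) =
    (-1) ^ d * (-1) ^ (d * (d + 1) / 2) := by
  have : (d + 3) * (d + 3 + 1) / 2 = d * (d + 1) / 2 + (d + (2 * (d + 3))) := by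
    rw [show (d + 3) * (d + 3 + 1) = d * (d + 1) + (d + (2 * (d + 3))) * 2 by ring,
      Int.add_mul_ediv_right _ _ (by norm_num)]
  rw [this, zpow_add₀ (by norm_num), zpow_add₀ (by norm_num), zpow_mul]
  simp
  ring

theorem Y_G_neg_one (h : ρ.IsVacuumModule c Ω) {p : ZMod 2} {x : V} (hx : x ∈ ρ.parity p) (m : ℤ) :
    h.Y (ρ.G (-1) x) m = ρ.tauField 0 * h.Y x m - paritySign 1 p • (h.Y x m * ρ.tauField 0) := by
  have := h.Y_natProd h.tau_mem_fields hx 0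
  rw [← natProd_zero, ← this]
  rfl

theorem Y_G_zero (h : ρ.IsVacuumModule c Ω) {p : ZMod 2} {x : V} (hx : x ∈ ρ.parity p) (m : ℤ) :
    h.Y (ρ.G 0 x) m = (ρ.tauField 1 * h.Y x m - paritySign 1 p • (h.Y x m * ρ.tauField 1)) -
      (ρ.tauField 0 * h.Y x (m + 1) - paritySign 1 p • (h.Y x (m + 1) * ρ.tauField 0)) := by
  have := h.Y_natProd h.tau_mem_fields hx 1
  rw [← natProd_one, ← this]
  rfl

theorem Y_G_neg_two (h : ρ.IsVacuumModule c Ω) {p : ZMod 2} {x : V} (hx : x ∈ ρ.parity p) (m : ℤ)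
    (v : V) : ∃ K₀ : ℕ, ∀ K, K₀ ≤ K → h.Y (ρ.G (-2) x) m v =
      ∑ i ∈ Finset.range K, ρ.tauField (-1 - i) (h.Y x (m + i) v) +
        paritySign 1 p • ∑ i ∈ Finset.range K, h.Y x (m - 1 - i) (ρ.tauField i v) := by
  have e := h.Y_normalOrd h.tau_mem_fields hx
  rw [show ρ.tauField (-1) = ρ.G (-2) from rfl] at e
  rw [e]
  exact normalOrd_eventually _ _ _ _ _

/-- Y(G_{-1/2}a, z) is the bracket of τ_(0) with Y(a, z). The correction by G_{1/2} that comes from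
e^{zL_1} replaces τ_(0) by its adjoint τ_(1). -/
theorem oppMode_G_neg_one (h : ρ.IsVacuumModule c Ω) {p : ZMod 2} {a : V} (ha : a ∈ ρ.parity p)
    {K : ℕ} (hK : (ρ.L 1 ^ K) a = 0) {d : ℤ} (hd : (-1 : ℂ) ^ d = paritySign 1 p) (n : ℤ) :
    h.oppMode (K + 1) (d + 1) (ρ.G (-1) a) n =
      h.oppMode K d a n * ρ.tauField 1 - paritySign 1 p • (ρ.tauField 1 * h.oppMode K d a n) := by
  have hs := paritySign_mul_self 1 p
  set ε := paritySign 1 p with hε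
  have e0 : ∑ j ∈ Finset.range (K + 1), (1 / (j.factorial : ℂ)) •
      h.Y ((ρ.L 1 ^ j) (ρ.G (-1) a)) (d + 1 - n - 2 - j) =
      ∑ j ∈ Finset.range (K + 1), (1 / (j.factorial : ℂ)) •
        h.Y (ρ.G (-1) ((ρ.L 1 ^ j) a)) (d + 1 - n - 2 - j) +
      ∑ j ∈ Finset.range K, (1 / (j.factorial : ℂ)) •
        h.Y (ρ.G 0 ((ρ.L 1 ^ j) a)) (d - n - 2 - j) := by
    rw [Finset.sum_range_succ', Finset.sum_range_succ' _ K, add_right_comm,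
      ← Finset.sum_add_distrib]
    congr 1
    refine Finset.sum_congr rfl fun j _ => ?_
    rw [h.L_one_pow_G_neg_one, map_add, map_smul, Pi.add_apply, Pi.smul_apply, smul_add, smul_smul]
    congr 2
    · rw [Nat.factorial_succ]
      have : ((j + 1 : ℕ) : ℂ) ≠ 0 := by exact_mod_cast j.succ_ne_zero
      push_cast at this ⊢
      field_simp
    · rw [show d + 1 - n - 2 - ((j + 1 : ℕ) : ℤ) = d - n - 2 - j by push_cast; ring]
  have e1 : ∑ j ∈ Finset.range (K + 1), (1 / (j.factorial : ℂ)) •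
      h.Y ((ρ.L 1 ^ j) (ρ.G (-1) a)) (d + 1 - n - 2 - j) =
      ∑ j ∈ Finset.range K, (1 / (j.factorial : ℂ)) •
        (ρ.tauField 1 * h.Y ((ρ.L 1 ^ j) a) (d - n - 2 - j) -
          ε • (h.Y ((ρ.L 1 ^ j) a) (d - n - 2 - j) * ρ.tauField 1)) := by
    rw [e0, Finset.sum_range_succ, hK, map_zero, map_zero, Pi.zero_apply, smul_zero, add_zero,
      ← Finset.sum_add_distrib]
    refine Finset.sum_congr rfl fun j _ => ?_
    rw [h.Y_G_neg_one (h.L_parity_pow ha j), h.Y_G_zero (h.L_parity_pow ha j),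
      show d - n - 2 - (j : ℤ) + 1 = d + 1 - n - 2 - j by ring, ← smul_add]
    congr 1
    abel
  rw [oppMode, e1, neg_one_zpow_one, hd, oppMode]
  have e2 : ∑ j ∈ Finset.range K, (1 / (j.factorial : ℂ)) •
      (ρ.tauField 1 * h.Y ((ρ.L 1 ^ j) a) (d - n - 2 - j) -
        ε • (h.Y ((ρ.L 1 ^ j) a) (d - n - 2 - j) * ρ.tauField 1)) =
      ρ.tauField 1 * (∑ j ∈ Finset.range K, (1 / (j.factorial : ℂ)) •
        h.Y ((ρ.L 1 ^ j) a) (d - n - 2 - j)) -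
      ε • ((∑ j ∈ Finset.range K, (1 / (j.factorial : ℂ)) •
        h.Y ((ρ.L 1 ^ j) a) (d - n - 2 - j)) * ρ.tauField 1) := by
    rw [Finset.mul_sum, Finset.sum_mul, Finset.smul_sum, ← Finset.sum_sub_distrib]
    refine Finset.sum_congr rfl fun j _ => ?_
    rw [mul_smul_comm, smul_mul_assoc]
    module
  rw [e2, mul_smul_comm, smul_mul_assoc]
  linear_combination (norm := module) (hs * (-1 : ℂ) ^ (d * (d + 1) / 2)) •
    ((∑ j ∈ Finset.range K, (1 / (j.factorial : ℂ)) •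
      h.Y ((ρ.L 1 ^ j) a) (d - n - 2 - j)) * ρ.tauField 1)

/-- This is the combination that e^{zL_1} makes out of G_{-3/2}. Its lower terms move the split of τ
into left and right modes from -1|0 to 1|2, which is the splitting obtained from normal ordering by
τ_(n) ↦ τ_(1-n), the adjoint. -/
theorem Y_G_combination (h : ρ.IsVacuumModule c Ω) {p : ZMod 2} {x : V} (hx : x ∈ ρ.parity p)
    (q : ℤ) (v : V) : ∃ K₀ : ℕ, ∀ K, K₀ ≤ K →
      h.Y (ρ.G (-2) x) (q + 2) v + (2 : ℂ) • h.Y (ρ.G (-1) x) (q + 1) v + h.Y (ρ.G 0 x) q v =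
      ∑ i ∈ Finset.range K, ρ.tauField (1 - i) (h.Y x (q + i) v) +
        paritySign 1 p • ∑ i ∈ Finset.range K, h.Y x (q - 1 - i) (ρ.tauField (i + 2) v) := by
  obtain ⟨K₀, hK₀⟩ := h.Y_G_neg_two hx (q + 2) v
  obtain ⟨M, hM⟩ := (h.Y_mem hx).1 v
  obtain ⟨M', hM'⟩ := h.isFieldSeries_tau v
  refine ⟨K₀ + (M - q).toNat + M'.toNat + 2, fun K hK => ?_⟩
  obtain ⟨k, rfl⟩ := Nat.exists_eq_add_of_le' (show 2 ≤ K by omega)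
  rw [hK₀ (k + 2) (by omega), h.Y_G_neg_one hx, h.Y_G_zero hx]
  have e1 : ∑ i ∈ Finset.range (k + 2), ρ.tauField (-1 - i) (h.Y x (q + 2 + i) v) =
      ∑ i ∈ Finset.range k, ρ.tauField (-1 - i) (h.Y x (q + 2 + i) v) := by
    rw [Finset.sum_range_succ, Finset.sum_range_succ, hM _ (by omega),
      hM _ (by push_cast; omega)]
    simp
  have e2 : ∑ i ∈ Finset.range (k + 2), ρ.tauField (1 - i) (h.Y x (q + i) v) =
      ∑ i ∈ Finset.range k, ρ.tauField (-1 - i) (h.Y x (q + 2 + i) v) +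
        ρ.tauField 0 (h.Y x (q + 1) v) + ρ.tauField 1 (h.Y x q v) := by
    rw [Finset.sum_range_succ', Finset.sum_range_succ']
    congr 2
    · refine Finset.sum_congr rfl fun i _ => ?_
      rw [show (1 : ℤ) - (i + 1 + 1 : ℕ) = -1 - i by push_cast; ring,
        show q + (i + 1 + 1 : ℕ) = q + 2 + i by push_cast; ring]
    · simp
  have e3 : ∑ i ∈ Finset.range (k + 2), h.Y x (q - 1 - i) (ρ.tauField (i + 2) v) =
      ∑ i ∈ Finset.range k, h.Y x (q - 1 - i) (ρ.tauField (i + 2) v) := by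
    rw [Finset.sum_range_succ, Finset.sum_range_succ, hM' _ (by omega),
      hM' _ (by push_cast; omega)]
    simp
  have e4 : ∑ i ∈ Finset.range (k + 2), h.Y x (q + 2 - 1 - i) (ρ.tauField i v) =
      ∑ i ∈ Finset.range k, h.Y x (q - 1 - i) (ρ.tauField (i + 2) v) +
        h.Y x q (ρ.tauField 1 v) + h.Y x (q + 1) (ρ.tauField 0 v) := by
    rw [Finset.sum_range_succ', Finset.sum_range_succ']
    congr 2
    · refine Finset.sum_congr rfl fun i _ => ?_
      rw [show q + 2 - 1 - (i + 1 + 1 : ℕ) = q - 1 - i by push_cast; ring,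
        show ((i + 1 + 1 : ℕ) : ℤ) = i + 2 by push_cast; ring]
    · rw [show q + 2 - 1 - (0 + 1 : ℕ) = q by push_cast; ring, zero_add, Nat.cast_one]
    · rw [show q + 2 - 1 - (0 : ℕ) = q + 1 by push_cast; ring]
  rw [e1, e2, e3, e4]
  simp only [LinearMap.sub_apply, LinearMap.smul_apply, Module.End.mul_apply]
  module

theorem exists_uniform_bound {P : ℕ → ℕ → Prop} (h : ∀ j, ∃ K₀, ∀ K, K₀ ≤ K → P j K) (J : ℕ) :
    ∃ K₀, ∀ j < J, ∀ K, K₀ ≤ K → P j K := by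
  choose f hf using h
  exact ⟨∑ j ∈ Finset.range J, f j, fun j hj K hK => hf j K
    (le_trans (Finset.single_le_sum (fun _ _ => Nat.zero_le _) (Finset.mem_range.2 hj)) hK)⟩

theorem oppMode_G_neg_two (h : ρ.IsVacuumModule c Ω) {p : ZMod 2} {a : V} (ha : a ∈ ρ.parity p)
    {K : ℕ} (hK : (ρ.L 1 ^ K) a = 0) {d : ℤ} (hd : (-1 : ℂ) ^ d = paritySign 1 p) (n : ℤ) (v : V) :
    ∃ M₀ : ℕ, ∀ M, M₀ ≤ M → h.oppMode (K + 2) (d + 3) (ρ.G (-2) a) n v =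
      ∑ i ∈ Finset.range M, h.oppMode K d a (n + i) (ρ.tauField (2 + i) v) +
        paritySign 1 p •
          ∑ i ∈ Finset.range M, ρ.tauField (1 - i) (h.oppMode K d a (n - 1 - i) v) := by
  have hs := paritySign_mul_self 1 p
  obtain ⟨M₀, hM₀⟩ := exists_uniform_bound
    (fun j => h.Y_G_combination (h.L_parity_pow ha j) (d - n - 1 - j) v) K
  refine ⟨M₀, fun M hM => ?_⟩
  set ε := paritySign 1 p with hε
  -- The coefficients produced by powers of L_1 cancel against the factorials, so the corrections
  -- become the same exponential sum shifted by one and by two steps.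
  have e0 : ∑ j ∈ Finset.range (K + 2), (1 / (j.factorial : ℂ)) •
      h.Y ((ρ.L 1 ^ j) (ρ.G (-2) a)) (d + 3 - n - 2 - j) v =
      ∑ j ∈ Finset.range (K + 2), (1 / (j.factorial : ℂ)) •
        h.Y (ρ.G (-2) ((ρ.L 1 ^ j) a)) (d + 3 - n - 2 - j) v +
      ∑ j ∈ Finset.range (K + 1), (1 / (j.factorial : ℂ)) •
        (2 : ℂ) • h.Y (ρ.G (-1) ((ρ.L 1 ^ j) a)) (d + 2 - n - 2 - j) v +
      ∑ j ∈ Finset.range K, (1 / (j.factorial : ℂ)) •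
        h.Y (ρ.G 0 ((ρ.L 1 ^ j) a)) (d - n - 1 - j) v := by
    have f0 : ρ.L 1 (ρ.G (-2) a) = ρ.G (-2) (ρ.L 1 a) + (2 : ℂ) • ρ.G (-1) a := by
      rw [h.rep.relations.LG_apply]; norm_num
    rw [Finset.sum_range_succ', Finset.sum_range_succ' _ K, Finset.sum_range_succ' _ (K + 1),
      Finset.sum_range_succ' _ K, Finset.sum_range_succ' _ K]
    have f1 : ∀ j : ℕ, (1 / ((j + 1 + 1).factorial : ℂ)) •
        h.Y ((ρ.L 1 ^ (j + 1 + 1)) (ρ.G (-2) a)) (d + 3 - n - 2 - (j + 1 + 1 : ℕ)) v =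
        (1 / ((j + 1 + 1).factorial : ℂ)) •
          h.Y (ρ.G (-2) ((ρ.L 1 ^ (j + 1 + 1)) a)) (d + 3 - n - 2 - (j + 1 + 1 : ℕ)) v +
        (1 / ((j + 1).factorial : ℂ)) •
          (2 : ℂ) • h.Y (ρ.G (-1) ((ρ.L 1 ^ (j + 1)) a)) (d + 2 - n - 2 - (j + 1 : ℕ)) v +
        (1 / (j.factorial : ℂ)) • h.Y (ρ.G 0 ((ρ.L 1 ^ j) a)) (d - n - 1 - j) v := fun j => by
      rw [h.L_one_pow_G_neg_two, map_add, map_add, map_smul, map_smul]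
      simp only [Pi.add_apply, Pi.smul_apply, LinearMap.add_apply, LinearMap.smul_apply, smul_add,
        smul_smul]
      have h1 : ((j : ℂ) + 1) ≠ 0 := by exact_mod_cast j.succ_ne_zero
      have h2 : ((j : ℂ) + 2) ≠ 0 := by exact_mod_cast (by omega : j + 2 ≠ 0)
      have h2' : ((j : ℂ) + 1 + 1) ≠ 0 := by exact_mod_cast (by omega : j + 1 + 1 ≠ 0)
      have h3 : (j.factorial : ℂ) ≠ 0 := by exact_mod_cast j.factorial_ne_zero
      congr 2
      · congr 1
        · rw [Nat.factorial_succ (j + 1)]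
          push_cast
          field_simp
          ring
        · rw [show d + 3 - n - 2 - ((j + 1 + 1 : ℕ) : ℤ) = d + 2 - n - 2 - (j + 1 : ℕ) by
            push_cast; ring]
      · rw [Nat.factorial_succ (j + 1), Nat.factorial_succ]
        push_cast
        field_simp
        ring
      · rw [show d + 3 - n - 2 - ((j + 1 + 1 : ℕ) : ℤ) = d - n - 1 - j by push_cast; ring]
    simp only [f1, Finset.sum_add_distrib]
    simp only [zero_add, pow_one, pow_zero, Module.End.one_apply, f0, map_add, map_smul,
      Nat.factorial_one, Nat.factorial_zero, Nat.cast_one, Nat.cast_zero, Pi.add_apply,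
      Pi.smul_apply, LinearMap.add_apply, LinearMap.smul_apply, div_one, one_smul]
    rw [show d + 3 - n - 2 - 1 = d + 2 - n - 2 - 0 by ring]
    abel
  have e1 : ∑ j ∈ Finset.range (K + 2), (1 / (j.factorial : ℂ)) •
      h.Y ((ρ.L 1 ^ j) (ρ.G (-2) a)) (d + 3 - n - 2 - j) v =
      ∑ j ∈ Finset.range K, (1 / (j.factorial : ℂ)) •
        (∑ i ∈ Finset.range M, ρ.tauField (1 - i) (h.Y ((ρ.L 1 ^ j) a) (d - n - 1 - j + i) v) +
          ε • ∑ i ∈ Finset.range M,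
            h.Y ((ρ.L 1 ^ j) a) (d - n - 1 - j - 1 - i) (ρ.tauField (i + 2) v)) := by
    rw [e0, Finset.sum_range_succ _ (K + 1), Finset.sum_range_succ _ K, Finset.sum_range_succ _ K,
      hK, L_one_pow_eq_zero hK (Nat.le_succ K)]
    simp only [map_zero, Pi.zero_apply, LinearMap.zero_apply, smul_zero, add_zero]
    rw [← Finset.sum_add_distrib, ← Finset.sum_add_distrib]
    refine Finset.sum_congr rfl fun j hj => ?_
    rw [← hM₀ j (Finset.mem_range.1 hj) M hM, ← smul_add, ← smul_add,
      show d - n - 1 - (j : ℤ) + 2 = d + 3 - n - 2 - j by ring,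
      show d - n - 1 - (j : ℤ) + 1 = d + 2 - n - 2 - j by ring]
  have e2 : ∀ i : ℕ, h.oppMode K d a (n + i) (ρ.tauField (2 + i) v) =
      (-1 : ℂ) ^ (d * (d + 1) / 2) • ∑ j ∈ Finset.range K, (1 / (j.factorial : ℂ)) •
        h.Y ((ρ.L 1 ^ j) a) (d - n - 1 - j - 1 - i) (ρ.tauField (i + 2) v) := fun i => by
    simp only [oppMode, LinearMap.smul_apply, LinearMap.sum_apply]
    congr 1
    refine Finset.sum_congr rfl fun j _ => ?_
    rw [show d - (n + i) - 2 - (j : ℤ) = d - n - 1 - j - 1 - i by ring, add_comm 2 (i : ℤ)]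
  have e3 : ∀ i : ℕ, ρ.tauField (1 - i) (h.oppMode K d a (n - 1 - i) v) =
      (-1 : ℂ) ^ (d * (d + 1) / 2) • ∑ j ∈ Finset.range K, (1 / (j.factorial : ℂ)) •
        ρ.tauField (1 - i) (h.Y ((ρ.L 1 ^ j) a) (d - n - 1 - j + i) v) := fun i => by
    simp only [oppMode, LinearMap.smul_apply, LinearMap.sum_apply, map_smul, map_sum]
    congr 1
    refine Finset.sum_congr rfl fun j _ => ?_
    rw [show d - (n - 1 - i) - 2 - (j : ℤ) = d - n - 1 - j + i by ring]
  rw [oppMode, neg_one_zpow_three, hd, LinearMap.smul_apply, LinearMap.sum_apply]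
  simp only [LinearMap.smul_apply, e1, e2, e3]
  have e4 : ∑ j ∈ Finset.range K, (1 / (j.factorial : ℂ)) •
        (∑ i ∈ Finset.range M, ρ.tauField (1 - i) (h.Y ((ρ.L 1 ^ j) a) (d - n - 1 - j + i) v) +
          ε • ∑ i ∈ Finset.range M,
            h.Y ((ρ.L 1 ^ j) a) (d - n - 1 - j - 1 - i) (ρ.tauField (i + 2) v)) =
      ∑ i ∈ Finset.range M, ∑ j ∈ Finset.range K, (1 / (j.factorial : ℂ)) •
        ρ.tauField (1 - i) (h.Y ((ρ.L 1 ^ j) a) (d - n - 1 - j + i) v) +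
      ε • ∑ i ∈ Finset.range M, ∑ j ∈ Finset.range K, (1 / (j.factorial : ℂ)) •
        h.Y ((ρ.L 1 ^ j) a) (d - n - 1 - j - 1 - i) (ρ.tauField (i + 2) v) := by
    rw [Finset.sum_comm, Finset.sum_comm (s := Finset.range M)]
    simp only [← Finset.smul_sum]
    rw [Finset.smul_sum, ← Finset.sum_add_distrib]
    refine Finset.sum_congr rfl fun j _ => ?_
    module
  rw [e4, ← Finset.smul_sum, ← Finset.smul_sum]
  linear_combination (norm := module) (hs * (-1 : ℂ) ^ (d * (d + 1) / 2)) •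
    ∑ i ∈ Finset.range M, ∑ j ∈ Finset.range K, (1 / (j.factorial : ℂ)) •
        h.Y ((ρ.L 1 ^ j) a) (d - n - 1 - j - 1 - i) (ρ.tauField (i + 2) v)

theorem neg_one_zpow_gWeight (w : List Bool) :
    (-1 : ℂ) ^ (gWeight w : ℤ) = paritySign 1 (gWeight w) := by
  rw [zpow_natCast, paritySign, ZMod.val_one, one_mul, ZMod.val_natCast]
  exact neg_one_pow_eq_pow_mod_two _

/-! ### Invariance by induction over words -/

section Unitary

variable {ip : InnerProductSpace.Core ℂ V}

theorem inner_tau (hu : ρ.IsUnitary ip) (n : ℤ) (x y : V) :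
    ip.inner (ρ.tauField n x) y = ip.inner x (ρ.tauField (1 - n) y) := by
  have := hu.2 (n - 1) x y
  rw [show -(n - 1) - 1 = 1 - n - 1 by ring] at this
  exact this

/-- Invariance of the scalar product for words. -/
theorem inner_Y_gWord (h : ρ.IsVacuumModule c Ω) (hu : ρ.IsUnitary ip) (w : List Bool) :
    ∃ K : ℕ, (ρ.L 1 ^ K) (gWord ρ.G Ω w) = 0 ∧ ∀ n b v,
      ip.inner (h.Y (gWord ρ.G Ω w) n b) v =
        ip.inner b (h.oppMode K (gWeight w) (gWord ρ.G Ω w) n v) := by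
  induction w with
  | nil =>
    refine ⟨1, by simpa [gWord] using h.cyc.L_pos 1 one_pos, fun n b v => ?_⟩
    have hY : h.Y Ω = oneField V := by
      have := h.Y_state one_mem_fields
      rwa [show oneField V (-1) Ω = Ω by simp [oneField]] at this
    simp only [gWord, oppMode, gWeight, hY, oneField, Finset.range_one, Finset.sum_singleton,
      pow_zero, Module.End.one_apply, Nat.cast_zero]
    by_cases hn : n = -1
    · subst hn; simp
    · rw [if_neg hn, if_neg (by omega)]
      simp [coreInner_zero_left, coreInner_zero_right]
  | cons s w ih =>
    obtain ⟨K, hK, ih⟩ := ih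
    set a := gWord ρ.G Ω w with ha
    have hp : a ∈ ρ.parity (gWeight w) := h.gWord_mem_parity w
    have hd := neg_one_zpow_gWeight w
    have hc : starRingEnd ℂ (paritySign 1 (gWeight w)) = paritySign 1 (gWeight w) :=
      conj_paritySign _ _
    cases s with
    | false =>
      refine ⟨K + 1, ?_, fun n b v => ?_⟩
      · rw [gWord, ← ha]
        simp only [Bool.false_eq_true, if_false]
        rw [h.L_one_pow_G_neg_one, hK, L_one_pow_eq_zero hK (Nat.le_succ K)]
        simp
      · have e : ((gWeight (false :: w) : ℕ) : ℤ) = (gWeight w : ℤ) + 1 := by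
          simp [gWeight, add_comm]
        rw [gWord, ← ha, e]
        simp only [Bool.false_eq_true, if_false]
        rw [h.oppMode_G_neg_one hp hK hd, h.Y_G_neg_one hp]
        simp only [LinearMap.sub_apply, LinearMap.smul_apply, Module.End.mul_apply,
          coreInner_sub_left, coreInner_sub_right, ip.smul_left, coreInner_smul_right, ih, hc,
          inner_tau hu]
        rw [sub_zero]
    | true =>
      refine ⟨K + 2, ?_, fun n b v => ?_⟩
      · rw [gWord, ← ha]
        simp only [if_true]
        rw [h.L_one_pow_G_neg_two, hK, L_one_pow_eq_zero hK (Nat.le_succ K),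
          L_one_pow_eq_zero hK (show K ≤ K + 2 by omega)]
        simp
      · have e : ((gWeight (true :: w) : ℕ) : ℤ) = (gWeight w : ℤ) + 3 := by
          simp [gWeight, add_comm]
        rw [gWord, ← ha, e]
        simp only [if_true]
        -- Both normally ordered expansions are cut off at a common bound; then they are adjoint to
        -- each other term by term.
        obtain ⟨M₁, h1⟩ := h.oppMode_G_neg_two hp hK hd n v
        obtain ⟨M₂, h2⟩ := h.Y_G_neg_two hp n b
        rw [h1 (M₁ + M₂) (by omega), h2 (M₁ + M₂) (by omega)]
        simp only [ip.add_left, coreInner_add_right, ip.smul_left, coreInner_smul_right,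
          coreInner_sum_left, coreInner_sum_right, ih, hc, inner_tau hu]
        congr 1
        refine Finset.sum_congr rfl fun i _ => ?_
        rw [show (1 - (-1 - (i : ℤ))) = 2 + i by ring]

/-- Invariance of the scalar product, with a finite sum. -/
theorem inner_Y_theta (h : ρ.IsVacuumModule c Ω) (hu : ρ.IsUnitary ip) {θ : V →ₗ⋆[ℂ] V}
    (hθ : ∀ x ∈ Submodule.span ℝ (Set.range (gWord ρ.G Ω)), θ x = x) {d : ℤ} {a : V}
    (ha : a ∈ Module.End.eigenspace (ρ.L 0) ((d : ℂ) / 2)) :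
    ∃ K : ℕ, (ρ.L 1 ^ K) a = 0 ∧ ∀ n b v,
      ip.inner (h.Y (θ a) n b) v = ip.inner b (h.oppMode K d a n v) := by
  rw [h.eigenspace_eq_span] at ha
  induction ha using Submodule.span_induction with
  | mem x hx =>
    obtain ⟨w, hw, rfl⟩ := hx
    obtain rfl : (gWeight w : ℤ) = d := (half_eq_iff _ _).1 hw
    rw [hθ _ (Submodule.subset_span ⟨w, rfl⟩)]
    exact h.inner_Y_gWord hu w
  | zero =>
    refine ⟨0, by simp, fun n b v => ?_⟩
    simp [oppMode, coreInner_zero_left, coreInner_zero_right]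
  | add x y _ _ hx hy =>
    obtain ⟨K, hK, e⟩ := hx
    obtain ⟨K', hK', e'⟩ := hy
    have h1 := L_one_pow_eq_zero hK (le_max_left K K')
    have h2 := L_one_pow_eq_zero hK' (le_max_right K K')
    refine ⟨max K K', by rw [map_add, h1, h2, add_zero], fun n b v => ?_⟩
    have : h.oppMode (max K K') d (x + y) n = h.oppMode K d x n + h.oppMode K' d y n := by
      rw [← h.oppMode_of_le hK (le_max_left K K'), ← h.oppMode_of_le hK' (le_max_right K K')]
      simp only [oppMode, map_add, Pi.add_apply, smul_add, Finset.sum_add_distrib]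
    rw [this, map_add, map_add, Pi.add_apply, LinearMap.add_apply, LinearMap.add_apply, ip.add_left,
      coreInner_add_right, e, e']
  | smul r x _ hx =>
    obtain ⟨K, hK, e⟩ := hx
    refine ⟨K, by rw [map_smul, hK, smul_zero], fun n b v => ?_⟩
    have : h.oppMode K d (r • x) n = r • h.oppMode K d x n := by
      simp only [oppMode, map_smul, Pi.smul_apply, Finset.smul_sum]
      refine Finset.sum_congr rfl fun j _ => ?_
      module
    rw [this, map_smulₛₗ, map_smul, Pi.smul_apply, LinearMap.smul_apply, LinearMap.smul_apply,
      ip.smul_left, coreInner_smul_right, e]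
    simp

theorem vosa_isUnitary (h : ρ.IsVacuumModule c Ω) (hu : ρ.IsUnitary ip)
    (hn : ip.inner Ω Ω = 1) : h.vosa.IsUnitary ip := by
  refine ⟨hn, ?_⟩
  obtain ⟨θ, hθ⟩ := h.exists_antilinear hu
  refine ⟨θ, h.vosa_isAntilinearInvolution hθ, fun d n a ha b v => ?_⟩
  rw [h.vosa_L] at ha ⊢
  obtain ⟨K, hK, e⟩ := h.inner_Y_theta hu hθ ha
  rw [vosa_Y, e, finsum_nat_eq_sum (K := K)]
  · simp only [oppMode, LinearMap.smul_apply, LinearMap.sum_apply, coreInner_smul_right,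
      coreInner_sum_right]
  · intro j hj
    rw [L_one_pow_eq_zero hK hj, map_zero]
    simp [coreInner_zero_right]

end Unitary

end IsVacuumModule

end NSAction

/-! ## The irreducible vacuum module -/

namespace NSEnveloping

variable {c : ℂ}

theorem map_mem {M : Type*} [AddCommGroup M] [Module ℂ M]
    (ψ : NSEnveloping c →ₐ[ℂ] Module.End ℂ M) (N : Submodule ℂ M)
    (h : ∀ g, ∀ x ∈ N, ψ (gen c g) x ∈ N) (u : NSEnveloping c) {x : M} (hx : x ∈ N) :
    ψ u x ∈ N := by
  obtain ⟨a, rfl⟩ := RingQuot.mkAlgHom_surjective ℂ (NSRel c) u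
  induction a using FreeAlgebra.induction generalizing x with
  | grade0 r => rw [AlgHom.commutes, AlgHom.commutes]; exact N.smul_mem r hx
  | grade1 g => exact h g x hx
  | mul a b ha hb => rw [map_mul, map_mul]; exact ha (hb hx)
  | add a b ha hb => rw [map_add, map_add]; exact N.add_mem (ha hx) (hb hx)

theorem eq_top_of_one_mem (N : Submodule ℂ (NSEnveloping c)) (h1 : 1 ∈ N)
    (h : ∀ g, ∀ x ∈ N, gen c g * x ∈ N) : N = ⊤ := by
  refine eq_top_iff.2 fun u _ => ?_
  have := map_mem (Algebra.lmul ℂ (NSEnveloping c)) N h u h1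
  simpa using this

/-- Modules over the enveloping algebra satisfy the Neveu-Schwarz relations. -/
theorem relations {M : Type*} [AddCommGroup M] [Module ℂ M]
    (ψ : NSEnveloping c →ₐ[ℂ] Module.End ℂ M) :
    NSRelations (fun m => ψ (gen c (NSGen.L m))) (fun r => ψ (gen c (NSGen.G r))) c where
  LL m n := by
    have := congrArg ψ (RingQuot.mkAlgHom_rel ℂ (NSRel.LL (c := c) m n))
    simp only [map_sub, map_mul, map_add, map_smul, map_one] at this
    exact this
  LG m n := by
    have := congrArg ψ (RingQuot.mkAlgHom_rel ℂ (NSRel.LG (c := c) m n))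
    simp only [map_sub, map_mul, map_smul] at this
    exact this
  GG m n := by
    have := congrArg ψ (RingQuot.mkAlgHom_rel ℂ (NSRel.GG (c := c) m n))
    simp only [map_mul, map_add, map_smul, map_one] at this
    exact this

end NSEnveloping

theorem NSRelations.prodMap {V W : Type*} [AddCommGroup V] [Module ℂ V] [AddCommGroup W]
    [Module ℂ W] {L G : ℤ → Module.End ℂ V} {L' G' : ℤ → Module.End ℂ W} {c : ℂ}
    (h : NSRelations L G c) (h' : NSRelations L' G' c) :
    NSRelations (fun m => (L m).prodMap (L' m)) (fun r => (G r).prodMap (G' r)) c where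
  LL m n := LinearMap.ext fun x => Prod.ext (LinearMap.congr_fun (h.LL m n) x.1)
    (LinearMap.congr_fun (h'.LL m n) x.2)
  LG m n := LinearMap.ext fun x => Prod.ext (LinearMap.congr_fun (h.LG m n) x.1)
    (LinearMap.congr_fun (h'.LG m n) x.2)
  GG m n := LinearMap.ext fun x => Prod.ext (LinearMap.congr_fun (h.GG m n) x.1)
    (LinearMap.congr_fun (h'.GG m n) x.2)

/-- The representation of the enveloping algebra. -/
noncomputable def NSRelations.toAlgHom {V : Type*} [AddCommGroup V] [Module ℂ V]
    {L G : ℤ → Module.End ℂ V} {c : ℂ} (h : NSRelations L G c) :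
    NSEnveloping c →ₐ[ℂ] Module.End ℂ V :=
  RingQuot.liftAlgHom ℂ ⟨FreeAlgebra.lift ℂ fun g => match g with
    | NSGen.L m => L m
    | NSGen.G r => G r, fun x y hxy => by
      cases hxy with
      | LL m n => simpa only [map_sub, map_mul, map_add, map_smul, map_one,
          FreeAlgebra.lift_ι_apply] using h.LL m n
      | LG m n => simpa only [map_sub, map_mul, map_add, map_smul, map_one,
          FreeAlgebra.lift_ι_apply] using h.LG m n
      | GG m n => simpa only [map_sub, map_mul, map_add, map_smul, map_one,
          FreeAlgebra.lift_ι_apply] using h.GG m n⟩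

section toAlgHom

variable {V : Type*} [AddCommGroup V] [Module ℂ V] {L G : ℤ → Module.End ℂ V} {c : ℂ}

theorem NSRelations.toAlgHom_L (h : NSRelations L G c) (m : ℤ) :
    h.toAlgHom (NSEnveloping.gen c (NSGen.L m)) = L m := by
  simp [toAlgHom, NSEnveloping.gen, RingQuot.liftAlgHom_mkAlgHom_apply]

theorem NSRelations.toAlgHom_G (h : NSRelations L G c) (r : ℤ) :
    h.toAlgHom (NSEnveloping.gen c (NSGen.G r)) = G r := by
  simp [toAlgHom, NSEnveloping.gen, RingQuot.liftAlgHom_mkAlgHom_apply]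

end toAlgHom

/-! ### Evaluation at the vacuum and simplicity -/

namespace NSAction

/-- The squared norm of G_{-1/2}Ω is (Ω|G_{1/2}G_{-1/2}Ω) = 2(Ω|L_0Ω) = 0; the central term vanishes
at this index. -/
theorem isVacuumModule_of_isUnitary {V : Type*} [AddCommGroup V] [Module ℂ V] {ρ : NSAction V}
    {c : ℝ} {Ω : V} {ip : InnerProductSpace.Core ℂ V} (hρ : ρ.IsRepresentation (c : ℂ))
    (hΩ : ρ.IsCyclicLowestWeight Ω 0) (hΩ_even : Ω ∈ ρ.parity 0) (hu : ρ.IsUnitary ip) :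
    ρ.IsVacuumModule c Ω where
  rep := hρ
  cyc := hΩ
  even := hΩ_even
  G_neg_one := by
    refine ip.definite _ ?_
    rw [hu.2, show (-(-1) - 1 : ℤ) = 0 by norm_num, hρ.relations.GG_apply, hΩ.G_pos 0 le_rfl]
    norm_num [hΩ.L_zero, coreInner_zero_right]

namespace IsVacuumModule

variable {V : Type*} [AddCommGroup V] [Module ℂ V] {ρ : NSAction V} {c : ℝ} {Ω : V}
  {ip : InnerProductSpace.Core ℂ V}

/-- The evaluation of the enveloping algebra at the vacuum. -/
noncomputable def eval (h : ρ.IsVacuumModule c Ω) : NSEnveloping (c : ℂ) →ₗ[ℂ] V :=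
  (LinearMap.applyₗ Ω).comp h.rep.relations.toAlgHom.toLinearMap

theorem eval_mul (h : ρ.IsVacuumModule c Ω) (u v : NSEnveloping (c : ℂ)) :
    h.eval (u * v) = h.rep.relations.toAlgHom u (h.eval v) := by
  simp [eval]

theorem eval_one (h : ρ.IsVacuumModule c Ω) : h.eval 1 = Ω := by
  simp [eval]

theorem eval_L_mul (h : ρ.IsVacuumModule c Ω) (m : ℤ) (u : NSEnveloping (c : ℂ)) :
    h.eval (NSEnveloping.gen c (NSGen.L m) * u) = ρ.L m (h.eval u) := by
  rw [eval_mul, NSRelations.toAlgHom_L]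

theorem eval_G_mul (h : ρ.IsVacuumModule c Ω) (r : ℤ) (u : NSEnveloping (c : ℂ)) :
    h.eval (NSEnveloping.gen c (NSGen.G r) * u) = ρ.G r (h.eval u) := by
  rw [eval_mul, NSRelations.toAlgHom_G]

theorem eval_L (h : ρ.IsVacuumModule c Ω) (m : ℤ) :
    h.eval (NSEnveloping.gen c (NSGen.L m)) = ρ.L m Ω := by
  rw [← mul_one (NSEnveloping.gen _ _), eval_L_mul, eval_one]

theorem eval_G (h : ρ.IsVacuumModule c Ω) (r : ℤ) :
    h.eval (NSEnveloping.gen c (NSGen.G r)) = ρ.G r Ω := by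
  rw [← mul_one (NSEnveloping.gen _ _), eval_G_mul, eval_one]

theorem eval_surjective (h : ρ.IsVacuumModule c Ω) : Function.Surjective h.eval := by
  rw [← LinearMap.range_eq_top]
  refine h.cyc.cyclic _ ⟨1, h.eval_one⟩ ?_ ?_
  · rintro m _ ⟨u, rfl⟩
    exact ⟨_, h.eval_L_mul m u⟩
  · rintro m _ ⟨u, rfl⟩
    exact ⟨_, h.eval_G_mul m u⟩

theorem L_eq_zero (h : ρ.IsVacuumModule c Ω) {m : ℤ} (hm : -1 ≤ m) : ρ.L m Ω = 0 := by
  rcases eq_or_lt_of_le hm with rfl | hm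
  · exact h.L_neg_one
  · exact h.cyc.isNSVacuum.L_nonneg m (by omega)

theorem G_eq_zero (h : ρ.IsVacuumModule c Ω) {r : ℤ} (hr : -1 ≤ r) : ρ.G r Ω = 0 := by
  rcases eq_or_lt_of_le hr with rfl | hr
  · exact h.G_neg_one
  · exact h.cyc.G_pos r (by omega)

theorem inner_vacuum_gWord (h : ρ.IsVacuumModule c Ω) (hu : ρ.IsUnitary ip) (b : Bool)
    (w : List Bool) : ip.inner Ω (gWord ρ.G Ω (b :: w)) = 0 := by
  rw [gWord, show (if b then (-2 : ℤ) else -1) = -(if b then (1 : ℤ) else 0) - 1 by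
    cases b <;> norm_num, ← hu.2, h.cyc.G_pos _ (by cases b <;> norm_num), coreInner_zero_left]

/-- The component of `u` of weight `0` is determined by its image in any module with a vacuum. -/
theorem exists_vacuum_component (h : ρ.IsVacuumModule c Ω) (hu : ρ.IsUnitary ip) {M : Type*}
    [AddCommGroup M] [Module ℂ M] (ψ : NSEnveloping (c : ℂ) →ₐ[ℂ] Module.End ℂ M) {ω : M}
    (hω : IsNSVacuum (fun m => ψ (NSEnveloping.gen c (NSGen.L m)))
      (fun r => ψ (NSEnveloping.gen c (NSGen.G r))) ω) (u : NSEnveloping (c : ℂ)) :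
    ∃ a : ℂ, ψ u ω - a • ω ∈
        ⨆ μ ≠ 0, Module.End.eigenspace (ψ (NSEnveloping.gen c (NSGen.L 0))) μ ∧
      ip.inner Ω (h.eval u) = a * ip.inner Ω Ω := by
  -- In the product module, words applied to (ω, Ω) express uω and uΩ simultaneously with the same
  -- coefficients. The empty word carries the scalar a; the others have nonzero weight in M and are
  -- orthogonal to Ω in V.
  have R := (NSEnveloping.relations ψ).prodMap h.rep.relations
  have hv : IsNSVacuum (fun m => (ψ (NSEnveloping.gen c (NSGen.L m))).prodMap (ρ.L m))
      (fun r => (ψ (NSEnveloping.gen c (NSGen.G r))).prodMap (ρ.G r)) (ω, Ω) :=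
    ⟨fun m hm => Prod.ext (hω.L_nonneg m hm) (h.cyc.isNSVacuum.L_nonneg m hm),
      fun m hm => Prod.ext (hω.G_nonneg m hm) (h.cyc.isNSVacuum.G_nonneg m hm)⟩
  obtain ⟨hG, hL⟩ := R.span_invariant hv
  set W := Submodule.span ℂ (Set.range (gWord
    (fun r => (ψ (NSEnveloping.gen c (NSGen.G r))).prodMap (ρ.G r)) (ω, Ω))) with hW
  have hmem : ((ψ u ω, h.eval u) : M × V) ∈ W := by
    have : W.comap (((LinearMap.applyₗ ω).comp ψ.toLinearMap).prod h.eval) = ⊤ := by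
      refine NSEnveloping.eq_top_of_one_mem _ ?_ fun g x hx => ?_
      · refine Submodule.subset_span ⟨[], ?_⟩
        simp [gWord, eval_one]
      · cases g with
        | L m =>
          have := hL m _ hx
          simpa [eval_L_mul] using this
        | G r =>
          have := hG r _ hx
          simpa [eval_G_mul] using this
    have hu' : u ∈ W.comap (((LinearMap.applyₗ ω).comp ψ.toLinearMap).prod h.eval) := by
      rw [this]; trivial
    exact hu'
  have key : ∀ x ∈ W, ∃ a : ℂ, x.1 - a • ω ∈
        ⨆ μ ≠ 0, Module.End.eigenspace (ψ (NSEnveloping.gen c (NSGen.L 0))) μ ∧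
      ip.inner Ω x.2 = a * ip.inner Ω Ω := by
    intro x hx
    induction hx using Submodule.span_induction with
    | mem x hx =>
      obtain ⟨w, rfl⟩ := hx
      have hw : ∀ w, gWord (fun r => (ψ (NSEnveloping.gen c (NSGen.G r))).prodMap (ρ.G r))
          (ω, Ω) w = (gWord (fun r => ψ (NSEnveloping.gen c (NSGen.G r))) ω w,
            gWord ρ.G Ω w) := by
        intro w
        induction w with
        | nil => rfl
        | cons b w ih => rw [gWord, ih]; rfl
      rw [hw]
      cases w with
      | nil => exact ⟨1, by simp [gWord], by simp [gWord]⟩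
      | cons b w =>
        refine ⟨0, ?_, ?_⟩
        · rw [zero_smul, sub_zero]
          refine Submodule.mem_iSup_of_mem ((gWeight (b :: w) : ℂ) / 2)
            (Submodule.mem_iSup_of_mem ?_ (Module.End.mem_eigenspace_iff.2
              ((NSEnveloping.relations ψ).L_zero_gWord hω (b :: w))))
          have : gWeight (b :: w) ≠ 0 := by cases b <;> simp [gWeight]
          simpa using this
        · rw [zero_mul]
          exact h.inner_vacuum_gWord hu b w
    | zero => exact ⟨0, by simp, by simp [coreInner_zero_right]⟩
    | add x y _ _ hx hy =>
      obtain ⟨a, ha, ha'⟩ := hx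
      obtain ⟨b, hb, hb'⟩ := hy
      refine ⟨a + b, ?_, ?_⟩
      · convert Submodule.add_mem _ ha hb using 1
        rw [Prod.fst_add]
        module
      · rw [Prod.snd_add, coreInner_add_right, ha', hb', add_mul]
    | smul r x _ hx =>
      obtain ⟨a, ha, ha'⟩ := hx
      refine ⟨r * a, ?_, ?_⟩
      · convert Submodule.smul_mem _ r ha using 1
        rw [Prod.smul_fst]
        module
      · rw [Prod.smul_snd, coreInner_smul_right, ha', mul_assoc]
  exact key _ hmem

/-- If uω = 0, then aω has weight 0 and is also a sum of vectors of nonzero weight, so a = 0. -/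
theorem inner_vacuum_eval (h : ρ.IsVacuumModule c Ω) (hu : ρ.IsUnitary ip) {M : Type*}
    [AddCommGroup M] [Module ℂ M] (ψ : NSEnveloping (c : ℂ) →ₐ[ℂ] Module.End ℂ M) {ω : M}
    (hω : IsNSVacuum (fun m => ψ (NSEnveloping.gen c (NSGen.L m)))
      (fun r => ψ (NSEnveloping.gen c (NSGen.G r))) ω) (hω0 : ω ≠ 0) {u : NSEnveloping (c : ℂ)}
    (hu' : ψ u ω = 0) : ip.inner Ω (h.eval u) = 0 := by
  obtain ⟨a, ha, e⟩ := h.exists_vacuum_component hu ψ hω u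
  rw [hu', zero_sub, ← neg_smul] at ha
  have h0 : (-a) • ω ∈ Module.End.eigenspace (ψ (NSEnveloping.gen c (NSGen.L 0))) 0 := by
    rw [Module.End.mem_eigenspace_iff, map_smul, hω.L_nonneg 0 le_rfl]
    simp
  have := Submodule.disjoint_def.1
    (Module.End.eigenspaces_iSupIndep (ψ (NSEnveloping.gen c (NSGen.L 0))) 0) _ h0 ha
  have ha0 : a = 0 := by simpa [hω0] using this
  rw [e, ha0, zero_mul]

/-- A proper left ideal that contains the generators of nonnegative index annihilates the vacuum of
a unitary module. -/
theorem eval_eq_zero_of_mem (h : ρ.IsVacuumModule c Ω) (hu : ρ.IsUnitary ip)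
    (I : Submodule (NSEnveloping (c : ℂ)) (NSEnveloping (c : ℂ))) (hI : I ≠ ⊤)
    (hL : ∀ m : ℤ, -1 ≤ m → NSEnveloping.gen (c : ℂ) (NSGen.L m) ∈ I)
    (hG : ∀ r : ℤ, -1 ≤ r → NSEnveloping.gen (c : ℂ) (NSGen.G r) ∈ I)
    {u : NSEnveloping (c : ℂ)} (hu' : u ∈ I) : h.eval u = 0 := by
  set ψ : NSEnveloping (c : ℂ) →ₐ[ℂ] Module.End ℂ (NSEnveloping (c : ℂ) ⧸ I) :=
    Algebra.lsmul ℂ ℂ (NSEnveloping (c : ℂ) ⧸ I)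
  set ω : NSEnveloping (c : ℂ) ⧸ I := Submodule.Quotient.mk 1 with hω
  have hψ : ∀ v, ψ v ω = Submodule.Quotient.mk v := fun v => by
    change v • ω = _
    rw [hω, ← Submodule.Quotient.mk_smul, smul_eq_mul, mul_one]
  have hω0 : ω ≠ 0 := fun e => hI ((Ideal.eq_top_iff_one I).2
    ((Submodule.Quotient.mk_eq_zero I).1 e))
  have hv : IsNSVacuum (fun m => ψ (NSEnveloping.gen c (NSGen.L m)))
      (fun r => ψ (NSEnveloping.gen c (NSGen.G r))) ω :=
    ⟨fun m hm => by
        change ψ _ ω = 0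
        rw [hψ]
        exact (Submodule.Quotient.mk_eq_zero I).2 (hL m (by omega)),
      fun m hm => by
        change ψ _ ω = 0
        rw [hψ]
        exact (Submodule.Quotient.mk_eq_zero I).2 (hG m (by omega))⟩
  have vac : ∀ v ∈ I, ip.inner Ω (h.eval v) = 0 := by
    intro v hv'
    refine h.inner_vacuum_eval hu ψ hv hω0 ?_
    rw [hψ, (Submodule.Quotient.mk_eq_zero I).2 hv']
  -- The letters of y become left multiplications on v, and these stay in I.
  have all : ∀ y : V, ∀ v ∈ I, ip.inner y (h.eval v) = 0 := by
    intro y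
    induction y using word_induction h.rep h.cyc with
    | zero => intro v _; exact coreInner_zero_left ip _
    | add x y hx hy => intro v hv; rw [ip.add_left, hx v hv, hy v hv, add_zero]
    | smul a x hx => intro v hv; rw [ip.smul_left, hx v hv, mul_zero]
    | vac => exact vac
    | step s k x hs hk hx =>
      intro v hv
      rw [hu.2, ← eval_G_mul]
      exact hx _ (I.smul_mem _ hv)
  exact ip.definite _ (all _ u hu')

/-- A unitary vacuum module is simple as a vertex superalgebra. -/
theorem vosa_isSimple (h : ρ.IsVacuumModule c Ω) (hu : ρ.IsUnitary ip) : h.vosa.IsSimple := by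
  refine ⟨⟨Ω, 0, h.cyc.ne_zero⟩, fun J hJ => ?_⟩
  have hJL : ∀ m, ∀ x ∈ J, ρ.L m x ∈ J := fun m x hx => by
    rw [← h.vosa_isStructureOn.Y_ν m]; exact hJ.2 _ _ x hx
  have hJG : ∀ r, ∀ x ∈ J, ρ.G r x ∈ J := fun r x hx => by
    rw [← h.vosa_isStructureOn.Y_τ r]; exact hJ.2 _ _ x hx
  by_cases hΩ : Ω ∈ J
  · exact Or.inr (h.cyc.cyclic J hΩ hJL hJG)
  · refine Or.inl (Submodule.eq_bot_iff J |>.2 fun x hx => ?_)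
    -- An ideal J without Ω pulls back to a proper left ideal, which annihilates Ω by
    -- `eval_eq_zero_of_mem`; since evaluation is surjective, J = 0.
    let I : Submodule (NSEnveloping (c : ℂ)) (NSEnveloping (c : ℂ)) :=
      { carrier := {u | h.eval u ∈ J}
        zero_mem' := by simp
        add_mem' := fun {a b} ha hb => by
          simp only [Set.mem_ofPred_eq, map_add] at ha hb ⊢; exact J.add_mem ha hb
        smul_mem' := fun v u hu' => by
          change h.eval (v * u) ∈ J
          rw [eval_mul]
          refine NSEnveloping.map_mem _ J (fun g y hy => ?_) v hu'
          cases g with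
          | L m => rw [NSRelations.toAlgHom_L]; exact hJL m y hy
          | G r => rw [NSRelations.toAlgHom_G]; exact hJG r y hy }
    have hmem : ∀ v, v ∈ I ↔ h.eval v ∈ J := fun v => Iff.rfl
    obtain ⟨u, rfl⟩ := h.eval_surjective x
    refine h.eval_eq_zero_of_mem hu I ?_ ?_ ?_ hx
    · intro e
      apply hΩ
      rw [← h.eval_one, ← hmem, e]
      trivial
    · intro m hm
      rw [hmem, eval_L, h.L_eq_zero hm]
      exact J.zero_mem
    · intro m hm
      rw [hmem, eval_G, h.G_eq_zero hm]
      exact J.zero_mem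

end IsVacuumModule

end NSAction

/-! ## Isomorphisms of vacuum modules and the super-Virasoro VOSA -/

namespace NSAction

namespace IsVacuumModule

section Iso

variable {V W : Type*} [AddCommGroup V] [Module ℂ V] [AddCommGroup W] [Module ℂ W]
  {ρ : NSAction V} {ρ' : NSAction W} {c : ℝ} {Ω : V} {Ω' : W}

theorem map_parity (h : ρ.IsVacuumModule c Ω) (h' : ρ'.IsVacuumModule c Ω') (φ : V ≃ₗ[ℂ] W)
    (hG : ∀ r x, φ (ρ.G r x) = ρ'.G r (φ x)) (hΩ : φ Ω = Ω') (p : ZMod 2) {a : V}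
    (ha : a ∈ ρ.parity p) : φ a ∈ ρ'.parity p := by
  rw [h.parity_eq_span] at ha
  induction ha using Submodule.span_induction with
  | mem x hx =>
    obtain ⟨w, rfl, rfl⟩ := hx
    have : φ (gWord ρ.G Ω w) = gWord ρ'.G Ω' w := by
      induction w with
      | nil => exact hΩ
      | cons b w ih => rw [gWord, hG, ih, gWord]
    rw [this]
    exact h'.gWord_mem_parity w
  | zero => rw [map_zero]; exact Submodule.zero_mem _
  | add x y _ _ hx hy => rw [map_add]; exact Submodule.add_mem _ hx hy
  | smul a x _ hx => rw [map_smul]; exact Submodule.smul_mem _ a hx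

/-- An isomorphism of vacuum modules is an isomorphism of VOSAs. -/
theorem vosa_isIso (h : ρ.IsVacuumModule c Ω) (h' : ρ'.IsVacuumModule c Ω') (φ : V ≃ₗ[ℂ] W)
    (hL : ∀ m x, φ (ρ.L m x) = ρ'.L m (φ x)) (hG : ∀ r x, φ (ρ.G r x) = ρ'.G r (φ x))
    (hΩ : φ Ω = Ω') : h.vosa.IsIso h'.vosa φ := by
  have hG' : ∀ r x, φ.symm (ρ'.G r x) = ρ.G r (φ.symm x) := fun r x => by
    rw [LinearEquiv.symm_apply_eq, hG, LinearEquiv.apply_symm_apply]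
  have hL' : ∀ r x, φ.symm (ρ'.L r x) = ρ.L r (φ.symm x) := fun r x => by
    rw [LinearEquiv.symm_apply_eq, hL, LinearEquiv.apply_symm_apply]
  have hΩ' : φ.symm Ω' = Ω := by rw [LinearEquiv.symm_apply_eq, hΩ]
  refine ⟨fun p a ha => h.map_parity h' φ hG hΩ p ha, hΩ, ?_, fun a b n => ?_⟩
  · change φ (ρ.L (-2) Ω) = ρ'.L (-2) Ω'
    rw [hL, hΩ]
  change φ (h.Y a n b) = h'.Y (φ a) n (φ b)
  induction a using h.parity_induction with
  | add x y hx hy => simp [hx, hy]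
  | hom p a ha =>
    have hY := h.Y_mem ha
    have hc : ∀ X x, φ.conj X x = φ (X (φ.symm x)) := fun X x => rfl
    have hmem : (fun n => φ.conj (h.Y a n)) ∈ ρ'.fields p := by
      refine ⟨fun b => ?_, fun q n x hx => ?_, fun n => ?_, ?_⟩
      · obtain ⟨M, hM⟩ := hY.1 (φ.symm b)
        exact ⟨M, fun n hn => by rw [hc, hM n hn, map_zero]⟩
      · exact h.map_parity h' φ hG hΩ _ (hY.2.1 q n _ (h'.map_parity h φ.symm hG' hΩ' q hx))
      · ext x
        have := hY.2.2.1.apply n (φ.symm x)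
        simp only [LinearMap.sub_apply, Module.End.mul_apply, LinearMap.smul_apply, hc, ← hL, hL',
          this]
        simp
      · obtain ⟨N, hN⟩ := hY.2.2.2
        refine ⟨N, ?_⟩
        have e : superComm (paritySign 1 p) ρ'.tauField (fun n => φ.conj (h.Y a n)) =
            fun m n => φ.conj.toLinearMap (superComm (paritySign 1 p) ρ.tauField (h.Y a) m n) := by
          ext m n x
          simp only [superComm, LinearMap.sub_apply, Module.End.mul_apply, LinearMap.smul_apply,
            LinearEquiv.coe_coe, hc, map_sub, map_smul, tauField, hG, hG']
        rw [e, diff2_pow_map, hN]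
        ext m n x
        simp
    have e := h'.Y_state hmem
    simp only [hc, hΩ', h.Y_apply_vac] at e
    rw [e, hc, LinearEquiv.symm_apply_apply]

end Iso

/-! ### Identification with the irreducible vacuum module -/

variable {V : Type*} [AddCommGroup V] [Module ℂ V] {ρ : NSAction V} {c : ℝ} {Ω : V}
  {ip : InnerProductSpace.Core ℂ V}

/-- The annihilator of Ω contains every ideal in the supremum that defines `vacuumIdeal`, and it is
itself one of them. -/
theorem mem_vacuumIdeal_iff (h : ρ.IsVacuumModule c Ω) (hu : ρ.IsUnitary ip)
    (u : NSEnveloping (c : ℂ)) : u ∈ NSEnveloping.vacuumIdeal (c : ℂ) ↔ h.eval u = 0 := by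
  let A : Submodule (NSEnveloping (c : ℂ)) (NSEnveloping (c : ℂ)) :=
    { carrier := {u | h.eval u = 0}
      zero_mem' := by simp
      add_mem' := fun {a b} ha hb => by
        simp only [Set.mem_ofPred_eq, map_add] at ha hb ⊢; rw [ha, hb, add_zero]
      smul_mem' := fun v u hu' => by
        change h.eval (v * u) = 0
        rw [eval_mul, show h.eval u = 0 from hu', map_zero] }
  have hA : ∀ v, v ∈ A ↔ h.eval v = 0 := fun v => Iff.rfl
  constructor
  · intro hv
    have hle : NSEnveloping.vacuumIdeal (c : ℂ) ≤ A := by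
      refine sSup_le ?_
      rintro I ⟨hI, hL, hG⟩ v hv
      exact h.eval_eq_zero_of_mem hu I hI hL hG hv
    exact hle hv
  · intro hv
    have hle : A ≤ NSEnveloping.vacuumIdeal (c : ℂ) := by
      refine le_sSup ⟨fun e => h.cyc.ne_zero ?_, fun m hm => ?_, fun r hr => ?_⟩
      · rw [← h.eval_one, ← hA, e]
        trivial
      · rw [hA, eval_L, h.L_eq_zero hm]
      · rw [hA, eval_G, h.G_eq_zero hr]
    exact hle hv

theorem ker_eval (h : ρ.IsVacuumModule c Ω) (hu : ρ.IsUnitary ip) :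
    (NSEnveloping.vacuumIdeal (c : ℂ)).restrictScalars ℂ = LinearMap.ker h.eval := by
  ext u
  rw [Submodule.restrictScalars_mem, h.mem_vacuumIdeal_iff hu, LinearMap.mem_ker]

/-- A unitary vacuum module is isomorphic to the irreducible vacuum module. -/
noncomputable def superVirasoroEquiv (h : ρ.IsVacuumModule c Ω) (hu : ρ.IsUnitary ip) :
    SuperVirasoro (c : ℂ) ≃ₗ[ℂ] V :=
  (Submodule.Quotient.restrictScalarsEquiv ℂ (NSEnveloping.vacuumIdeal (c : ℂ))).symm.trans
    ((Submodule.quotEquivOfEq _ _ (h.ker_eval hu)).trans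
      (h.eval.quotKerEquivOfSurjective h.eval_surjective))

theorem superVirasoroEquiv_mk (h : ρ.IsVacuumModule c Ω) (hu : ρ.IsUnitary ip)
    (u : NSEnveloping (c : ℂ)) :
    h.superVirasoroEquiv hu (Submodule.Quotient.mk u) = h.eval u := rfl

theorem superVirasoroEquiv_symm_vac (h : ρ.IsVacuumModule c Ω) (hu : ρ.IsUnitary ip) :
    (h.superVirasoroEquiv hu).symm Ω = SuperVirasoro.vac c := by
  rw [LinearEquiv.symm_apply_eq, SuperVirasoro.vac, superVirasoroEquiv_mk, eval_one]

theorem superVirasoroEquiv_symm_L (h : ρ.IsVacuumModule c Ω) (hu : ρ.IsUnitary ip) (m : ℤ)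
    (x : V) : (h.superVirasoroEquiv hu).symm (ρ.L m x) =
      (SuperVirasoro.action c).L m ((h.superVirasoroEquiv hu).symm x) := by
  obtain ⟨u, rfl⟩ := h.eval_surjective x
  rw [← eval_L_mul, ← h.superVirasoroEquiv_mk hu, ← h.superVirasoroEquiv_mk hu,
    LinearEquiv.symm_apply_apply, LinearEquiv.symm_apply_apply]
  rfl

theorem superVirasoroEquiv_symm_G (h : ρ.IsVacuumModule c Ω) (hu : ρ.IsUnitary ip) (r : ℤ)
    (x : V) : (h.superVirasoroEquiv hu).symm (ρ.G r x) =
      (SuperVirasoro.action c).G r ((h.superVirasoroEquiv hu).symm x) := by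
  obtain ⟨u, rfl⟩ := h.eval_surjective x
  rw [← eval_G_mul, ← h.superVirasoroEquiv_mk hu, ← h.superVirasoroEquiv_mk hu,
    LinearEquiv.symm_apply_apply, LinearEquiv.symm_apply_apply]
  rfl

theorem eval_prod_mem_parity (h : ρ.IsVacuumModule c Ω) (w : List NSGen) :
    h.eval (w.map (NSEnveloping.gen (c : ℂ))).prod ∈ ρ.parity (w.map NSGen.parity).sum := by
  induction w with
  | nil => simpa [eval_one] using h.even
  | cons g w ih =>
    rw [List.map_cons, List.map_cons, List.prod_cons, List.sum_cons]
    cases g with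
    | L m =>
      rw [eval_L_mul, NSGen.parity, zero_add]
      exact h.rep.L_parity _ _ _ ih
    | G r =>
      rw [eval_G_mul, NSGen.parity, add_comm]
      exact h.rep.G_parity _ _ _ ih

theorem exists_word (h : ρ.IsVacuumModule c Ω) (w : List Bool) : ∃ l : List NSGen,
    (l.map NSGen.parity).sum = gWeight w ∧
      h.eval (l.map (NSEnveloping.gen (c : ℂ))).prod = gWord ρ.G Ω w := by
  induction w with
  | nil => exact ⟨[], by simp [gWeight], by simp [eval_one, gWord]⟩
  | cons b w ih =>
    obtain ⟨l, hl, e⟩ := ih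
    refine ⟨NSGen.G (if b then -2 else -1) :: l, ?_, ?_⟩
    · rw [List.map_cons, List.sum_cons, hl, gWeight, Nat.cast_add]
      congr 1
      cases b <;> decide
    · rw [List.map_cons, List.prod_cons, eval_G_mul, e, gWord]

theorem superVirasoro_parity (h : ρ.IsVacuumModule c Ω) (hu : ρ.IsUnitary ip) (p : ZMod 2) :
    (SuperVirasoro.action c).parity p =
      (ρ.parity p).map (h.superVirasoroEquiv hu).symm.toLinearMap := by
  refine le_antisymm (Submodule.span_le.2 ?_) ?_
  · rintro _ ⟨w, rfl, rfl⟩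
    refine ⟨_, h.eval_prod_mem_parity w, ?_⟩
    rw [← h.superVirasoroEquiv_mk hu]
    exact LinearEquiv.symm_apply_apply _ _
  · rw [h.parity_eq_span, Submodule.map_span_le]
    rintro _ ⟨w, rfl, rfl⟩
    obtain ⟨l, hl, e⟩ := h.exists_word w
    refine Submodule.subset_span ⟨l, hl, ?_⟩
    rw [← e, ← h.superVirasoroEquiv_mk hu]
    exact LinearEquiv.symm_apply_apply _ _

/-- The relations hold in every module over the enveloping algebra; the rest is carried over from V
by the equivalence. The construction `vosa` then applies to the quotient as well. -/
theorem superVirasoro_isVacuumModule (h : ρ.IsVacuumModule c Ω) (hu : ρ.IsUnitary ip) :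
    (SuperVirasoro.action (c : ℂ)).IsVacuumModule c (SuperVirasoro.vac c) := by
  set φ := (h.superVirasoroEquiv hu).symm
  have hL := h.superVirasoroEquiv_symm_L hu
  have hG := h.superVirasoroEquiv_symm_G hu
  have hΩ := h.superVirasoroEquiv_symm_vac hu
  have hp := h.superVirasoro_parity hu
  have R := NSEnveloping.relations (Algebra.lsmul ℂ ℂ (SuperVirasoro (c : ℂ)) :
    NSEnveloping (c : ℂ) →ₐ[ℂ] Module.End ℂ (SuperVirasoro (c : ℂ)))
  refine ⟨⟨?_, ?_, ?_, R.LL, R.LG, R.GG⟩, ⟨?_, ?_, ?_, ?_, ?_⟩, ?_, ?_⟩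
  · rw [DirectSum.isInternal_submodule_iff_iSupIndep_and_iSup_eq_top]
    have e : (SuperVirasoro.action (c : ℂ)).parity = Submodule.orderIsoMapComap φ ∘ ρ.parity :=
      funext hp
    rw [e, iSupIndep_map_orderIso_iff]
    refine ⟨h.rep.parity_internal.submodule_iSupIndep, ?_⟩
    have := (Submodule.orderIsoMapComap φ).map_iSup ρ.parity
    rw [h.rep.parity_internal.submodule_iSup_eq_top, map_top] at this
    exact this.symm
  · intro m p x hx
    rw [hp] at hx ⊢
    obtain ⟨y, hy, rfl⟩ := hx
    exact ⟨_, h.rep.L_parity m p y hy, hL m y⟩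
  · intro m p x hx
    rw [hp] at hx ⊢
    obtain ⟨y, hy, rfl⟩ := hx
    exact ⟨_, h.rep.G_parity m p y hy, hG m y⟩
  · rw [← hΩ]
    exact (LinearEquiv.map_ne_zero_iff _).2 h.cyc.ne_zero
  · rw [← hΩ, ← hL, h.L_eq_zero (by norm_num), map_zero]
    exact (zero_smul ℂ (φ Ω)).symm
  · intro m hm
    rw [← hΩ, ← hL, h.L_eq_zero (by omega), map_zero]
  · intro m hm
    rw [← hΩ, ← hG, h.G_eq_zero (by omega), map_zero]
  · intro W hW hWL hWG
    have : W.comap φ.toLinearMap = ⊤ := by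
      refine h.cyc.cyclic _ ?_ ?_ ?_
      · change φ Ω ∈ W
        rw [hΩ]
        exact hW
      · intro m x hx
        change φ (ρ.L m x) ∈ W
        rw [hL]
        exact hWL m _ hx
      · intro m x hx
        change φ (ρ.G m x) ∈ W
        rw [hG]
        exact hWG m _ hx
    refine eq_top_iff.2 fun x _ => ?_
    have hx : φ.symm x ∈ W.comap φ.toLinearMap := by rw [this]; trivial
    simpa using hx
  · rw [hp, ← hΩ]
    exact ⟨Ω, h.even, rfl⟩
  · rw [← hΩ, ← hG, h.G_neg_one, map_zero]

end IsVacuumModule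

end NSAction

/-! ### Transported and normalized scalar products, and the main theorem -/

/-- Transport of a scalar product along a linear equivalence. -/
noncomputable abbrev coreTransport {V W : Type*} [AddCommGroup V] [Module ℂ V] [AddCommGroup W]
    [Module ℂ W] (ip : InnerProductSpace.Core ℂ V) (φ : V ≃ₗ[ℂ] W) :
    InnerProductSpace.Core ℂ W where
  inner x y := ip.inner (φ.symm x) (φ.symm y)
  conj_inner_symm _ _ := ip.conj_inner_symm _ _
  re_inner_nonneg _ := ip.re_inner_nonneg _
  add_left _ _ _ := by rw [map_add, ip.add_left]
  smul_left _ _ _ := by rw [map_smul, ip.smul_left]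
  definite x hx := by simpa using ip.definite _ hx

theorem coreInner_self {V : Type*} [AddCommGroup V] [Module ℂ V]
    (ip : InnerProductSpace.Core ℂ V) {Ω : V} (hΩ : Ω ≠ 0) :
    ∃ r : ℝ, 0 < r ∧ ip.inner Ω Ω = r := by
  have h : ip.inner Ω Ω = ((ip.inner Ω Ω).re : ℂ) :=
    (Complex.conj_eq_iff_real.1 (ip.conj_inner_symm Ω Ω)).elim fun r hr => by rw [hr]; simp
  refine ⟨_, lt_of_le_of_ne (ip.re_inner_nonneg Ω) fun e => hΩ (ip.definite _ ?_), h⟩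
  rw [h]
  exact_mod_cast e.symm

/-- The scalar product rescaled such that `Ω` is normalized. -/
noncomputable abbrev coreNormalized {V : Type*} [AddCommGroup V] [Module ℂ V]
    (ip : InnerProductSpace.Core ℂ V) {Ω : V} (hΩ : Ω ≠ 0) : InnerProductSpace.Core ℂ V where
  inner x y := ip.inner x y / ip.inner Ω Ω
  conj_inner_symm x y := by rw [map_div₀, ip.conj_inner_symm, ip.conj_inner_symm]
  re_inner_nonneg x := by
    obtain ⟨r, hr, e⟩ := coreInner_self ip hΩ
    rw [e]
    change 0 ≤ (ip.inner x x / (r : ℂ)).re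
    rw [Complex.div_ofReal_re]
    exact div_nonneg (ip.re_inner_nonneg x) hr.le
  add_left x y z := by rw [ip.add_left, add_div]
  smul_left x y a := by rw [ip.smul_left, mul_div_assoc]
  definite x hx := by
    obtain ⟨r, hr, e⟩ := coreInner_self ip hΩ
    refine ip.definite _ ((div_eq_zero_iff.1 hx).resolve_right ?_)
    rw [e]
    exact_mod_cast hr.ne'

theorem mainTheorem5 {V : Type*} [AddCommGroup V] [Module ℂ V]
    (c : ℝ) (hc : 3 / 2 ≤ c)
    (ρ : NSAction V) (hρ : ρ.IsRepresentation (c : ℂ))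
    (Ω : V) (hΩ : ρ.IsCyclicLowestWeight Ω 0) (hΩ_even : Ω ∈ ρ.parity 0)
    (ip : InnerProductSpace.Core ℂ V) (hip : ρ.IsWeaklySymmetric ip) :
    -- the representation is unitary with respect to the given scalar product
    ρ.IsUnitary ip ∧
    -- the representation carries a VOSA structure `S` with central charge `c`, which is simple,
    -- and unitary for the normalized scalar product
    ∃ (S : VOSA V) (ip₁ : InnerProductSpace.Core ℂ V),
      S.IsStructureOn ρ Ω (c : ℂ) ∧
      S.IsSimple ∧
      (∀ x y : V, ip₁.inner x y = ip.inner x y / ip.inner Ω Ω) ∧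
      S.IsUnitary ip₁ ∧
      -- and it is unitarily isomorphic to the super-Virasoro VOSA `V^c(NS)`
      ∃ (S' : VOSA (SuperVirasoro (c : ℂ))) (ip' : InnerProductSpace.Core ℂ (SuperVirasoro (c : ℂ)))
        (φ : V ≃ₗ[ℂ] SuperVirasoro (c : ℂ)),
        SuperVirasoro.IsVOSA (c : ℂ) S' ∧
        S'.IsUnitary ip' ∧
        S.IsIso S' φ ∧
        ∀ x y : V, ip'.inner (φ x) (φ y) = ip₁.inner x y := by
  have hu := NSAction.isUnitary_of_isWeaklySymmetric hρ hΩ hip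
  have h := NSAction.isVacuumModule_of_isUnitary hρ hΩ hΩ_even hu
  -- Rescaling a scalar product does not change adjoints.
  have hu₁ : ρ.IsUnitary (coreNormalized ip hΩ.ne_zero) :=
    ⟨fun m x y => congrArg (· / ip.inner Ω Ω) (hu.1 m x y),
      fun r x y => congrArg (· / ip.inner Ω Ω) (hu.2 r x y)⟩
  have hn : (coreNormalized ip hΩ.ne_zero).inner Ω Ω = 1 :=
    div_self fun e => hΩ.ne_zero (ip.definite _ e)
  have h' := h.superVirasoro_isVacuumModule hu
  set φ := (h.superVirasoroEquiv hu).symm with hφ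
  have hL : ∀ m x, φ (ρ.L m x) = _ := h.superVirasoroEquiv_symm_L hu
  have hG : ∀ r x, φ (ρ.G r x) = _ := h.superVirasoroEquiv_symm_G hu
  have hv : φ Ω = _ := h.superVirasoroEquiv_symm_vac hu
  have hip' : ∀ x y, (coreTransport (coreNormalized ip hΩ.ne_zero) φ).inner (φ x) (φ y) =
      (coreNormalized ip hΩ.ne_zero).inner x y := fun x y => by
    change (coreNormalized ip hΩ.ne_zero).inner (φ.symm (φ x)) (φ.symm (φ y)) = _
    rw [φ.symm_apply_apply, φ.symm_apply_apply]
  -- The scalar product on the quotient is the one that makes φ unitary; as φ intertwines the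
  -- generators, unitarity of the action carries over.
  have hu' : (SuperVirasoro.action (c : ℂ)).IsUnitary
      (coreTransport (coreNormalized ip hΩ.ne_zero) φ) := by
    refine ⟨fun m x y => ?_, fun r x y => ?_⟩ <;>
      obtain ⟨x, rfl⟩ := φ.surjective x <;> obtain ⟨y, rfl⟩ := φ.surjective y
    · rw [← hL, ← hL, hip', hip', hu₁.1]
    · rw [← hG, ← hG, hip', hip', hu₁.2]
  refine ⟨hu, h.vosa, coreNormalized ip hΩ.ne_zero, h.vosa_isStructureOn, h.vosa_isSimple hu,
    fun _ _ => rfl, h.vosa_isUnitary hu₁ hn, h'.vosa, coreTransport _ φ, φ, h'.vosa_isStructureOn,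
    h'.vosa_isUnitary hu' ?_, h.vosa_isIso h' φ hL hG hv, hip'⟩
  rw [← hv, hip', hn]
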